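/- Let $A=B=C=\mathbb C^5$ with standard bases $(a_i)$, $(b_j)$, $(c_k)$, $1\le i,j,k\le 5$. Let $T\in A\otimes B\otimes C$. - $T$ is *concise* if the three induced linear maps $T_A:A^*\to B\otimes C$, $T_B:B^*\to A\otimes C$, $T_C:C^*\to A\otimes B$ are injective. - $T$ is *$1$-degenerate* if none of the three images $T(A^*)$, $T(B^*)$, $T(C^*)$ contains an element of (matrix) rank $5$. - The *border rank* of $T$ is the smallest $r$ such that $T$ is a limit of sums of $r$ rank one tensors, and a concise $T$ has *minimal border rank* if its border rank is $5$. The group $G=\mathrm{GL}_5(\mathbb C)^{\times 3}\rtimes\mathfrak S_3$ acts on $A\otimes B\otimes C$, where $\mathfrak S_3$ permutes the three factors. Put $$T_{M1}=a_1\otimes(b_1\otimes c_1+b_2\otimes c_2+b_3\otimes c_3+b_4\otimes c_4)+a_2\otimes b_3\otimes c_1+a_3\otimes b_4\otimes c_1+a_4\otimes b_4\otimes c_2+a_5\otimes(b_5\otimes c_1+b_4\otimes c_5),$$ $$T_{M2}=a_1\otimes(b_1\otimes c_1+b_2\otimes c_2+b_3\otimes c_3+b_4\otimes c_4)+a_2\otimes(b_3\otimes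 c_1-b_4\otimes c_2)+a_3\otimes b_4\otimes c_1+a_4\otimes b_3\otimes c_2+a_5\otimes(b_5\otimes c_1+b_4\otimes c_5),$$ and $$\begin{aligned}T_{O_{58}}&=T_{M2}+a_5\otimes(b_1\otimes c_2-b_3\otimes c_4),& T_{O_{57}}&=T_{M2},& T_{O_{56}}&=T_{M1}+a_5\otimes b_2\otimes c_2,\\ T_{O_{55}}&=T_{M1}+a_5\otimes b_3\otimes c_2,& T_{O_{54}}&=T_{M1}.\end{aligned}$$ **Theorem.** Up to the action of $G$ there are exactly five concise $1$-degenerate tensors of minimal border rank in $\mathbb C^5\otimes\mathbb C^5\otimes\mathbb C^5$, namely $T_{O_{58}},T_{O_{57}},T_{O_{56}},T_{O_{55}},T_{O_{54}}$. That is, these five tensors are concise, $1$-degenerate and of minimal border rank, they lie in pairwise distinct $G$-orbits, and every concise $1$-degenerate tensor of minimal border rank lies in the $G$-orbit of one of them. Their contractions with $x=(x_1,\dots,x_5)\in A^*$, written as matrices with rows indexed by $C$ and columns by $B$, are, in the order $T_{O_{58}},\dots,T_{O_{54}}$, $$\begin{pmatrix}x_1&0&x_2&x_3&x_5\\x_5&x_1&x_4&-x_2&0\\0&0&x_1&0&0\\0&0&-x_5&x_1&0\\0&0&0&x_5&0\end{pmatrix},\quad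 \begin{pmatrix}x_1&0&x_2&x_3&x_5\\0&x_1&x_4&-x_2&0\\0&0&x_1&0&0\\0&0&0&x_1&0\\0&0&0&x_5&0\end{pmatrix},\quad \begin{pmatrix}x_1&0&x_2&x_3&x_5\\0&x_1+x_5&0&x_4&0\\0&0&x_1&0&0\\0&0&0&x_1&0\\0&0&0&x_5&0\end{pmatrix},$$ $$\begin{pmatrix}x_1&0&x_2&x_3&x_5\\0&x_1&x_5&x_4&0\\0&0&x_1&0&0\\0&0&0&x_1&0\\0&0&0&x_5&0\end{pmatrix},\quad \begin{pmatrix}x_1&0&x_2&x_3&x_5\\0&x_1&0&x_4&0\\0&0&x_1&0&0\\0&0&0&x_1&0\\0&0&0&x_5&0\end{pmatrix}.$$ Moreover, each subsequent tensor lies in the closure of the $G$-orbit of the previous one: $T_{O_{57}}\in\overline{G\cdot T_{O_{58}}}$, $T_{O_{56}}\in\overline{G\cdot T_{O_{57}}}$, $T_{O_{55}}\in\overline{G\cdot T_{O_{56}}}$, $T_{O_{54}}\in\overline{G\cdot T_{O_{55}}}$. -/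

import Mathlib

/-- The space `ℂ^m ⊗ ℂ^m ⊗ ℂ^m` in coordinates: the tensor `T` has the coefficient `T ![i, j, k]`
at `a_i ⊗ b_j ⊗ c_k`. An index is a function `x : Fin 3 → Fin m`, where `x 0`, `x 1`, `x 2` belong
to the factors `A`, `B`, `C`. The topology is the Euclidean one. -/
abbrev Tensor3 (m : ℕ) : Type := (Fin 3 → Fin m) → ℂ

/-- The decomposable tensor `a ⊗ b ⊗ c`. -/
def pureTensor {m : ℕ} (a b c : Fin m → ℂ) : Tensor3 m :=
  fun x => a (x 0) * b (x 1) * c (x 2)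

/-- `IsSumOfPure r T`: the tensor `T` is a sum of `r` decomposable tensors
(the zero tensor being admitted as a summand), i.e. `T` has rank at most `r`. -/
def IsSumOfPure {m : ℕ} (r : ℕ) (T : Tensor3 m) : Prop :=
  ∃ a b c : Fin r → Fin m → ℂ, T = ∑ s, pureTensor (a s) (b s) (c s)

/-- The border rank: the smallest `r` such that `T` is a limit of tensors of rank at most `r`. -/
noncomputable def borderRank {m : ℕ} (T : Tensor3 m) : ℕ :=
  sInf {r : ℕ | T ∈ closure {S : Tensor3 m | IsSumOfPure r S}}

/-- Minimal border rank, for concise tensors in `ℂ^m ⊗ ℂ^m ⊗ ℂ^m`. -/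
def HasMinimalBorderRank {m : ℕ} (T : Tensor3 m) : Prop := borderRank T = m

/-- The map `T_A : A^* → B ⊗ C`. The element `α ∈ A^*` is given by its coordinates in the dual
basis. Elements of `B ⊗ C` are written as matrices with rows indexed by `C` and columns by `B`. -/
def contractA {m : ℕ} (T : Tensor3 m) : (Fin m → ℂ) →ₗ[ℂ] Matrix (Fin m) (Fin m) ℂ where
  toFun α := Matrix.of fun k j => ∑ i, α i * T ![i, j, k]
  map_add' α β := by
    ext k j
    simp [add_mul, Finset.sum_add_distrib]
  map_smul' t α := by
    ext k j
    simp [Finset.mul_sum, mul_assoc]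

/-- The map `T_B : B^* → A ⊗ C`; rows are indexed by `C` and columns by `A`. -/
def contractB {m : ℕ} (T : Tensor3 m) : (Fin m → ℂ) →ₗ[ℂ] Matrix (Fin m) (Fin m) ℂ where
  toFun β := Matrix.of fun k i => ∑ j, β j * T ![i, j, k]
  map_add' α β := by
    ext k j
    simp [add_mul, Finset.sum_add_distrib]
  map_smul' t α := by
    ext k j
    simp [Finset.mul_sum, mul_assoc]

/-- The map `T_C : C^* → A ⊗ B`; rows are indexed by `B` and columns by `A`. -/
def contractC {m : ℕ} (T : Tensor3 m) : (Fin m → ℂ) →ₗ[ℂ] Matrix (Fin m) (Fin m) ℂ where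
  toFun γ := Matrix.of fun j i => ∑ k, γ k * T ![i, j, k]
  map_add' α β := by
    ext k j
    simp [add_mul, Finset.sum_add_distrib]
  map_smul' t α := by
    ext k j
    simp [Finset.mul_sum, mul_assoc]

/-- `T` is concise: `T_A`, `T_B` and `T_C` are injective. -/
def IsConcise {m : ℕ} (T : Tensor3 m) : Prop :=
  Function.Injective (contractA T) ∧ Function.Injective (contractB T) ∧
    Function.Injective (contractC T)

/-- `T` is `1_*`-generic: at least one of the spaces `T(A^*)`, `T(B^*)`, `T(C^*)` contains
an element of rank `m`. -/
def IsOneStarGeneric {m : ℕ} (T : Tensor3 m) : Prop :=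
  (∃ α, (contractA T α).rank = m) ∨ (∃ β, (contractB T β).rank = m) ∨
    (∃ γ, (contractC T γ).rank = m)

/-- `T` is `1`-degenerate: it is not `1_*`-generic. -/
def IsOneDegenerate {m : ℕ} (T : Tensor3 m) : Prop := ¬ IsOneStarGeneric T

/-- The group `GL_m(ℂ)^{×3} ⋊ S_3`, where `S_3` permutes the three factors:
`(σ • g) p = g (σ⁻¹ p)`. -/
abbrev TensorGroup (m : ℕ) : Type :=
  (Fin 3 → GL (Fin m) ℂ) ⋊[mulAutArrow (G := Equiv.Perm (Fin 3)) (A := Fin 3)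
    (M := GL (Fin m) ℂ)] Equiv.Perm (Fin 3)

/-- The action of `(g, σ)`: first permute the factors by `σ`, then apply `g 0 ⊗ g 1 ⊗ g 2`. -/
noncomputable def tensorAct {m : ℕ} (g : Fin 3 → GL (Fin m) ℂ) (σ : Equiv.Perm (Fin 3))
    (T : Tensor3 m) : Tensor3 m :=
  fun x => ∑ y : Fin 3 → Fin m,
    (∏ p : Fin 3, (g p : Matrix (Fin m) (Fin m) ℂ) (x p) (y p)) * T (y ∘ σ)

/-- The action of `GL_m(ℂ)^{×3} ⋊ S_3` on `ℂ^m ⊗ ℂ^m ⊗ ℂ^m`. -/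
noncomputable instance tensorGroupAction (m : ℕ) : MulAction (TensorGroup m) (Tensor3 m) where
  smul h T := tensorAct h.left h.right T
  one_smul T := by
    funext x
    change tensorAct 1 1 T x = T x
    unfold tensorAct
    rw [Finset.sum_eq_single x]
    · simp
    · intro y _ hy
      obtain ⟨p, hp⟩ := Function.ne_iff.mp hy
      rw [Finset.prod_eq_zero (Finset.mem_univ p), zero_mul]
      simp [Ne.symm hp]
    · simp
  mul_smul h h' T := by
    funext x
    change tensorAct (h * h').left (h * h').right T x =
      tensorAct h.left h.right (tensorAct h'.left h'.right T) x
    obtain ⟨g, σ⟩ := h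
    obtain ⟨g', τ⟩ := h'
    have key : ∀ p, ((⟨g, σ⟩ : TensorGroup m) * (⟨g', τ⟩ : TensorGroup m)).left p
        = g p * g' (σ⁻¹ p) := fun p => rfl
    have key2 : ((⟨g, σ⟩ : TensorGroup m) * (⟨g', τ⟩ : TensorGroup m)).right = σ * τ := rfl
    unfold tensorAct
    simp only [key, key2, Units.val_mul, Matrix.mul_apply]
    simp_rw [Finset.prod_univ_sum, Fintype.piFinset_univ, Finset.sum_mul, Finset.mul_sum]
    rw [Finset.sum_comm]
    refine Finset.sum_congr rfl fun z _ => ?_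
    refine Fintype.sum_equiv (Equiv.arrowCongr σ⁻¹ (Equiv.refl _)) _ _ fun y => ?_
    have h1 : ((Equiv.arrowCongr σ⁻¹ (Equiv.refl (Fin m))) y : Fin 3 → Fin m) = y ∘ σ := by
      funext p
      rfl
    rw [h1, Finset.prod_mul_distrib, mul_assoc]
    congr 1
    have h2 : (∏ p, (g' (σ⁻¹ p) : Matrix (Fin m) (Fin m) ℂ) (z p) (y p))
        = ∏ p, (g' p : Matrix (Fin m) (Fin m) ℂ) ((z ∘ σ) p) ((y ∘ σ) p) := by
      rw [← Equiv.prod_comp σ]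
      simp
    rw [h2]
    rfl

/-- The tensor `a_i ⊗ b_j ⊗ c_k` of basis vectors, numbered from `0`. -/
def basisTensor (i j k : Fin 5) : Tensor3 5 :=
  pureTensor (Pi.single i 1) (Pi.single j 1) (Pi.single k 1)

/-- The tensor `T_{M1}`; the basis vectors `a_1, …, a_5` have the indices `0, …, 4`,
and similarly for `b` and `c`. -/
def tensorM1 : Tensor3 5 :=
  basisTensor 0 0 0 + basisTensor 0 1 1 + basisTensor 0 2 2 + basisTensor 0 3 3
    + basisTensor 1 2 0 + basisTensor 2 3 0 + basisTensor 3 3 1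
    + (basisTensor 4 4 0 + basisTensor 4 3 4)

/-- The tensor `T_{M2}`. -/
def tensorM2 : Tensor3 5 :=
  basisTensor 0 0 0 + basisTensor 0 1 1 + basisTensor 0 2 2 + basisTensor 0 3 3
    + (basisTensor 1 2 0 - basisTensor 1 3 1) + basisTensor 2 3 0 + basisTensor 3 2 1
    + (basisTensor 4 4 0 + basisTensor 4 3 4)

/-- The tensor `T_{O58}`. -/
def tensorO58 : Tensor3 5 := tensorM2 + (basisTensor 4 0 1 - basisTensor 4 2 3)

/-- The tensor `T_{O57}`. -/
def tensorO57 : Tensor3 5 := tensorM2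

/-- The tensor `T_{O56}`. -/
def tensorO56 : Tensor3 5 := tensorM1 + basisTensor 4 1 1

/-- The tensor `T_{O55}`. -/
def tensorO55 : Tensor3 5 := tensorM1 + basisTensor 4 2 1

/-- The tensor `T_{O54}`. -/
def tensorO54 : Tensor3 5 := tensorM1

/-- The list `T_{O58}, T_{O57}, T_{O56}, T_{O55}, T_{O54}`. -/
def fiveTensors : Fin 5 → Tensor3 5 :=
  ![tensorO58, tensorO57, tensorO56, tensorO55, tensorO54]

/-! # Concise 1-degenerate tensors of minimal border rank in dimension five

A tensor is treated as a trilinear form `T` on `M × N × P`, where `M = A^*`, `N = B^*`, `P = C^*`.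

*Every such tensor is one of the five.* The triples `(X, Y, Z)` of endomorphisms with
`T (X m) n p = T m (Y n) p = T m n (Z p)` form a commutative algebra `R`. A concise sum of five
decomposable tensors is a unit tensor in suitable bases, so the diagonal matrices give `dim R ≥ 5`;
as `R` is the kernel of a linear system depending linearly on the tensor, the inequality persists
for limits (`le_finrank_formAlgebra`). If some `m : M` had trivial annihilator in `R`, then
`R m = M` by dimension, and the slice of `T` by `m` would be nondegenerate, which `1`-degeneracy
excludes. Hence none of the three modules has a vector with trivial annihilator in `R`, and some
primitive idempotent of `R` has the same defect. A study of the socles shows that it is the same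
idempotent for the three modules, that it equals `1`, and that the nilradical `J` of the local
algebra `R` has square zero and rank three on each module (`IsBalancedForm.local_structure`).

Put `V₁ = J M`, `V₂ = J N`, `V₃ = J P`. Then `T` vanishes as soon as two arguments lie in these
subspaces, and the slices of `T` by `V₁` are bilinear forms on the planes `N / V₂` and `P / V₃`.
They form a hyperplane, the kernel of one relation in the four-dimensional space
`N / V₂ ⊗ P / V₃`; likewise for the two other factors. The four-dimensional ideal
inside `J` gives a family `τ` of trilinear forms on the three quotient planes compatible
with all three relations (`exists_isQuotientPlaneForm`). The size of this family forces the three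
relations to have ranks `(2, 2, 2)`, `(2, 1, 1)` or `(1, 1, 1)`; in the last case the vectors in the
relations agree on all three planes or disagree on one of them, and if they agree, the form may or
may not vanish on them. This leaves five normal forms (`hasFiveTensorValues`): the
remaining coefficients are removed by adding elements of `V₁`, `V₂`, `V₃` to the basis vectors.

*Border rank and degenerations.* The tensor `T_{O58}` is a limit of sums of five decomposable
tensors: it is a combination of tangent vectors to the variety of decomposable tensors at
five points of a twisted cubic, and the corresponding combination of the points themselves is zero
(`tensorO58_mem_closure`). Each of the other tensors is the limit of a one-parameter family in
the orbit of the preceding one (`mem_closure_orbit`), hence has border rank at most five as well.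

*The orbits are different.* The action preserves the loci of slices of given rank: planes of slices
of rank one, and hyperplanes of slices of rank at most two or three, distinguish the five tensors
(`fiveTensors_notMem_orbit`).
-/


/-! ### Balanced trilinear forms over a commutative algebra -/

section Balanced

open Module

set_option linter.unusedSectionVars false

universe u₁ u₂ u₃ u₄

/-- A nondegenerate trilinear form on three faithful modules over a commutative `ℂ`-algebra `R`
which is balanced: an element of `R` may be moved from one argument to another. -/
structure IsBalancedForm (R : Type u₁) {M : Type u₂} {N : Type u₃} {P : Type u₄} [CommRing R]
    [AddCommGroup M] [Module ℂ M] [Module R M] [AddCommGroup N] [Module ℂ N] [Module R N]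
    [AddCommGroup P] [Module ℂ P] [Module R P] (T : M →ₗ[ℂ] N →ₗ[ℂ] P →ₗ[ℂ] ℂ) : Prop where
  smul_left : ∀ (r : R) m n p, T (r • m) n p = T m (r • n) p
  smul_right : ∀ (r : R) m n p, T (r • m) n p = T m n (r • p)
  nondeg₁ : ∀ m, (∀ n p, T m n p = 0) → m = 0
  nondeg₂ : ∀ n, (∀ m p, T m n p = 0) → n = 0
  nondeg₃ : ∀ p, (∀ m n, T m n p = 0) → p = 0
  faithful : ∀ r : R, (∀ m : M, r • m = 0) → r = 0

variable {R : Type u₁} {M : Type u₂} {N : Type u₃} {P : Type u₄} [CommRing R]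
    [AddCommGroup M] [Module ℂ M] [Module R M] [AddCommGroup N] [Module ℂ N] [Module R N]
    [AddCommGroup P] [Module ℂ P] [Module R P] {T : M →ₗ[ℂ] N →ₗ[ℂ] P →ₗ[ℂ] ℂ}

/-- A trilinear form with its first two arguments exchanged. -/
def flipLeft (T : M →ₗ[ℂ] N →ₗ[ℂ] P →ₗ[ℂ] ℂ) : N →ₗ[ℂ] M →ₗ[ℂ] P →ₗ[ℂ] ℂ := T.flip

/-- A trilinear form with its last two arguments exchanged. -/
def flipRight (T : M →ₗ[ℂ] N →ₗ[ℂ] P →ₗ[ℂ] ℂ) : M →ₗ[ℂ] P →ₗ[ℂ] N →ₗ[ℂ] ℂ :=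
  LinearMap.lflip.toLinearMap ∘ₗ T

@[simp] lemma flipLeft_apply (T : M →ₗ[ℂ] N →ₗ[ℂ] P →ₗ[ℂ] ℂ) (m n p) :
    flipLeft T n m p = T m n p := rfl

@[simp] lemma flipRight_apply (T : M →ₗ[ℂ] N →ₗ[ℂ] P →ₗ[ℂ] ℂ) (m n p) :
    flipRight T m p n = T m n p := rfl

lemma IsBalancedForm.flipLeft (h : IsBalancedForm R T) : IsBalancedForm R (flipLeft T) where
  smul_left r n m p := by simp [h.smul_left]
  smul_right r n m p := by simp [← h.smul_left, h.smul_right]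
  nondeg₁ n hn := h.nondeg₂ n fun m p => hn m p
  nondeg₂ m hm := h.nondeg₁ m fun n p => hm n p
  nondeg₃ p hp := h.nondeg₃ p fun m n => hp n m
  faithful r hr := h.faithful r fun m => h.nondeg₁ _ fun n p => by simp [h.smul_left, hr]

lemma IsBalancedForm.flipRight (h : IsBalancedForm R T) : IsBalancedForm R (flipRight T) where
  smul_left r m p n := by simp [h.smul_right]
  smul_right r m p n := by simp [h.smul_left]
  nondeg₁ m hm := h.nondeg₁ m fun n p => hm p n
  nondeg₂ p hp := h.nondeg₃ p fun m n => hp m n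
  nondeg₃ n hn := h.nondeg₂ n fun m p => hn m p
  faithful := h.faithful

/-- If, for every `n`, some nonzero `s ∈ D` satisfies `T s n = 0`, then `D` is not a line. -/
lemma two_le_finrank_of_forall_exists [FiniteDimensional ℂ M]
    (hT : ∀ m, (∀ n p, T m n p = 0) → m = 0) (D : Submodule ℂ M)
    (h₂ : ∀ n, ∃ s ∈ D, s ≠ 0 ∧ ∀ p, T s n p = 0) : 2 ≤ finrank ℂ D := by
  by_contra hlt
  obtain ⟨s, hs, hs0, -⟩ := h₂ 0
  have h1 : finrank ℂ D = 1 := by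
    have : 0 < finrank ℂ D := by
      rw [Module.finrank_pos_iff_exists_ne_zero]
      exact ⟨⟨s, hs⟩, by simpa [Subtype.ext_iff] using hs0⟩
    omega
  refine hs0 (hT s fun n p => ?_)
  obtain ⟨s', hs', hs0', h'⟩ := h₂ n
  obtain ⟨c, hc⟩ := (finrank_eq_one_iff_of_nonzero' (⟨s', hs'⟩ : D)
    (by simpa [Subtype.ext_iff] using hs0')).1 h1 ⟨s, hs⟩
  have : s = c • s' := by simpa [Subtype.ext_iff] using hc.symm
  rw [this]
  simp [h']

/-- In a plane, two vectors become proportional modulo a nonzero vector, so a linear map on a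
plane with a kernel has rank at most one. -/
lemma apply_mul_apply_comm_of_finrank_le_two {V : Type*} [AddCommGroup V] [Module ℂ V]
    [FiniteDimensional ℂ V] {Q : Type*} (D : Submodule ℂ V) (hD : finrank ℂ D ≤ 2)
    (L : Q → V →ₗ[ℂ] ℂ) (h : ∃ s ∈ D, s ≠ 0 ∧ ∀ q, L q s = 0) (x y : V) (hx : x ∈ D)
    (hy : y ∈ D) (q q' : Q) : L q x * L q' y = L q' x * L q y := by
  obtain ⟨s, hs, hs0, hL⟩ := h
  have hdep : ¬ LinearIndependent ℂ ![(⟨s, hs⟩ : D), ⟨x, hx⟩, ⟨y, hy⟩] := by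
    intro hli
    have := hli.fintype_card_le_finrank
    simp at this
    omega
  obtain ⟨g, hg, i, hi⟩ := Fintype.not_linearIndependent_iff.1 hdep
  have hg' : g 0 • s + g 1 • x + g 2 • y = 0 := by
    simpa [Fin.sum_univ_three, Subtype.ext_iff] using hg
  have key : ∀ q, g 1 * L q x + g 2 * L q y = 0 := by
    intro q
    have := congrArg (L q) hg'
    simpa [hL] using this
  have k1 := key q
  have k2 := key q'
  by_cases h1 : g 1 = 0
  · by_cases h2 : g 2 = 0
    · exfalso
      have h0 : g 0 = 0 := by
        rw [h1, h2] at hg'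
        simpa [hs0] using hg'
      fin_cases i <;> simp_all
    · have e1 : L q y = 0 := by simpa [h1, h2] using k1
      have e2 : L q' y = 0 := by simpa [h1, h2] using k2
      rw [e1, e2]; simp
  · refine mul_left_cancel₀ h1 ?_
    linear_combination L q' y * k1 - L q y * k2

/-- A plane of bilinear forms in `N × P` cannot consist of forms whose members become
dependent both after every substitution `n ∈ N` and after every substitution `p ∈ P`. -/
lemma three_le_finrank_of_forall_exists [FiniteDimensional ℂ M]
    (hT : ∀ m, (∀ n p, T m n p = 0) → m = 0) (D : Submodule ℂ M)
    (h₂ : ∀ n, ∃ s ∈ D, s ≠ 0 ∧ ∀ p, T s n p = 0)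
    (h₃ : ∀ p, ∃ s ∈ D, s ≠ 0 ∧ ∀ n, T s n p = 0) : 3 ≤ finrank ℂ D := by
  have htwo := two_le_finrank_of_forall_exists hT D h₂
  by_contra hlt
  have hD : finrank ℂ D ≤ 2 := by omega
  have e₂ : ∀ x ∈ D, ∀ y ∈ D, ∀ n p p', T x n p * T y n p' = T x n p' * T y n p := by
    intro x hx y hy n p p'
    exact apply_mul_apply_comm_of_finrank_le_two D hD
      (fun p => ((T.flip n).flip p)) (h₂ n) x y hx hy p p'
  have e₃ : ∀ x ∈ D, ∀ y ∈ D, ∀ n n' p, T x n p * T y n' p = T x n' p * T y n p := by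
    intro x hx y hy n n' p
    exact apply_mul_apply_comm_of_finrank_le_two D hD
      (fun n => ((T.flip n).flip p)) (h₃ p) x y hx hy n n'
  obtain ⟨s, hs, hs0, -⟩ := h₂ 0
  obtain ⟨n₀, p₀, h0⟩ : ∃ n p, T s n p ≠ 0 := by
    by_contra hcon
    push Not at hcon
    exact hs0 (hT s hcon)
  have hline : D ≤ Submodule.span ℂ {s} := by
    intro x hx
    set c := T x n₀ p₀ / T s n₀ p₀ with hc
    have hy : x - c • s ∈ D := D.sub_mem hx (D.smul_mem _ hs)
    set y := x - c • s with hydef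
    have hy0 : T y n₀ p₀ = 0 := by
      simp only [hydef, map_sub, map_smul, LinearMap.sub_apply, LinearMap.smul_apply, smul_eq_mul,
        hc]
      field_simp
      simp
    have a : ∀ p, T y n₀ p = 0 := fun p => by
      have := e₂ s hs y hy n₀ p₀ p
      rw [hy0, mul_zero] at this
      simpa [h0] using this
    have b : ∀ n, T y n p₀ = 0 := fun n => by
      have := e₃ s hs y hy n₀ n p₀
      rw [hy0, mul_zero] at this
      simpa [h0] using this
    have hyz : y = 0 := by
      refine hT y fun n p => ?_
      have := e₂ s hs y hy (n₀ + n) p₀ p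
      have h2 := e₂ s hs y hy n p₀ p
      simp only [map_add, LinearMap.add_apply, a, b, zero_add, mul_zero, add_mul] at this h2
      rw [h2] at this
      simpa [h0] using this
    rw [Submodule.mem_span_singleton]
    exact ⟨c, by rw [hydef] at hyz; exact (sub_eq_zero.1 hyz).symm⟩
  have := (Submodule.finrank_mono hline).trans (finrank_span_le_card _)
  simp at this
  omega

/-! ### Idempotents and separating vectors -/

/-- The annihilator of some `n : N` meets the ideal generated by `f` trivially. -/
def HasSeparatingVector (f : R) (N : Type u₃) [AddCommGroup N] [Module R N] : Prop :=
  ∃ n : N, ∀ r : R, (r * f) • n = 0 → r * f = 0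

/-- A nonzero idempotent which is not a sum of two nonzero orthogonal idempotents. -/
structure IsPrimitiveIdempotent (f : R) : Prop where
  idem : f * f = f
  ne_zero : f ≠ 0
  eq_or_eq : ∀ g, g * g = g → g * f = g → g = 0 ∨ g = f

lemma IsPrimitiveIdempotent.mul_eq_zero {f f' : R} (hf : IsPrimitiveIdempotent f)
    (hf' : IsPrimitiveIdempotent f') (hne : f ≠ f') : f * f' = 0 := by
  have e : (f * f') * (f * f') = f * f' := by
    linear_combination f' * f' * hf.idem + f * hf'.idem
  rcases hf.eq_or_eq (f * f') e (by linear_combination f' * hf.idem) with h | h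
  · exact h
  rcases hf'.eq_or_eq (f * f') e (by linear_combination f * hf'.idem) with h' | h'
  · exact h'
  · exact absurd (h.symm.trans h') hne

/-- If all idempotents of a decomposition of `1` into primitive ones have separating vectors, then
so does `1`. -/
lemma exists_isPrimitiveIdempotent_not_hasSeparatingVector [IsArtinianRing R]
    {N : Type u₃} [AddCommGroup N] [Module R N] (h : ¬ HasSeparatingVector (1 : R) N) :
    ∃ f : R, IsPrimitiveIdempotent f ∧ ¬ HasSeparatingVector f N := by
  by_contra! hcon
  refine h ?_
  suffices H : ∀ I : Ideal R, ∀ f : R, I = Ideal.span {f} → f * f = f →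
      HasSeparatingVector f N from H _ 1 rfl (by simp)
  intro I
  induction I using WellFoundedLT.induction with
  | ind I ih =>
    intro f hI hf
    by_cases hf0 : f = 0
    · exact ⟨0, by simp [hf0]⟩
    by_cases hp : IsPrimitiveIdempotent f
    · exact hcon f hp
    obtain ⟨g, hg, hgf, hg0, hgne⟩ : ∃ g, g * g = g ∧ g * f = g ∧ g ≠ 0 ∧ g ≠ f := by
      by_contra! hall
      exact hp ⟨hf, hf0, fun g hg hgf => by
        by_cases g0 : g = 0
        · exact Or.inl g0
        · exact Or.inr (hall g hg hgf g0)⟩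
    have hlt : ∀ k : R, k * k = k → k * f = k → k ≠ f → Ideal.span {k} < I := by
      intro k hk hkf hne
      rw [hI]
      refine lt_of_le_of_ne ((Ideal.span_singleton_le_span_singleton).2 ⟨k, by rw [mul_comm, hkf]⟩)
        fun he => hne ?_
      have : f ∈ Ideal.span {k} := by rw [he]; exact Ideal.mem_span_singleton_self f
      obtain ⟨a, ha⟩ := Ideal.mem_span_singleton.1 this
      rw [← hkf, ha]
      linear_combination a * hk
    obtain ⟨n₁, hn₁⟩ := ih _ (hlt g hg hgf hgne) g rfl hg
    have hh : (f - g) * (f - g) = f - g := by linear_combination hf - 2 * hgf + hg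
    obtain ⟨n₂, hn₂⟩ := ih _ (hlt (f - g) hh (by linear_combination hf - hgf)
      (by simpa using hg0)) (f - g) rfl hh
    refine ⟨g • n₁ + (f - g) • n₂, fun r hr => ?_⟩
    have a1 : r * g = 0 := by
      apply hn₁
      have := congrArg (g • ·) hr
      simp only [smul_add, smul_smul, smul_zero] at this
      rw [show g * (r * f * g) = r * g by linear_combination r * g * hgf + r * hg,
        show g * (r * f * (f - g)) = 0 by
          linear_combination r * (f-g) * hgf + r * hgf - r * hg] at this
      simpa using this
    have a2 : r * (f - g) = 0 := by
      apply hn₂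
      have := congrArg ((f - g) • ·) hr
      simp only [smul_add, smul_smul, smul_zero] at this
      rw [show (f - g) * (r * f * g) = 0 by
          linear_combination r * (f-g) * hgf + r * hgf - r * hg,
        show (f - g) * (r * f * (f - g)) = r * (f - g) by
          linear_combination r * f * hh + r * hf - r * hgf] at this
      simpa using this
    linear_combination a1 + a2

/-- The nilpotent elements of the ideal generated by `f`. -/
def radicalAt (f : R) : Ideal R := nilradical R ⊓ Ideal.span {f}

lemma mul_eq_of_mem_radicalAt {f j : R} (hf : f * f = f) (hj : j ∈ radicalAt f) : j * f = j := by
  obtain ⟨a, rfl⟩ := Ideal.mem_span_singleton.1 hj.2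
  linear_combination a * hf

variable [Algebra ℂ R] [FiniteDimensional ℂ R]

lemma isArtinianRing_of_finiteDimensional : IsArtinianRing R := isArtinian_of_tower ℂ inferInstance

lemma isNoetherianRing_of_finiteDimensional : IsNoetherianRing R :=
  isNoetherian_of_tower ℂ inferInstance

/-- Over `ℂ`, an element of the corner of a primitive idempotent is a scalar plus a nilpotent. -/
lemma IsPrimitiveIdempotent.exists_isNilpotent {f : R} (hf : IsPrimitiveIdempotent f) (r : R) :
    ∃ c : ℂ, IsNilpotent ((r - algebraMap ℂ R c) * f) := by
  have := isArtinianRing_of_finiteDimensional (R := R)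
  let V : Submodule ℂ R := LinearMap.range (LinearMap.mulLeft ℂ f)
  have hV : ∀ x ∈ V, LinearMap.mulLeft ℂ r x ∈ V := by
    rintro _ ⟨x, rfl⟩
    exact ⟨r * x, by simp; ring⟩
  have hfV : f ∈ V := ⟨1, by simp⟩
  have : Nontrivial V := ⟨⟨⟨f, hfV⟩, 0, by simpa [Subtype.ext_iff] using hf.ne_zero⟩⟩
  obtain ⟨c, hc⟩ := Module.End.exists_eigenvalue ((LinearMap.mulLeft ℂ r).restrict hV)
  obtain ⟨⟨x, hxV⟩, hx⟩ := hc.exists_hasEigenvector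
  have hx0 : x ≠ 0 := by simpa [Subtype.ext_iff] using hx.2
  have hrx : r * x = algebraMap ℂ R c * x := by
    have := hx.apply_eq_smul
    rw [Subtype.ext_iff] at this
    simpa [Algebra.smul_def] using this
  have hfx : f * x = x := by
    obtain ⟨z, rfl⟩ := hxV
    simp only [LinearMap.mulLeft_apply]
    linear_combination z * hf.idem
  refine ⟨c, ?_⟩
  set y := (r - algebraMap ℂ R c) * f with hy
  have hyx : y * x = 0 := by rw [hy]; linear_combination (r - algebraMap ℂ R c) * hfx + hrx
  have hyf : y * f = y := by rw [hy]; linear_combination (r - algebraMap ℂ R c) * hf.idem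
  obtain ⟨n, s, hs⟩ := IsArtinian.exists_pow_succ_smul_dvd y (1 : R)
  simp only [smul_eq_mul, mul_one, Nat.succ_eq_add_one] at hs
  have hk : ∀ k : ℕ, y ^ (n + 1) = y ^ (n + 1 + k) * s ^ k := by
    intro k
    induction k with
    | zero => simp
    | succ k ih =>
      rw [ih]
      have : y ^ (n + 1 + k) = y ^ (1 + k) * y ^ n := by ring
      rw [this, ← hs]
      ring
  set g := y ^ (n + 1) * s ^ (n + 1) with hg
  have hgg : g * g = g := by
    rw [hg]; linear_combination (-s ^ (n + 1)) * hk (n + 1)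
  have hgf : g * f = g := by
    rw [hg]; linear_combination y ^ n * s ^ (n + 1) * hyf
  rcases hf.eq_or_eq g hgg hgf with h | h
  · refine ⟨n + 1, ?_⟩
    rw [hk (n + 1)]
    linear_combination y ^ (n + 1) * h
  · exfalso
    apply hx0
    rw [← hfx, ← h, hg]
    linear_combination y ^ n * s ^ (n + 1) * hyx

/-! ### The radical of a primitive idempotent and its socle -/

variable [IsScalarTower ℂ R M] [IsScalarTower ℂ R N] [IsScalarTower ℂ R P]
  [FiniteDimensional ℂ M] [FiniteDimensional ℂ N] [FiniteDimensional ℂ P]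

/-- The part of `J M` annihilated by `J`, where `J` is the radical at `f`. -/
def socleAt (f : R) (M : Type u₂) [AddCommGroup M] [Module R M] : Submodule R M :=
  (radicalAt f • ⊤) ⊓ Submodule.torsionBySet R M (radicalAt f)

lemma exists_mem_ne_zero_of_isNilpotent {J : Ideal R} (hJ : IsNilpotent J) (S : Submodule R M)
    (hS : S ≠ ⊥) : ∃ s ∈ S, s ≠ 0 ∧ ∀ j ∈ J, j • s = 0 := by
  obtain ⟨k, hk⟩ := hJ
  have hex : ∃ k, J ^ k • S = ⊥ := ⟨k, by rw [hk]; simp⟩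
  classical
  have hpos : Nat.find hex ≠ 0 := by
    intro h0
    have := Nat.find_spec hex
    rw [h0] at this
    simp at this
    exact hS this
  obtain ⟨k', hk'⟩ := Nat.exists_eq_succ_of_ne_zero hpos
  have h1 : J ^ k' • S ≠ ⊥ := Nat.find_min hex (by omega)
  have h2 : J ^ (k' + 1) • S = ⊥ := by
    have := Nat.find_spec hex
    rwa [hk'] at this
  obtain ⟨s, hs, hs0⟩ := Submodule.exists_mem_ne_zero_of_ne_bot h1
  refine ⟨s, Submodule.smul_le_right hs, hs0, fun j hj => ?_⟩
  have : j • s ∈ J ^ (k' + 1) • S := by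
    rw [pow_succ', mul_smul]
    exact Submodule.smul_mem_smul hj hs
  rw [h2] at this
  simpa using this

lemma isNilpotent_radicalAt [IsNoetherianRing R] (f : R) : IsNilpotent (radicalAt f) := by
  obtain ⟨k, hk⟩ := IsNoetherianRing.isNilpotent_nilradical R
  refine ⟨k, ?_⟩
  have : radicalAt f ^ k ≤ nilradical R ^ k := Ideal.pow_right_mono inf_le_left k
  rw [hk] at this
  simpa using this

/-- If `N` has no separating vector at `f`, every `n : N` is orthogonal to a nonzero element of
the socle of `M`: an element `r` annihilating `n` makes `r M` orthogonal to `n`. -/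
lemma IsBalancedForm.exists_mem_socleAt (h : IsBalancedForm R T) {f : R}
    (hf : IsPrimitiveIdempotent f) (hN : ¬ HasSeparatingVector f N) (n : N) :
    ∃ s ∈ (socleAt f M).restrictScalars ℂ, s ≠ 0 ∧ ∀ p, T s n p = 0 := by
  have := isNoetherianRing_of_finiteDimensional (R := R)
  unfold HasSeparatingVector at hN
  push Not at hN
  have hmem : ∀ {x : R}, x * f = x → IsNilpotent x → x ∈ radicalAt f := fun {x} hx hnil =>
    ⟨hnil, Ideal.mem_span_singleton.2 ⟨x, by rw [mul_comm, hx]⟩⟩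
  -- an element of the corner with `f n ≠ 0` that kills `n` is nilpotent
  have hcorner : ∀ n : N, f • n ≠ 0 → ∃ j ∈ radicalAt f, j ≠ 0 ∧ j • n = 0 := by
    intro n hfn
    obtain ⟨r, hr, hr0⟩ := hN n
    obtain ⟨c, hc⟩ := hf.exists_isNilpotent r
    have hc0 : c = 0 := by
      by_contra hc0
      obtain ⟨k, hk⟩ := hc
      apply hfn
      have hstep : ∀ i : ℕ, ((r - algebraMap ℂ R c) * f) ^ i • (f • n) = (-c) ^ i • (f • n) := by
        intro i
        induction i with
        | zero => simp
        | succ i ih =>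
          rw [pow_succ', mul_smul, ih, smul_comm, smul_smul,
            show (r - algebraMap ℂ R c) * f * f = r * f - algebraMap ℂ R c * f by
              linear_combination (r - algebraMap ℂ R c) * hf.idem, sub_smul, hr, mul_smul,
            algebraMap_smul, zero_sub, pow_succ, mul_smul, neg_smul]
      have := hstep k
      rw [hk, zero_smul] at this
      exact (smul_eq_zero.1 this.symm).resolve_left (pow_ne_zero _ (neg_ne_zero.2 hc0))
    rw [hc0] at hc
    simp only [map_zero, sub_zero] at hc
    exact ⟨r * f, hmem (by linear_combination r * hf.idem) hc, hr0, hr⟩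
  obtain ⟨j, hj, hj0, hjn⟩ : ∃ j ∈ radicalAt f, j ≠ 0 ∧ j • n = 0 := by
    by_cases hfn : f • n = 0
    · obtain ⟨n', hn'⟩ : ∃ n' : N, f • n' ≠ 0 := by
        by_contra! hall
        exact hf.ne_zero (h.flipLeft.faithful f hall)
      obtain ⟨j, hj, hj0, -⟩ := hcorner n' hn'
      refine ⟨j, hj, hj0, ?_⟩
      rw [← mul_eq_of_mem_radicalAt hf.idem hj, mul_smul, hfn, smul_zero]
    · exact hcorner n hfn
  have hS : (Ideal.span {j} • ⊤ : Submodule R M) ≠ ⊥ := by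
    intro hbot
    refine hj0 (h.faithful j fun m => ?_)
    have : j • m ∈ (Ideal.span {j} • ⊤ : Submodule R M) :=
      Submodule.smul_mem_smul (Ideal.mem_span_singleton_self j) trivial
    rw [hbot] at this
    simpa using this
  obtain ⟨s, hs, hs0, hsJ⟩ :=
    exists_mem_ne_zero_of_isNilpotent (isNilpotent_radicalAt f) _ hS
  refine ⟨s, ⟨Submodule.smul_mono_left ((Ideal.span_singleton_le_iff_mem _).2 hj) hs, ?_⟩, hs0, ?_⟩
  · simp only [SetLike.mem_coe, Submodule.mem_torsionBySet_iff]
    exact fun a => hsJ a a.2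
  · intro p
    rw [Submodule.ideal_span_singleton_smul] at hs
    obtain ⟨m, -, rfl⟩ := hs
    change T (j • m) n p = 0
    rw [h.smul_left, hjn]
    simp

/-- Without a separating vector at `f`, the radical has codimension at least two on `f M`,
by Nakayama's lemma. -/
lemma finrank_radicalAt_smul_add_two_le (hfaith : ∀ r : R, (∀ m : M, r • m = 0) → r = 0) {f : R}
    (hf : f * f = f) (hM : ¬ HasSeparatingVector f M) :
    finrank ℂ ((radicalAt f • ⊤ : Submodule R M).restrictScalars ℂ) + 2 ≤
      finrank ℂ ((Ideal.span {f} • ⊤ : Submodule R M).restrictScalars ℂ) := by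
  have := isNoetherianRing_of_finiteDimensional (R := R)
  have : IsNoetherian R M := isNoetherian_of_tower ℂ inferInstance
  set J := radicalAt f with hJ
  set F : Submodule R M := Ideal.span {f} • ⊤ with hF
  have hJF : J • F = J • ⊤ := by
    refine le_antisymm (Submodule.smul_mono le_rfl le_top) ?_
    rw [Submodule.smul_le]
    intro j hj m _
    rw [← mul_eq_of_mem_radicalAt hf hj, mul_smul]
    exact Submodule.smul_mem_smul hj
      (Submodule.smul_mem_smul (Ideal.mem_span_singleton_self f) trivial)
  have hle : (J • ⊤ : Submodule R M) ≤ F := Submodule.smul_mono_left inf_le_right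
  by_contra hlt
  obtain ⟨u, hu⟩ : ∃ u : M, F ≤ Submodule.span R {u} ⊔ J • F := by
    rw [hJF]
    by_cases hFJ : F ≤ J • ⊤
    · exact ⟨0, by simpa using hFJ⟩
    obtain ⟨u, huF, huJ⟩ := SetLike.not_le_iff_exists.1 hFJ
    refine ⟨u, ?_⟩
    let A : Submodule ℂ M := (J • ⊤ : Submodule R M).restrictScalars ℂ
    let B : Submodule ℂ M := (Submodule.span R {u} ⊔ J • ⊤).restrictScalars ℂ ⊓
      F.restrictScalars ℂ
    have hAB : A < B := by
      refine lt_of_le_of_ne (le_inf (fun x hx => ?_) hle) fun he => huJ ?_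
      · exact Submodule.mem_sup_right (S := Submodule.span R {u}) hx
      · have : u ∈ B := ⟨Submodule.mem_sup_left (Submodule.mem_span_singleton_self u), huF⟩
        rw [← he] at this
        exact this
    have h1 := Submodule.finrank_lt_finrank_of_lt hAB
    have h2 : B = F.restrictScalars ℂ := by
      refine Submodule.eq_of_le_of_finrank_le inf_le_right ?_
      change finrank ℂ A < _ at h1
      change ¬ (finrank ℂ A + 2 ≤ finrank ℂ (F.restrictScalars ℂ)) at hlt
      omega
    intro x hx
    have : x ∈ B := by rw [h2]; exact hx
    exact this.1
  have hFu : F ≤ Submodule.span R {u} := by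
    refine Submodule.le_of_le_smul_of_le_jacobson_bot (IsNoetherian.noetherian F) ?_ hu
    exact inf_le_left.trans ((nilradical_le_jacobson R).trans Ideal.jacobson_bot.ge)
  refine hM ⟨u, fun r hr => hfaith _ fun m => ?_⟩
  have hm : f • m ∈ F := Submodule.smul_mem_smul (Ideal.mem_span_singleton_self f) trivial
  obtain ⟨a, ha⟩ := Submodule.mem_span_singleton.1 (hFu hm)
  rw [show r * f = r * f * f by linear_combination -r * hf, mul_smul, ← ha, smul_comm, hr,
    smul_zero]

lemma IsBalancedForm.three_le_finrank (h : IsBalancedForm R T) {f : R}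
    (hf : IsPrimitiveIdempotent f) (hN : ¬ HasSeparatingVector f N) :
    3 ≤ finrank ℂ ((Ideal.span {f} • ⊤ : Submodule R M).restrictScalars ℂ) := by
  have := isNoetherianRing_of_finiteDimensional (R := R)
  have : IsNoetherian R M := isNoetherian_of_tower ℂ inferInstance
  have h2 := two_le_finrank_of_forall_exists h.nondeg₁ _ (h.exists_mem_socleAt hf hN)
  set J := radicalAt f with hJ
  set F : Submodule R M := Ideal.span {f} • ⊤ with hF
  have hJF : J • F = J • ⊤ := by
    refine le_antisymm (Submodule.smul_mono le_rfl le_top) ?_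
    rw [Submodule.smul_le]
    intro j hj m _
    rw [← mul_eq_of_mem_radicalAt hf.idem hj, mul_smul]
    exact Submodule.smul_mem_smul hj
      (Submodule.smul_mem_smul (Ideal.mem_span_singleton_self f) trivial)
  have hle : (J • ⊤ : Submodule R M) ≤ F := Submodule.smul_mono_left inf_le_right
  have hsoc : socleAt f M ≤ J • ⊤ := inf_le_left
  have hlt : (socleAt f M).restrictScalars ℂ < F.restrictScalars ℂ := by
    refine lt_of_le_of_ne (fun x hx => hle (hsoc hx)) fun he => ?_
    have hFJ : F ≤ ⊥ ⊔ J • F := by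
      rw [hJF, bot_sup_eq]
      intro x hx
      have : x ∈ (socleAt f M).restrictScalars ℂ := by rw [he]; exact hx
      exact hsoc this
    have hbot : F ≤ ⊥ := Submodule.le_of_le_smul_of_le_jacobson_bot (IsNoetherian.noetherian F)
      (inf_le_left.trans ((nilradical_le_jacobson R).trans Ideal.jacobson_bot.ge)) hFJ
    have hF0 : F.restrictScalars ℂ = ⊥ := by rw [le_bot_iff.1 hbot]; rfl
    rw [he, hF0, finrank_bot] at h2
    omega
  have := Submodule.finrank_lt_finrank_of_lt hlt
  omega

lemma IsPrimitiveIdempotent.eq_of_three_le_finrank (hM : finrank ℂ M = 5) {f f' : R}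
    (hf : IsPrimitiveIdempotent f) (hf' : IsPrimitiveIdempotent f')
    (h : 3 ≤ finrank ℂ ((Ideal.span {f} • ⊤ : Submodule R M).restrictScalars ℂ))
    (h' : 3 ≤ finrank ℂ ((Ideal.span {f'} • ⊤ : Submodule R M).restrictScalars ℂ)) : f = f' := by
  by_contra hne
  have h0 := hf.mul_eq_zero hf' hne
  have hdis : Disjoint ((Ideal.span {f} • ⊤ : Submodule R M).restrictScalars ℂ)
      ((Ideal.span {f'} • ⊤ : Submodule R M).restrictScalars ℂ) := by
    rw [Submodule.disjoint_def]
    intro x hx hx'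
    rw [Submodule.restrictScalars_mem, Submodule.ideal_span_singleton_smul] at hx hx'
    obtain ⟨a, -, rfl⟩ := hx
    obtain ⟨b, -, hb⟩ := hx'
    change f' • b = f • a at hb
    change f • a = 0
    rw [← hf.idem, mul_smul, ← hb, smul_smul, h0, zero_smul]
  have := Submodule.finrank_add_finrank_le_of_disjoint hdis
  omega

/-- A balanced form on three `5`-dimensional modules without separating vectors comes from a local
algebra whose maximal ideal has square zero and rank three on each module. -/
theorem IsBalancedForm.local_structure (h : IsBalancedForm R T) (hM : finrank ℂ M = 5)
    (hN : finrank ℂ N = 5) (hP : finrank ℂ P = 5) (sM : ¬ HasSeparatingVector (1 : R) M)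
    (sN : ¬ HasSeparatingVector (1 : R) N) (sP : ¬ HasSeparatingVector (1 : R) P) :
    (∀ r : R, ∃ c : ℂ, r - algebraMap ℂ R c ∈ nilradical R) ∧
    (∀ i ∈ nilradical R, ∀ j ∈ nilradical R, i * j = 0) ∧
    finrank ℂ ((nilradical R • ⊤ : Submodule R M).restrictScalars ℂ) = 3 := by
  have := isArtinianRing_of_finiteDimensional (R := R)
  obtain ⟨f, hf, fM⟩ := exists_isPrimitiveIdempotent_not_hasSeparatingVector sM
  obtain ⟨g, hg, gN⟩ := exists_isPrimitiveIdempotent_not_hasSeparatingVector sN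
  obtain ⟨k, hk, kP⟩ := exists_isPrimitiveIdempotent_not_hasSeparatingVector sP
  -- two of the three idempotents have large image on the remaining module
  have hfg : f = g := hf.eq_of_three_le_finrank hP hg
    (h.flipRight.flipLeft.three_le_finrank hf fM)
    (h.flipLeft.flipRight.flipLeft.three_le_finrank hg gN)
  have hfk : f = k := hf.eq_of_three_le_finrank hN hk (h.flipLeft.three_le_finrank hf fM)
    (h.flipLeft.flipRight.three_le_finrank hk kP)
  subst hfg hfk
  have hsoc := three_le_finrank_of_forall_exists h.nondeg₁ _ (h.exists_mem_socleAt hf gN)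
    (fun p => h.flipRight.exists_mem_socleAt hf kP p)
  have hcod := finrank_radicalAt_smul_add_two_le h.faithful hf.idem fM
  have hle : (socleAt f M).restrictScalars ℂ ≤
    (radicalAt f • ⊤ : Submodule R M).restrictScalars ℂ := fun x hx => hx.1
  have hle' := Submodule.finrank_mono hle
  have htop : ((Ideal.span {f} • ⊤ : Submodule R M).restrictScalars ℂ) = ⊤ := by
    apply Submodule.eq_top_of_finrank_eq
    have := Submodule.finrank_le ((Ideal.span {f} • ⊤ : Submodule R M).restrictScalars ℂ)
    omega
  have hf1 : f = 1 := by
    have : 1 - f = 0 := h.faithful _ fun m => by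
      have hm : m ∈ ((Ideal.span {f} • ⊤ : Submodule R M).restrictScalars ℂ) := by
        rw [htop]; trivial
      rw [Submodule.restrictScalars_mem, Submodule.ideal_span_singleton_smul] at hm
      obtain ⟨a, -, rfl⟩ := hm
      change (1 - f) • f • a = 0
      rw [smul_smul, show (1 - f) * f = 0 by linear_combination -hf.idem, zero_smul]
    linear_combination -this
  subst hf1
  have hJ : radicalAt (1 : R) = nilradical R := by simp [radicalAt]
  have hFM := Submodule.finrank_le ((Ideal.span {(1 : R)} • ⊤ : Submodule R M).restrictScalars ℂ)
  have heq : (socleAt (1 : R) M).restrictScalars ℂ =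
      (radicalAt (1 : R) • ⊤ : Submodule R M).restrictScalars ℂ :=
    Submodule.eq_of_le_of_finrank_le hle (by omega)
  refine ⟨fun r => ?_, fun i hi j hj => h.faithful _ fun m => ?_, ?_⟩
  · obtain ⟨c, hc⟩ := hf.exists_isNilpotent r
    exact ⟨c, mem_nilradical.2 (by simpa using hc)⟩
  · have hj' : j ∈ radicalAt (1 : R) := hJ.ge hj
    have hmem : j • m ∈ (radicalAt (1 : R) • ⊤ : Submodule R M) :=
      Submodule.smul_mem_smul hj' Submodule.mem_top
    rw [← Submodule.restrictScalars_mem ℂ, ← heq, Submodule.restrictScalars_mem] at hmem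
    have h2 := (Submodule.mem_torsionBySet_iff _ _).1 hmem.2
    rw [mul_smul]
    exact h2 ⟨i, hJ.ge hi⟩
  · rw [hJ] at hcod heq hle'
    rw [heq] at hsoc
    omega

end Balanced


/-! ### The algebra of a trilinear form -/

section AlgebraOfForm

open Module

universe u₁ u₂ u₃ u₄

variable {M : Type u₂} {N : Type u₃} {P : Type u₄} [AddCommGroup M] [Module ℂ M]
  [AddCommGroup N] [Module ℂ N] [AddCommGroup P] [Module ℂ P]

/-- The algebra of triples `(X, Y, Z)` of endomorphisms whose actions on the three arguments of `T`
coincide. -/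
def formAlgebra (T : M →ₗ[ℂ] N →ₗ[ℂ] P →ₗ[ℂ] ℂ) :
    Subalgebra ℂ (End ℂ M × End ℂ N × End ℂ P) where
  carrier := {r | ∀ m n p, T (r.1 m) n p = T m (r.2.1 n) p ∧ T (r.1 m) n p = T m n (r.2.2 p)}
  mul_mem' {a b} ha hb m n p := by
    simp only [Prod.fst_mul, Prod.snd_mul, Module.End.mul_apply]
    constructor
    · rw [(ha _ _ _).2, (hb _ _ _).1, ← (ha _ _ _).2, (ha _ _ _).1]
    · rw [(ha _ _ _).1, (hb _ _ _).2, ← (ha _ _ _).1, (ha _ _ _).2]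
  add_mem' {a b} ha hb m n p := by
    simp only [Prod.fst_add, Prod.snd_add, LinearMap.add_apply, map_add]
    exact ⟨by rw [(ha _ _ _).1, (hb _ _ _).1], by rw [(ha _ _ _).2, (hb _ _ _).2]⟩
  algebraMap_mem' c m n p := by
    simp [Module.algebraMap_end_apply]

/-- A nondegenerate trilinear form on `M × N × P` in which the two-dimensional quotients
`M / V₁`, `N / V₂`, `P / V₃` play the main role: the form vanishes as soon as two of its arguments
lie in the subspaces `V₁`, `V₂`, `V₃` of dimension three. The four-dimensional family `τ`
consists of trilinear forms on these quotients whose slices in each of the three directions are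
slices of `T` by vectors of `V₁`, `V₂`, `V₃`. -/
structure IsQuotientPlaneForm
    (T : M →ₗ[ℂ] N →ₗ[ℂ] P →ₗ[ℂ] ℂ) (V₁ : Submodule ℂ M) (V₂ : Submodule ℂ N)
    (V₃ : Submodule ℂ P) (τ : (Fin 4 → ℂ) →ₗ[ℂ] M →ₗ[ℂ] N →ₗ[ℂ] P →ₗ[ℂ] ℂ) : Prop where
  nondeg₁ : ∀ m, (∀ n p, T m n p = 0) → m = 0
  nondeg₂ : ∀ n, (∀ m p, T m n p = 0) → n = 0
  nondeg₃ : ∀ p, (∀ m n, T m n p = 0) → p = 0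
  finrank₁ : finrank ℂ M = 5 ∧ finrank ℂ V₁ = 3
  finrank₂ : finrank ℂ N = 5 ∧ finrank ℂ V₂ = 3
  finrank₃ : finrank ℂ P = 5 ∧ finrank ℂ V₃ = 3
  vanish₁₂ : ∀ s ∈ V₁, ∀ t ∈ V₂, ∀ p, T s t p = 0
  vanish₁₃ : ∀ s ∈ V₁, ∀ n, ∀ t ∈ V₃, T s n t = 0
  vanish₂₃ : ∀ m, ∀ s ∈ V₂, ∀ t ∈ V₃, T m s t = 0
  slice₁ : ∀ j m, ∃ s ∈ V₁, ∀ n p, τ j m n p = T s n p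
  slice₂ : ∀ j n, ∃ s ∈ V₂, ∀ m p, τ j m n p = T m s p
  slice₃ : ∀ j p, ∃ s ∈ V₃, ∀ m n, τ j m n p = T m n s
  apply₁ : ∀ j, ∀ s ∈ V₁, ∀ n p, τ j s n p = 0
  apply₂ : ∀ j m, ∀ s ∈ V₂, ∀ p, τ j m s p = 0
  apply₃ : ∀ j m n, ∀ s ∈ V₃, τ j m n s = 0
  injective : ∀ j, (∀ m n p, τ j m n p = 0) → j = 0

lemma smul_eq_zero_of_mem_smul_top {R : Type*} [CommRing R] {J : Ideal R}
    (hsq : ∀ i ∈ J, ∀ j ∈ J, i * j = 0) {X : Type*} [AddCommGroup X] [Module R X] {i : R}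
    (hi : i ∈ J) {s : X} (hs : s ∈ (J • ⊤ : Submodule R X)) : i • s = 0 := by
  refine Submodule.smul_induction_on hs (fun j hj x _ => ?_) fun x y hx hy => ?_
  · rw [smul_smul, hsq i hi j hj, zero_smul]
  · rw [smul_add, hx, hy, add_zero]

/-- Over an algebra of dimension at least `dim M`, a separating vector would generate `M`
and hence give a nondegenerate slice of the form. -/
lemma IsBalancedForm.not_hasSeparatingVector_one {R : Type u₁} [CommRing R] [Algebra ℂ R]
    [FiniteDimensional ℂ R] [Module R M] [Module R N] [Module R P] [IsScalarTower ℂ R M]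
    [FiniteDimensional ℂ M]
    {T : M →ₗ[ℂ] N →ₗ[ℂ] P →ₗ[ℂ] ℂ} (h : IsBalancedForm R T)
    (hM : finrank ℂ M = 5) (hdim : 5 ≤ finrank ℂ R)
    (g₁ : ∀ m, ∃ n ≠ 0, ∀ p, T m n p = 0) : ¬ HasSeparatingVector (1 : R) M := by
  rintro ⟨m, hm⟩
  obtain ⟨n, hn0, hn⟩ := g₁ m
  refine hn0 (h.nondeg₂ n fun x p => ?_)
  let L : R →ₗ[ℂ] M := (LinearMap.toSpanSingleton R M m).restrictScalars ℂ
  have hinj : Function.Injective L := by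
    rw [← LinearMap.ker_eq_bot, LinearMap.ker_eq_bot']
    intro r hr
    simpa using hm r (by simpa [L] using hr)
  have hsurj : Function.Surjective L := by
    have := LinearMap.finrank_le_finrank_of_injective hinj
    exact (LinearMap.injective_iff_surjective_of_finrank_eq_finrank (by omega)).1 hinj
  obtain ⟨r, rfl⟩ := hsurj x
  change T (r • m) n p = 0
  rw [h.smul_right, hn]

lemma exists_four_mem_nilradical {R : Type*} [CommRing R] [Algebra ℂ R] [FiniteDimensional ℂ R]
    (hdim : 5 ≤ finrank ℂ R) (hloc : ∀ r : R, ∃ c : ℂ, r - algebraMap ℂ R c ∈ nilradical R) :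
    ∃ κ : (Fin 4 → ℂ) →ₗ[ℂ] R, (∀ a, κ a ∈ nilradical R) ∧ ∀ a, κ a = 0 → a = 0 := by
  let J : Submodule ℂ R := (nilradical R).restrictScalars ℂ
  have hJ : 4 ≤ finrank ℂ J := by
    let L : ℂ × J →ₗ[ℂ] R := (Algebra.linearMap ℂ R).coprod J.subtype
    have hL : Function.Surjective L := by
      intro r
      obtain ⟨c, hc⟩ := hloc r
      exact ⟨(c, ⟨_, hc⟩), by simp [L]⟩
    have := LinearMap.finrank_le_finrank_of_surjective hL
    simp at this
    omega
  obtain ⟨v, hv⟩ := exists_linearIndependent_of_le_finrank hJ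
  refine ⟨J.subtype ∘ₗ Fintype.linearCombination ℂ v,
    fun a => (Fintype.linearCombination ℂ v a).2, fun a ha =>
    (linearIndependent_iff_injective_fintypeLinearCombination.1 hv)
      ((Subtype.ext (by simpa using ha)).trans (map_zero _).symm)⟩

/-- A trilinear form with an algebra of dimension at least five, and without nondegenerate slices,
has square-zero radical of dimension at least four, acting on each argument with rank three. -/
theorem IsBalancedForm.exists_isQuotientPlaneForm {R : Type u₁} [CommRing R] [Algebra ℂ R]
    [FiniteDimensional ℂ R] [Module R M] [Module R N] [Module R P] [IsScalarTower ℂ R M]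
    [IsScalarTower ℂ R N] [IsScalarTower ℂ R P] [FiniteDimensional ℂ M] [FiniteDimensional ℂ N]
    [FiniteDimensional ℂ P] {T : M →ₗ[ℂ] N →ₗ[ℂ] P →ₗ[ℂ] ℂ} (h : IsBalancedForm R T)
    (hM : finrank ℂ M = 5) (hN : finrank ℂ N = 5) (hP : finrank ℂ P = 5)
    (g₁ : ∀ m, ∃ n ≠ 0, ∀ p, T m n p = 0) (g₂ : ∀ n, ∃ m ≠ 0, ∀ p, T m n p = 0)
    (g₃ : ∀ p, ∃ m ≠ 0, ∀ n, T m n p = 0) (hdim : 5 ≤ finrank ℂ R) :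
    ∃ (V₁ : Submodule ℂ M) (V₂ : Submodule ℂ N) (V₃ : Submodule ℂ P)
      (τ : (Fin 4 → ℂ) →ₗ[ℂ] M →ₗ[ℂ] N →ₗ[ℂ] P →ₗ[ℂ] ℂ),
      IsQuotientPlaneForm T V₁ V₂ V₃ τ := by
  have sM := h.not_hasSeparatingVector_one hM hdim g₁
  have sN := h.flipLeft.not_hasSeparatingVector_one hN hdim g₂
  have sP := h.flipRight.flipLeft.not_hasSeparatingVector_one hP hdim g₃
  obtain ⟨hloc, hsq, f₁⟩ := h.local_structure hM hN hP sM sN sP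
  obtain ⟨-, -, f₂⟩ := h.flipLeft.local_structure hN hM hP sN sM sP
  obtain ⟨-, -, f₃⟩ := h.flipRight.flipLeft.local_structure hP hM hN sP sM sN
  obtain ⟨κ, hκ, hκ0⟩ := exists_four_mem_nilradical hdim hloc
  obtain ⟨V₁, hV₁⟩ : ∃ V, V = (nilradical R • ⊤ : Submodule R M).restrictScalars ℂ := ⟨_, rfl⟩
  obtain ⟨V₂, hV₂⟩ : ∃ V, V = (nilradical R • ⊤ : Submodule R N).restrictScalars ℂ := ⟨_, rfl⟩
  obtain ⟨V₃, hV₃⟩ : ∃ V, V = (nilradical R • ⊤ : Submodule R P).restrictScalars ℂ := ⟨_, rfl⟩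
  rw [← hV₁] at f₁
  rw [← hV₂] at f₂
  rw [← hV₃] at f₃
  have s₁ : ∀ j ∈ nilradical R, ∀ m, j • m ∈ V₁ := fun j hj m => by
    rw [hV₁, Submodule.restrictScalars_mem]; exact Submodule.smul_mem_smul hj trivial
  have s₂ : ∀ j ∈ nilradical R, ∀ m, j • m ∈ V₂ := fun j hj m => by
    rw [hV₂, Submodule.restrictScalars_mem]; exact Submodule.smul_mem_smul hj trivial
  have s₃ : ∀ j ∈ nilradical R, ∀ m, j • m ∈ V₃ := fun j hj m => by
    rw [hV₃, Submodule.restrictScalars_mem]; exact Submodule.smul_mem_smul hj trivial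
  have z₁ : ∀ j ∈ nilradical R, ∀ s ∈ V₁, j • s = 0 := fun j hj s hs => by
    rw [hV₁, Submodule.restrictScalars_mem] at hs
    exact smul_eq_zero_of_mem_smul_top hsq hj hs
  have z₂ : ∀ j ∈ nilradical R, ∀ s ∈ V₂, j • s = 0 := fun j hj s hs => by
    rw [hV₂, Submodule.restrictScalars_mem] at hs
    exact smul_eq_zero_of_mem_smul_top hsq hj hs
  have z₃ : ∀ j ∈ nilradical R, ∀ s ∈ V₃, j • s = 0 := fun j hj s hs => by
    rw [hV₃, Submodule.restrictScalars_mem] at hs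
    exact smul_eq_zero_of_mem_smul_top hsq hj hs
  have v₁₂ : ∀ s ∈ V₁, ∀ t ∈ V₂, ∀ p, T s t p = 0 := by
    intro s hs t ht p
    rw [hV₂, Submodule.restrictScalars_mem] at ht
    refine Submodule.smul_induction_on ht (fun j hj x _ => ?_) fun x y hx hy => ?_
    · rw [← h.smul_left, z₁ j hj s hs]; simp
    · rw [map_add, LinearMap.add_apply, hx, hy, add_zero]
  have v₁₃ : ∀ s ∈ V₁, ∀ n, ∀ t ∈ V₃, T s n t = 0 := by
    intro s hs n t ht
    rw [hV₃, Submodule.restrictScalars_mem] at ht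
    refine Submodule.smul_induction_on ht (fun j hj x _ => ?_) fun x y hx hy => ?_
    · rw [← h.smul_right, z₁ j hj s hs]; simp
    · rw [map_add, hx, hy, add_zero]
  have v₂₃ : ∀ m, ∀ s ∈ V₂, ∀ t ∈ V₃, T m s t = 0 := by
    intro m s hs t ht
    rw [hV₃, Submodule.restrictScalars_mem] at ht
    refine Submodule.smul_induction_on ht (fun j hj x _ => ?_) fun x y hx hy => ?_
    · rw [← h.smul_right, h.smul_left, z₂ j hj s hs]; simp
    · rw [map_add, hx, hy, add_zero]
  obtain ⟨τ, hτ⟩ : ∃ τ : (Fin 4 → ℂ) →ₗ[ℂ] M →ₗ[ℂ] N →ₗ[ℂ] P →ₗ[ℂ] ℂ,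
      ∀ a m n p, τ a m n p = T (κ a • m) n p :=
    ⟨LinearMap.llcomp ℂ M M _ T ∘ₗ (Algebra.lsmul ℂ ℂ M).toLinearMap ∘ₗ κ,
      fun a m n p => rfl⟩
  exact ⟨V₁, V₂, V₃, τ,
    { nondeg₁ := h.nondeg₁
      nondeg₂ := h.nondeg₂
      nondeg₃ := h.nondeg₃
      finrank₁ := ⟨hM, f₁⟩
      finrank₂ := ⟨hN, f₂⟩
      finrank₃ := ⟨hP, f₃⟩
      vanish₁₂ := v₁₂
      vanish₁₃ := v₁₃
      vanish₂₃ := v₂₃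
      slice₁ := fun a m => ⟨κ a • m, s₁ _ (hκ a) m, fun n p => hτ a m n p⟩
      slice₂ := fun a n => ⟨κ a • n, s₂ _ (hκ a) n, fun m p => by rw [hτ, h.smul_left]⟩
      slice₃ := fun a p => ⟨κ a • p, s₃ _ (hκ a) p, fun m n => by rw [hτ, h.smul_right]⟩
      apply₁ := fun a s hs n p => by rw [hτ, z₁ _ (hκ a) s hs]; simp
      apply₂ := fun a m s hs p => by rw [hτ, h.smul_left, z₂ _ (hκ a) s hs]; simp
      apply₃ := fun a m n s hs => by rw [hτ, h.smul_right, z₃ _ (hκ a) s hs]; simp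
      injective := fun a ha => hκ0 a (h.faithful _ fun m => h.nondeg₁ _ fun n p => by
        rw [← hτ, ha]) }⟩

/-- The form of a tensor whose algebra has dimension at least five, and which has no nondegenerate
slice, is determined by its behaviour on three quotient planes. -/
theorem exists_isQuotientPlaneForm [FiniteDimensional ℂ M] [FiniteDimensional ℂ N]
    [FiniteDimensional ℂ P] (T : M →ₗ[ℂ] N →ₗ[ℂ] P →ₗ[ℂ] ℂ)
    (hM : finrank ℂ M = 5) (hN : finrank ℂ N = 5) (hP : finrank ℂ P = 5)
    (nd₁ : ∀ m, (∀ n p, T m n p = 0) → m = 0) (nd₂ : ∀ n, (∀ m p, T m n p = 0) → n = 0)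
    (nd₃ : ∀ p, (∀ m n, T m n p = 0) → p = 0)
    (g₁ : ∀ m, ∃ n ≠ 0, ∀ p, T m n p = 0) (g₂ : ∀ n, ∃ m ≠ 0, ∀ p, T m n p = 0)
    (g₃ : ∀ p, ∃ m ≠ 0, ∀ n, T m n p = 0) (hdim : 5 ≤ finrank ℂ (formAlgebra T)) :
    ∃ (V₁ : Submodule ℂ M) (V₂ : Submodule ℂ N) (V₃ : Submodule ℂ P)
      (τ : (Fin 4 → ℂ) →ₗ[ℂ] M →ₗ[ℂ] N →ₗ[ℂ] P →ₗ[ℂ] ℂ),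
      IsQuotientPlaneForm T V₁ V₂ V₃ τ := by
  have hmem : ∀ (r : formAlgebra T) m n p, T (r.1.1 m) n p = T m (r.1.2.1 n) p ∧
    T (r.1.1 m) n p = T m n (r.1.2.2 p) := fun r => r.2
  let _ : CommRing (formAlgebra T) :=
    { (inferInstance : Ring (formAlgebra T)) with
      mul_comm := by
        intro a b
        have e₁ : ∀ m, a.1.1 (b.1.1 m) = b.1.1 (a.1.1 m) := fun m => by
          rw [← sub_eq_zero]
          refine nd₁ _ fun n p => ?_
          rw [map_sub, LinearMap.sub_apply, LinearMap.sub_apply, (hmem a _ _ _).1,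
            (hmem b _ _ _).2, ← (hmem a _ _ _).1, ← (hmem b _ _ _).2, sub_self]
        have e₂ : ∀ n, a.1.2.1 (b.1.2.1 n) = b.1.2.1 (a.1.2.1 n) := fun n => by
          rw [← sub_eq_zero]
          refine nd₂ _ fun m p => ?_
          rw [map_sub, LinearMap.sub_apply, ← (hmem a _ _ _).1, ← (hmem b _ _ _).1,
            ← (hmem b _ _ _).1, ← (hmem a _ _ _).1, e₁, sub_self]
        have e₃ : ∀ p, a.1.2.2 (b.1.2.2 p) = b.1.2.2 (a.1.2.2 p) := fun p => by
          rw [← sub_eq_zero]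
          refine nd₃ _ fun m n => ?_
          rw [map_sub, ← (hmem a _ _ _).2, ← (hmem b _ _ _).2,
            ← (hmem b _ _ _).2, ← (hmem a _ _ _).2, e₁, sub_self]
        refine Subtype.ext (Prod.ext (LinearMap.ext e₁) (Prod.ext (LinearMap.ext e₂)
          (LinearMap.ext e₃))) }
  let φ₁ : formAlgebra T →+* End ℂ M :=
    (RingHom.fst _ _).comp (formAlgebra T).val.toRingHom
  let φ₂ : formAlgebra T →+* End ℂ N :=
    ((RingHom.fst _ _).comp (RingHom.snd _ _)).comp (formAlgebra T).val.toRingHom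
  let φ₃ : formAlgebra T →+* End ℂ P :=
    ((RingHom.snd _ _).comp (RingHom.snd _ _)).comp (formAlgebra T).val.toRingHom
  let _ : Module (formAlgebra T) M := Module.compHom M φ₁
  let _ : Module (formAlgebra T) N := Module.compHom N φ₂
  let _ : Module (formAlgebra T) P := Module.compHom P φ₃
  have : IsScalarTower ℂ (formAlgebra T) M := ⟨fun c r m => rfl⟩
  have : IsScalarTower ℂ (formAlgebra T) N := ⟨fun c r m => rfl⟩
  have : IsScalarTower ℂ (formAlgebra T) P := ⟨fun c r m => rfl⟩
  have h : IsBalancedForm (formAlgebra T) T :=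
    { smul_left := fun r m n p => (hmem r m n p).1
      smul_right := fun r m n p => (hmem r m n p).2
      nondeg₁ := nd₁
      nondeg₂ := nd₂
      nondeg₃ := nd₃
      faithful := fun r hr => by
        have e₁ : ∀ m, r.1.1 m = 0 := hr
        refine Subtype.ext (Prod.ext (LinearMap.ext e₁) (Prod.ext (LinearMap.ext fun n => ?_)
          (LinearMap.ext fun p => ?_)))
        · exact nd₂ _ fun m p => by rw [← (hmem r m n p).1, e₁]; simp
        · exact nd₃ _ fun m n => by rw [← (hmem r m n p).2, e₁]; simp }
  exact h.exists_isQuotientPlaneForm hM hN hP g₁ g₂ g₃ hdim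

end AlgebraOfForm


/-! ### Bases of two-dimensional quotients -/

section Spans

open Module

variable {M : Type*} [AddCommGroup M] [Module ℂ M]

/-- The images of `x` and `y` span the quotient by `V`. -/
def SpansMod (V : Submodule ℂ M) (x y : M) : Prop := ∀ z, ∃ a b : ℂ, z - a • x - b • y ∈ V

lemma exists_spansMod {V : Submodule ℂ M} (h : finrank ℂ M = 5 ∧ finrank ℂ V = 3) :
    ∃ x y, SpansMod V x y := by
  have : FiniteDimensional ℂ M := FiniteDimensional.of_finrank_pos (by omega)
  have hq : finrank ℂ (M ⧸ V) = 2 := by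
    have := Submodule.finrank_quotient_add_finrank V
    omega
  let b := finBasisOfFinrankEq ℂ (M ⧸ V) hq
  obtain ⟨x, hx⟩ := V.mkQ_surjective (b 0)
  obtain ⟨y, hy⟩ := V.mkQ_surjective (b 1)
  refine ⟨x, y, fun z => ⟨b.repr (V.mkQ z) 0, b.repr (V.mkQ z) 1, ?_⟩⟩
  refine (Submodule.Quotient.mk_eq_zero V).1 (show V.mkQ _ = 0 from ?_)
  rw [map_sub, map_sub, map_smul, map_smul, hx, hy]
  have := b.sum_repr (V.mkQ z)
  rw [Fin.sum_univ_two] at this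
  rw [sub_sub, this, sub_self]

lemma SpansMod.eq_zero {V : Submodule ℂ M} (h : finrank ℂ M = 5 ∧ finrank ℂ V = 3) {x y : M}
    (hs : SpansMod V x y) {a b : ℂ} (hab : a • x + b • y ∈ V) : a = 0 ∧ b = 0 := by
  have : FiniteDimensional ℂ M := FiniteDimensional.of_finrank_pos (by omega)
  have hq : finrank ℂ (M ⧸ V) = 2 := by
    have := Submodule.finrank_quotient_add_finrank V
    omega
  have hli : LinearIndependent ℂ ![V.mkQ x, V.mkQ y] := by
    refine linearIndependent_of_top_le_span_of_card_eq_finrank ?_ (by simp [hq])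
    intro z _
    obtain ⟨z, rfl⟩ := V.mkQ_surjective z
    obtain ⟨a, b, hz⟩ := hs z
    rw [← V.ker_mkQ, LinearMap.mem_ker, map_sub, map_sub, map_smul, map_smul, sub_sub,
      sub_eq_zero] at hz
    rw [hz]
    exact Submodule.add_mem _ (Submodule.smul_mem _ _ (Submodule.subset_span ⟨0, rfl⟩))
      (Submodule.smul_mem _ _ (Submodule.subset_span ⟨1, rfl⟩))
  refine LinearIndependent.pair_iff.1 hli a b ?_
  rw [← V.ker_mkQ, LinearMap.mem_ker, map_add, map_smul, map_smul] at hab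
  exact hab

lemma SpansMod.change {V : Submodule ℂ M} {x y : M} (hs : SpansMod V x y) {a b c d : ℂ}
    (hdet : a * d - b * c ≠ 0) {x' y' : M} (hx : x' - (a • x + b • y) ∈ V)
    (hy : y' - (c • x + d • y) ∈ V) : SpansMod V x' y' := by
  intro z
  obtain ⟨e, f, hz⟩ := hs z
  obtain ⟨α, β, rfl, rfl⟩ : ∃ α β, e = α * a + β * c ∧ f = α * b + β * d :=
    ⟨(e * d - f * c) / (a * d - b * c), (f * a - e * b) / (a * d - b * c),
      by rw [div_mul_eq_mul_div, div_mul_eq_mul_div, ← add_div, eq_div_iff hdet]; ring,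
      by rw [div_mul_eq_mul_div, div_mul_eq_mul_div, ← add_div, eq_div_iff hdet]; ring⟩
  refine ⟨α, β, ?_⟩
  have : z - α • x' - β • y' =
      (z - (α * a + β * c) • x - (α * b + β * d) • y) - α • (x' - (a • x + b • y))
        - β • (y' - (c • x + d • y)) := by module
  rw [this]
  exact V.sub_mem (V.sub_mem hz (V.smul_mem _ hx)) (V.smul_mem _ hy)

lemma SpansMod.add_mem {V : Submodule ℂ M} {x y : M} (hs : SpansMod V x y) {s t : M} (h₁ : s ∈ V)
    (h₂ : t ∈ V) : SpansMod V (x + s) (y + t) :=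
  hs.change (a := 1) (b := 0) (c := 0) (d := 1) (by norm_num) (by simpa) (by simpa)

/-- Two vectors outside `V` are either proportional modulo `V` or span the quotient. -/
lemma spansMod_or_exists_smul {V : Submodule ℂ M} (h : finrank ℂ M = 5 ∧ finrank ℂ V = 3)
    {x y : M} (hx : x ∉ V) (hy : y ∉ V) : SpansMod V x y ∨ ∃ c : ℂ, c ≠ 0 ∧ y - c • x ∈ V := by
  obtain ⟨e, f, hs⟩ := exists_spansMod h
  obtain ⟨a, b, hab⟩ := hs x
  obtain ⟨c, d, hcd⟩ := hs y
  rw [sub_sub] at hab hcd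
  by_cases hdet : a * d - b * c = 0
  · right
    have hne : a ≠ 0 ∨ b ≠ 0 := by
      by_contra! h0
      apply hx
      simpa [h0.1, h0.2] using hab
    have hprop : ∃ k : ℂ, c = k * a ∧ d = k * b := by
      rcases hne with h0 | h0
      · exact ⟨c / a, by field_simp, by field_simp; linear_combination hdet⟩
      · exact ⟨d / b, by field_simp; linear_combination -hdet, by field_simp⟩
    obtain ⟨k, rfl, rfl⟩ := hprop
    have hmem : y - k • x ∈ V := by
      have : y - k • x = (y - ((k * a) • e + (k * b) • f)) - k • (x - (a • e + b • f)) := by module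
      rw [this]
      exact V.sub_mem hcd (V.smul_mem _ hab)
    refine ⟨k, ?_, hmem⟩
    rintro rfl
    apply hy
    simpa using hmem
  · exact Or.inl (hs.change hdet hab hcd)

lemma exists_spansMod_left {V : Submodule ℂ M} (h : finrank ℂ M = 5 ∧ finrank ℂ V = 3)
    {x : M} (hx : x ∉ V) : ∃ y, SpansMod V x y := by
  obtain ⟨e, f, hs⟩ := exists_spansMod h
  obtain ⟨a, b, hab⟩ := hs x
  rw [sub_sub] at hab
  by_cases ha : a = 0
  · have hb : b ≠ 0 := by
      rintro rfl
      apply hx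
      simpa [ha] using hab
    exact ⟨e, hs.change (c := 1) (d := 0) (by simpa [ha] using hb) hab (by simp)⟩
  · exact ⟨f, hs.change (c := 0) (d := 1) (by simpa using ha) hab (by simp)⟩

lemma SpansMod.symm {V : Submodule ℂ M} {x y : M} (hs : SpansMod V x y) : SpansMod V y x :=
  hs.change (a := 0) (b := 1) (c := 1) (d := 0) (by norm_num) (by simp) (by simp)

lemma SpansMod.left_notMem {V : Submodule ℂ M} (h : finrank ℂ M = 5 ∧ finrank ℂ V = 3) {x y : M}
    (hs : SpansMod V x y) : x ∉ V := fun hx => by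
  have := hs.eq_zero h (a := 1) (b := 0) (by simpa)
  simp at this

end Spans

/-! ### Relations between the slices of a quotient plane form -/

section Relations

open Module

variable {M N P : Type*} [AddCommGroup M] [Module ℂ M]
  [AddCommGroup N] [Module ℂ N] [AddCommGroup P] [Module ℂ P]
  {T : M →ₗ[ℂ] N →ₗ[ℂ] P →ₗ[ℂ] ℂ} {V₁ : Submodule ℂ M} {V₂ : Submodule ℂ N} {V₃ : Submodule ℂ P}
  {τ : (Fin 4 → ℂ) →ₗ[ℂ] M →ₗ[ℂ] N →ₗ[ℂ] P →ₗ[ℂ] ℂ}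

namespace IsQuotientPlaneForm

lemma flipLeft (h : IsQuotientPlaneForm T V₁ V₂ V₃ τ) :
    IsQuotientPlaneForm (flipLeft T) V₂ V₁ V₃ (LinearMap.lflip.toLinearMap ∘ₗ τ) where
  nondeg₁ n hn := h.nondeg₂ n fun m p => hn m p
  nondeg₂ m hm := h.nondeg₁ m fun n p => hm n p
  nondeg₃ p hp := h.nondeg₃ p fun m n => hp n m
  finrank₁ := h.finrank₂
  finrank₂ := h.finrank₁
  finrank₃ := h.finrank₃
  vanish₁₂ s hs t ht p := h.vanish₁₂ t ht s hs p
  vanish₁₃ s hs n t ht := h.vanish₂₃ n s hs t ht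
  vanish₂₃ m s hs t ht := h.vanish₁₃ s hs m t ht
  slice₁ j n := (h.slice₂ j n).imp fun _ hs => ⟨hs.1, fun m p => hs.2 m p⟩
  slice₂ j n := (h.slice₁ j n).imp fun _ hs => ⟨hs.1, fun m p => hs.2 m p⟩
  slice₃ j n := (h.slice₃ j n).imp fun _ hs => ⟨hs.1, fun m p => hs.2 p m⟩
  apply₁ j _ hs m p := h.apply₂ j m _ hs p
  apply₂ j m _ hs p := h.apply₁ j _ hs m p
  apply₃ j m n _ hs := h.apply₃ j n m _ hs
  injective j hj := h.injective j fun m n p => hj n m p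

lemma flipRight (h : IsQuotientPlaneForm T V₁ V₂ V₃ τ) :
    ∃ τ', IsQuotientPlaneForm (flipRight T) V₁ V₃ V₂ τ' := by
  let L : (M →ₗ[ℂ] N →ₗ[ℂ] P →ₗ[ℂ] ℂ) →ₗ[ℂ] M →ₗ[ℂ] P →ₗ[ℂ] N →ₗ[ℂ] ℂ :=
    LinearMap.llcomp ℂ M _ _ LinearMap.lflip.toLinearMap
  refine ⟨L ∘ₗ τ, ?_⟩
  exact
  { nondeg₁ := fun n hn => h.nondeg₁ n fun m p => hn p m
    nondeg₂ := fun m hm => h.nondeg₃ m fun n p => hm n p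
    nondeg₃ := fun p hp => h.nondeg₂ p fun m n => hp m n
    finrank₁ := h.finrank₁
    finrank₂ := h.finrank₃
    finrank₃ := h.finrank₂
    vanish₁₂ := fun s hs t ht p => h.vanish₁₃ s hs p t ht
    vanish₁₃ := fun s hs n t ht => h.vanish₁₂ s hs t ht n
    vanish₂₃ := fun m s hs t ht => h.vanish₂₃ m t ht s hs
    slice₁ := fun j n => (h.slice₁ j n).imp fun _ hs => ⟨hs.1, fun m p => hs.2 p m⟩
    slice₂ := fun j n => (h.slice₃ j n).imp fun _ hs => ⟨hs.1, fun m p => hs.2 m p⟩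
    slice₃ := fun j n => (h.slice₂ j n).imp fun _ hs => ⟨hs.1, fun m p => hs.2 m p⟩
    apply₁ := fun j s hs m p => h.apply₁ j s hs p m
    apply₂ := fun j m s hs p => h.apply₃ j m p s hs
    apply₃ := fun j m n s hs => h.apply₂ j m s hs n
    injective := fun j hj => h.injective j fun m n p => hj m p n }

lemma eq_zero_of_slice (h : IsQuotientPlaneForm T V₁ V₂ V₃ τ)
    {n₀ n₁ : N} {p₀ p₁ : P} (hn : SpansMod V₂ n₀ n₁) (hp : SpansMod V₃ p₀ p₁)
    {s : M} (hs : s ∈ V₁) (h₀₀ : T s n₀ p₀ = 0) (h₀₁ : T s n₀ p₁ = 0) (h₁₀ : T s n₁ p₀ = 0)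
    (h₁₁ : T s n₁ p₁ = 0) : s = 0 := by
  refine h.nondeg₁ s fun n p => ?_
  obtain ⟨a, b, hab⟩ := hn n
  obtain ⟨c, d, hcd⟩ := hp p
  obtain ⟨t, ht, rfl⟩ : ∃ t ∈ V₂, n = a • n₀ + b • n₁ + t := ⟨_, hab, by abel⟩
  obtain ⟨r, hr, rfl⟩ : ∃ r ∈ V₃, p = c • p₀ + d • p₁ + r := ⟨_, hcd, by abel⟩
  simp [h.vanish₁₂ s hs t ht, h.vanish₁₃ s hs _ r hr, h₀₀, h₀₁, h₁₀, h₁₁]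

lemma eq_zero_of_values (h : IsQuotientPlaneForm T V₁ V₂ V₃ τ)
    {m₀ m₁ : M} {n₀ n₁ : N} {p₀ p₁ : P} (hm : SpansMod V₁ m₀ m₁)
    (hn : SpansMod V₂ n₀ n₁) (hp : SpansMod V₃ p₀ p₁) {a : Fin 4 → ℂ}
    (h₀₀₀ : τ a m₀ n₀ p₀ = 0) (h₀₀₁ : τ a m₀ n₀ p₁ = 0) (h₀₁₀ : τ a m₀ n₁ p₀ = 0)
    (h₀₁₁ : τ a m₀ n₁ p₁ = 0) (h₁₀₀ : τ a m₁ n₀ p₀ = 0) (h₁₀₁ : τ a m₁ n₀ p₁ = 0)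
    (h₁₁₀ : τ a m₁ n₁ p₀ = 0) (h₁₁₁ : τ a m₁ n₁ p₁ = 0) : a = 0 := by
  refine h.injective a fun m n p => ?_
  obtain ⟨a₁, b₁, h₁⟩ := hm m
  obtain ⟨a₂, b₂, h₂⟩ := hn n
  obtain ⟨a₃, b₃, h₃⟩ := hp p
  obtain ⟨s, hs, rfl⟩ : ∃ s ∈ V₁, m = a₁ • m₀ + b₁ • m₁ + s := ⟨_, h₁, by abel⟩
  obtain ⟨t, ht, rfl⟩ : ∃ t ∈ V₂, n = a₂ • n₀ + b₂ • n₁ + t := ⟨_, h₂, by abel⟩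
  obtain ⟨r, hr, rfl⟩ : ∃ r ∈ V₃, p = a₃ • p₀ + b₃ • p₁ + r := ⟨_, h₃, by abel⟩
  simp [h.apply₁ a s hs, h.apply₂ a _ t ht, h.apply₃ a _ _ r hr, h₀₀₀, h₀₀₁, h₀₁₀, h₀₁₁, h₁₀₀,
    h₁₀₁, h₁₁₀, h₁₁₁]

/-- The slices by `V₁`, evaluated on bases of the two quotient planes, are the solutions of exactly
one nontrivial linear equation `q`. -/
lemma exists_relation (h : IsQuotientPlaneForm T V₁ V₂ V₃ τ)
    {n₀ n₁ : N} {p₀ p₁ : P} (hn : SpansMod V₂ n₀ n₁) (hp : SpansMod V₃ p₀ p₁) :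
    ∃ q : Fin 4 → ℂ, q ≠ 0 ∧ (∀ s ∈ V₁, q 0 * T s n₀ p₀ + q 1 * T s n₀ p₁ + q 2 * T s n₁ p₀
      + q 3 * T s n₁ p₁ = 0) ∧ ∀ b : Fin 4 → ℂ, ∑ i, q i * b i = 0 →
        ∃ s ∈ V₁, T s n₀ p₀ = b 0 ∧ T s n₀ p₁ = b 1 ∧ T s n₁ p₀ = b 2 ∧ T s n₁ p₁ = b 3 := by
  have : FiniteDimensional ℂ M := FiniteDimensional.of_finrank_pos (by rw [h.finrank₁.1]; omega)
  let φ : V₁ →ₗ[ℂ] (Fin 4 → ℂ) := LinearMap.pi ![(T.flip n₀).flip p₀ ∘ₗ V₁.subtype,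
    (T.flip n₀).flip p₁ ∘ₗ V₁.subtype, (T.flip n₁).flip p₀ ∘ₗ V₁.subtype,
    (T.flip n₁).flip p₁ ∘ₗ V₁.subtype]
  have hφ : Function.Injective φ := by
    rw [← LinearMap.ker_eq_bot, LinearMap.ker_eq_bot']
    intro s hs
    have h0 := congrFun hs 0
    have h1 := congrFun hs 1
    have h2 := congrFun hs 2
    have h3 := congrFun hs 3
    exact Subtype.ext (h.eq_zero_of_slice hn hp s.2 h0 h1 h2 h3)
  have hr : finrank ℂ (LinearMap.range φ) = 3 := by
    rw [LinearMap.finrank_range_of_inj hφ, h.finrank₁.2]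
  have hlt : LinearMap.range φ < ⊤ := by
    refine lt_top_iff_ne_top.2 fun htop => ?_
    rw [htop, finrank_top] at hr
    simp at hr
  obtain ⟨f, hf0, hf⟩ := Submodule.exists_le_ker_of_lt_top _ hlt
  have hker : LinearMap.range φ = LinearMap.ker f := by
    refine Submodule.eq_of_le_of_finrank_le hf ?_
    have h1 := LinearMap.finrank_range_add_finrank_ker f
    have h2 : 0 < finrank ℂ (LinearMap.range f) := by
      rw [Module.finrank_pos_iff, Submodule.nontrivial_iff_ne_bot]
      exact fun hb => hf0 (LinearMap.range_eq_bot.1 hb)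
    simp at h1
    omega
  have hfe : ∀ b : Fin 4 → ℂ, f b = ∑ i, f (fun j => if i = j then 1 else 0) * b i := by
    intro b
    rw [LinearMap.pi_apply_eq_sum_univ f b]
    simp only [smul_eq_mul, mul_comm]
  refine ⟨fun i => f (fun j => if i = j then 1 else 0), fun h0 => hf0 ?_, fun s hs => ?_,
    fun b hb => ?_⟩
  · refine LinearMap.ext fun b => ?_
    rw [hfe]
    simp [fun i => congrFun h0 i]
  · have := hfe (φ ⟨s, hs⟩)
    rw [LinearMap.mem_ker.1 (hf ⟨_, rfl⟩), Fin.sum_univ_four] at this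
    exact this.symm
  · rw [← hfe] at hb
    have : b ∈ LinearMap.range φ := by rw [hker]; exact hb
    obtain ⟨s, rfl⟩ := this
    exact ⟨s, s.2, rfl, rfl, rfl, rfl⟩

end IsQuotientPlaneForm

end Relations


/-! ### Integral coefficients of the five tensors -/

section Coefficients

/-- The coefficients of `basisTensor a b c`. -/
def unitCoeff (a b c i j k : Fin 5) : ℤ := if i = a ∧ j = b ∧ k = c then 1 else 0

/-- The coefficients of `tensorM1`. -/
def coeffM1 (i j k : Fin 5) : ℤ :=
  unitCoeff 0 0 0 i j k + unitCoeff 0 1 1 i j k + unitCoeff 0 2 2 i j k + unitCoeff 0 3 3 i j k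
    + unitCoeff 1 2 0 i j k + unitCoeff 2 3 0 i j k + unitCoeff 3 3 1 i j k
    + (unitCoeff 4 4 0 i j k + unitCoeff 4 3 4 i j k)

/-- The coefficients of `tensorM2`. -/
def coeffM2 (i j k : Fin 5) : ℤ :=
  unitCoeff 0 0 0 i j k + unitCoeff 0 1 1 i j k + unitCoeff 0 2 2 i j k + unitCoeff 0 3 3 i j k
    + (unitCoeff 1 2 0 i j k - unitCoeff 1 3 1 i j k) + unitCoeff 2 3 0 i j k
    + unitCoeff 3 2 1 i j k + (unitCoeff 4 4 0 i j k + unitCoeff 4 3 4 i j k)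

/-- The coefficients of the five tensors. -/
def coeffs : Fin 5 → Fin 5 → Fin 5 → Fin 5 → ℤ :=
  ![fun i j k => coeffM2 i j k + (unitCoeff 4 0 1 i j k - unitCoeff 4 2 3 i j k), coeffM2,
    fun i j k => coeffM1 i j k + unitCoeff 4 1 1 i j k,
    fun i j k => coeffM1 i j k + unitCoeff 4 2 1 i j k, coeffM1]

lemma basisTensor_apply (a b c i j k : Fin 5) :
    basisTensor a b c ![i, j, k] = (unitCoeff a b c i j k : ℂ) := by
  simp only [basisTensor, pureTensor, unitCoeff, Pi.single_apply]
  by_cases h1 : i = a <;> by_cases h2 : j = b <;> by_cases h3 : k = c <;> simp [h1, h2, h3]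

lemma fiveTensors_apply (n i j k : Fin 5) :
    fiveTensors n ![i, j, k] = (coeffs n i j k : ℂ) := by
  fin_cases n <;>
  simp [fiveTensors, coeffs, tensorO58, tensorO57, tensorO56, tensorO55, tensorO54, tensorM1,
    tensorM2, coeffM1, coeffM2, basisTensor_apply]

end Coefficients

/-! ### Normal forms -/

section NormalForms

open Module

variable {M N P : Type*} [AddCommGroup M] [Module ℂ M]
  [AddCommGroup N] [Module ℂ N] [AddCommGroup P] [Module ℂ P]
  {T : M →ₗ[ℂ] N →ₗ[ℂ] P →ₗ[ℂ] ℂ} {V₁ : Submodule ℂ M} {V₂ : Submodule ℂ N} {V₃ : Submodule ℂ P}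
  {τ : (Fin 4 → ℂ) →ₗ[ℂ] M →ₗ[ℂ] N →ₗ[ℂ] P →ₗ[ℂ] ℂ}

/-- Up to a permutation of its arguments, the form `T` takes the values of one of the five tensors
on three families of five vectors. -/
def HasFiveTensorValues (T : M →ₗ[ℂ] N →ₗ[ℂ] P →ₗ[ℂ] ℂ) : Prop :=
  ∃ (n : Fin 5) (σ : Equiv.Perm (Fin 3)) (u : Fin 5 → M) (v : Fin 5 → N) (w : Fin 5 → P),
    ∀ x : Fin 3 → Fin 5, T (u (x 0)) (v (x 1)) (w (x 2)) = fiveTensors n (x ∘ σ)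

lemma HasFiveTensorValues.of_flipLeft (h : HasFiveTensorValues (flipLeft T)) :
    HasFiveTensorValues T := by
  obtain ⟨n, σ, v, u, w, hx⟩ := h
  refine ⟨n, Equiv.swap 0 1 * σ, u, v, w, fun x => ?_⟩
  exact hx (x ∘ Equiv.swap 0 1)

lemma HasFiveTensorValues.of_flipRight (h : HasFiveTensorValues (flipRight T)) :
    HasFiveTensorValues T := by
  obtain ⟨n, σ, u, w, v, hx⟩ := h
  refine ⟨n, Equiv.swap 1 2 * σ, u, v, w, fun x => ?_⟩
  exact hx (x ∘ Equiv.swap 1 2)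

namespace IsQuotientPlaneForm

/-- All slices allowed by a relation occur: the slices by `V₁` form a hyperplane in the space of
bilinear forms on the two quotient planes. -/
lemma exists_slice (h : IsQuotientPlaneForm T V₁ V₂ V₃ τ) {n : Fin 2 → N} {p : Fin 2 → P}
    (hn : SpansMod V₂ (n 0) (n 1)) (hp : SpansMod V₃ (p 0) (p 1)) {c : Fin 2 → Fin 2 → ℂ}
    (hc : c ≠ 0) (hrel : ∀ s ∈ V₁, ∑ j, ∑ k, c j k * T s (n j) (p k) = 0)
    (b : Fin 2 → Fin 2 → ℂ) (hb : ∑ j, ∑ k, c j k * b j k = 0) :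
    ∃ s ∈ V₁, ∀ j k, T s (n j) (p k) = b j k := by
  obtain ⟨q, -, -, hq⟩ := h.exists_relation hn hp
  have hprop : ∀ d : Fin 4 → ℂ, ∑ i, q i * d i = 0 →
      c 0 0 * d 0 + c 0 1 * d 1 + c 1 0 * d 2 + c 1 1 * d 3 = 0 := by
    intro d hd
    obtain ⟨s, hs, e0, e1, e2, e3⟩ := hq d hd
    have := hrel s hs
    simp only [Fin.sum_univ_two] at this
    rw [← e0, ← e1, ← e2, ← e3, ← this]
    ring
  have k01 := hprop ![q 1, -q 0, 0, 0] (by simp [Fin.sum_univ_four]; ring)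
  have k02 := hprop ![q 2, 0, -q 0, 0] (by simp [Fin.sum_univ_four]; ring)
  have k03 := hprop ![q 3, 0, 0, -q 0] (by simp [Fin.sum_univ_four]; ring)
  have k12 := hprop ![0, q 2, -q 1, 0] (by simp [Fin.sum_univ_four]; ring)
  have k13 := hprop ![0, q 3, 0, -q 1] (by simp [Fin.sum_univ_four]; ring)
  have k23 := hprop ![0, 0, q 3, -q 2] (by simp [Fin.sum_univ_four]; ring)
  simp at k01 k02 k03 k12 k13 k23
  simp only [Fin.sum_univ_two] at hb
  have hzero : ∑ i, q i * ![b 0 0, b 0 1, b 1 0, b 1 1] i = 0 := by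
    simp only [Fin.sum_univ_four, Matrix.cons_val]
    by_contra hne
    apply hc
    ext j k
    have c0 : c 0 0 = 0 := by
      refine (mul_eq_zero.1 ?_).resolve_right hne
      linear_combination q 0 * hb + b 0 1 * k01 + b 1 0 * k02 + b 1 1 * k03
    have c1 : c 0 1 = 0 := by
      refine (mul_eq_zero.1 ?_).resolve_right hne
      linear_combination q 1 * hb - b 0 0 * k01 + b 1 0 * k12 + b 1 1 * k13
    have c2 : c 1 0 = 0 := by
      refine (mul_eq_zero.1 ?_).resolve_right hne
      linear_combination q 2 * hb - b 0 0 * k02 - b 0 1 * k12 + b 1 1 * k23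
    have c3 : c 1 1 = 0 := by
      refine (mul_eq_zero.1 ?_).resolve_right hne
      linear_combination q 3 * hb - b 0 0 * k03 - b 0 1 * k13 - b 1 0 * k23
    fin_cases j <;> fin_cases k <;> simp [c0, c1, c2, c3]
  obtain ⟨s, hs, e0, e1, e2, e3⟩ := hq _ hzero
  refine ⟨s, hs, fun j k => ?_⟩
  fin_cases j <;> fin_cases k <;> simp [e0, e1, e2, e3]

/-- The indices of the five tensors outside the three-dimensional subspace, for each factor. -/
def planeIndex : Fin 3 → Fin 2 → Fin 5 := ![![0, 4], ![2, 3], ![0, 1]]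

/-- The indices of the five tensors inside the three-dimensional subspace, for each factor. -/
def spaceIndex : Fin 3 → Fin 3 → Fin 5 := ![![1, 2, 3], ![0, 1, 4], ![2, 3, 4]]

lemma exists_index (q : Fin 3) (i : Fin 5) :
    (∃ a, i = planeIndex q a) ∨ ∃ l, i = spaceIndex q l := by
  revert q i; decide

lemma exists_vector {V : Type*} (q : Fin 3) (x : Fin 2 → V) (y : Fin 3 → V) :
    ∃ u : Fin 5 → V, (∀ a, u (planeIndex q a) = x a) ∧ ∀ l, u (spaceIndex q l) = y l := by
  fin_cases q
  · exact ⟨![x 0, y 0, y 1, y 2, x 1], by simp [Fin.forall_fin_two, planeIndex],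
      by simp [Fin.forall_fin_succ, spaceIndex]⟩
  · exact ⟨![y 0, y 1, x 0, x 1, y 2], by simp [Fin.forall_fin_two, planeIndex],
      by simp [Fin.forall_fin_succ, spaceIndex]⟩
  · exact ⟨![x 0, x 1, y 0, y 1, y 2], by simp [Fin.forall_fin_two, planeIndex],
      by simp [Fin.forall_fin_succ, spaceIndex]⟩

lemma coeffs_spaceIndex (q : Fin 5) :
    (∀ l l' k, coeffs q (spaceIndex 0 l) (spaceIndex 1 l') k = 0) ∧
    (∀ l j l', coeffs q (spaceIndex 0 l) j (spaceIndex 2 l') = 0) ∧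
    (∀ i l l', coeffs q i (spaceIndex 1 l) (spaceIndex 2 l') = 0) := by
  revert q; decide

/-- A form whose slices satisfy the same relations `c₁`, `c₂`, `c₃` as one of the five tensors
takes the values of this tensor, provided that its values on the quotient planes
become those of the tensor after adding elements of `V₁`, `V₂`, `V₃` to the vectors. The slices by
these elements are prescribed by `a`, `b`, `g`. -/
lemma exists_values (h : IsQuotientPlaneForm T V₁ V₂ V₃ τ) {m : Fin 2 → M} {n : Fin 2 → N}
    {p : Fin 2 → P} (hm : SpansMod V₁ (m 0) (m 1)) (hn : SpansMod V₂ (n 0) (n 1))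
    (hp : SpansMod V₃ (p 0) (p 1)) (q : Fin 5) (c₁ c₂ c₃ : Fin 2 → Fin 2 → ℤ) (hc₁ : c₁ ≠ 0)
    (hc₂ : c₂ ≠ 0) (hc₃ : c₃ ≠ 0)
    (r₁ : ∀ s ∈ V₁, ∑ j, ∑ k, (c₁ j k : ℂ) * T s (n j) (p k) = 0)
    (r₂ : ∀ s ∈ V₂, ∑ i, ∑ k, (c₂ i k : ℂ) * T (m i) s (p k) = 0)
    (r₃ : ∀ s ∈ V₃, ∑ i, ∑ j, (c₃ i j : ℂ) * T (m i) (n j) s = 0)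
    (o₁ : ∀ l, ∑ j, ∑ k, c₁ j k * coeffs q (spaceIndex 0 l) (planeIndex 1 j) (planeIndex 2 k) = 0)
    (o₂ : ∀ l, ∑ i, ∑ k, c₂ i k * coeffs q (planeIndex 0 i) (spaceIndex 1 l) (planeIndex 2 k) = 0)
    (o₃ : ∀ l, ∑ i, ∑ j, c₃ i j * coeffs q (planeIndex 0 i) (planeIndex 1 j) (spaceIndex 2 l) = 0)
    (a b g : Fin 2 → Fin 2 → Fin 2 → ℂ) (ha : ∀ i, ∑ j, ∑ k, (c₁ j k : ℂ) * a i j k = 0)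
    (hb : ∀ j, ∑ i, ∑ k, (c₂ i k : ℂ) * b j i k = 0)
    (hg : ∀ k, ∑ i, ∑ j, (c₃ i j : ℂ) * g k i j = 0)
    (hval : ∀ i j k, T (m i) (n j) (p k) + a i j k + b j i k + g k i j =
      coeffs q (planeIndex 0 i) (planeIndex 1 j) (planeIndex 2 k)) :
    HasFiveTensorValues T := by
  have cast_ne : ∀ c : Fin 2 → Fin 2 → ℤ, c ≠ 0 → (fun j k => (c j k : ℂ)) ≠ 0 := by
    intro c hc h0
    apply hc
    ext j k
    have := congrFun (congrFun h0 j) k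
    simpa using this
  have h₂ := h.flipLeft
  obtain ⟨τ', h₃'⟩ := h.flipRight
  have h₃ := h₃'.flipLeft
  choose α hα hα' using fun i => h.exists_slice hn hp (cast_ne _ hc₁) r₁ (a i) (ha i)
  choose β hβ hβ' using fun j => h₂.exists_slice hm hp (cast_ne _ hc₂) r₂ (b j) (hb j)
  choose γ hγ hγ' using fun k => h₃.exists_slice hm hn (cast_ne _ hc₃) r₃ (g k) (hg k)
  simp only [flipLeft_apply, flipRight_apply] at hβ' hγ'
  choose s hs hs' using fun l => h.exists_slice hn hp (cast_ne _ hc₁) r₁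
    (fun j k => (coeffs q (spaceIndex 0 l) (planeIndex 1 j) (planeIndex 2 k) : ℂ))
    (by exact_mod_cast o₁ l)
  choose t ht ht' using fun l => h₂.exists_slice hm hp (cast_ne _ hc₂) r₂
    (fun i k => (coeffs q (planeIndex 0 i) (spaceIndex 1 l) (planeIndex 2 k) : ℂ))
    (by exact_mod_cast o₂ l)
  choose r hr hr' using fun l => h₃.exists_slice hm hn (cast_ne _ hc₃) r₃
    (fun i j => (coeffs q (planeIndex 0 i) (planeIndex 1 j) (spaceIndex 2 l) : ℂ))
    (by exact_mod_cast o₃ l)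
  simp only [flipLeft_apply, flipRight_apply] at ht' hr'
  obtain ⟨u, hu, hu'⟩ := exists_vector 0 (fun i => m i + α i) s
  obtain ⟨v, hv, hv'⟩ := exists_vector 1 (fun i => n i + β i) t
  obtain ⟨w, hw, hw'⟩ := exists_vector 2 (fun i => p i + γ i) r
  obtain ⟨z₁, z₂, z₃⟩ := coeffs_spaceIndex q
  refine ⟨q, 1, u, v, w, fun x => ?_⟩
  have hx : x ∘ (1 : Equiv.Perm (Fin 3)) = ![x 0, x 1, x 2] := by
    ext i; fin_cases i <;> rfl
  rw [hx, fiveTensors_apply]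
  generalize x 0 = i
  generalize x 1 = j
  generalize x 2 = k
  obtain ⟨i, rfl⟩ | ⟨i, rfl⟩ := exists_index 0 i <;>
  obtain ⟨j, rfl⟩ | ⟨j, rfl⟩ := exists_index 1 j <;>
  obtain ⟨k, rfl⟩ | ⟨k, rfl⟩ := exists_index 2 k <;>
  simp only [hu, hv, hw, hu', hv', hw', map_add, LinearMap.add_apply, z₁, z₂, z₃, Int.cast_zero,
    fun a b c => h.vanish₁₂ _ (hs a) _ (ht b) c, fun a b c => h.vanish₁₂ _ (hα a) _ (ht b) c,
    fun a b c => h.vanish₁₂ _ (hs a) _ (hβ b) c, fun a b c => h.vanish₁₂ _ (hα a) _ (hβ b) c,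
    fun a b c => h.vanish₁₃ _ (hs a) c _ (hr b), fun a b c => h.vanish₁₃ _ (hα a) c _ (hr b),
    fun a b c => h.vanish₁₃ _ (hs a) c _ (hγ b), fun a b c => h.vanish₁₃ _ (hα a) c _ (hγ b),
    fun a b c => h.vanish₂₃ c _ (ht a) _ (hr b), fun a b c => h.vanish₂₃ c _ (hβ a) _ (hr b),
    fun a b c => h.vanish₂₃ c _ (ht a) _ (hγ b), fun a b c => h.vanish₂₃ c _ (hβ a) _ (hγ b),
    add_zero, hs', ht', hr', hα', hβ', hγ']
  rw [← hval]

end IsQuotientPlaneForm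

end NormalForms


/-! ### Classification of the relations -/

section Classification

open Module

variable {M N P : Type*} [AddCommGroup M] [Module ℂ M]
  [AddCommGroup N] [Module ℂ N] [AddCommGroup P] [Module ℂ P]
  {T : M →ₗ[ℂ] N →ₗ[ℂ] P →ₗ[ℂ] ℂ} {V₁ : Submodule ℂ M} {V₂ : Submodule ℂ N} {V₃ : Submodule ℂ P}
  {τ : (Fin 4 → ℂ) →ₗ[ℂ] M →ₗ[ℂ] N →ₗ[ℂ] P →ₗ[ℂ] ℂ}

/-- Four linear functionals on a four-dimensional space with no common zero
take arbitrary values. -/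
lemma exists_of_four_functionals (f : Fin 4 → (Fin 4 → ℂ) →ₗ[ℂ] ℂ)
    (hf : ∀ a, (∀ i, f i a = 0) → a = 0) (y : Fin 4 → ℂ) : ∃ a, ∀ i, f i a = y i := by
  have hinj : Function.Injective (LinearMap.pi f) := by
    rw [← LinearMap.ker_eq_bot, LinearMap.ker_eq_bot']
    exact fun a ha => hf a fun i => congrFun ha i
  obtain ⟨a, ha⟩ := LinearMap.injective_iff_surjective.1 hinj y
  exact ⟨a, fun i => congrFun ha i⟩

/-- A relation of rank one between the slices of `T` by `V₁`. -/
def HasPureRelation (T : M →ₗ[ℂ] N →ₗ[ℂ] P →ₗ[ℂ] ℂ) (V₁ : Submodule ℂ M) (V₂ : Submodule ℂ N)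
    (V₃ : Submodule ℂ P) : Prop := ∃ n ∉ V₂, ∃ p ∉ V₃, ∀ s ∈ V₁, T s n p = 0

namespace IsQuotientPlaneForm

/-- The evaluation of the family `τ` at a triple of vectors. -/
def evalAt (τ : (Fin 4 → ℂ) →ₗ[ℂ] M →ₗ[ℂ] N →ₗ[ℂ] P →ₗ[ℂ] ℂ) (m : M) (n : N) (p : P) :
    (Fin 4 → ℂ) →ₗ[ℂ] ℂ where
  toFun a := τ a m n p
  map_add' a b := by simp
  map_smul' c a := by simp

@[simp] lemma evalAt_apply (m : M) (n : N) (p : P) (a) : evalAt τ m n p a = τ a m n p := rfl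

/-- A relation without pure tensors pairs any basis of one quotient plane with a basis of the
other. -/
lemma exists_relation_of_not_hasPureRelation (h : IsQuotientPlaneForm T V₁ V₂ V₃ τ)
    (hp : ¬ HasPureRelation T V₁ V₂ V₃) {p₀ p₁ : P} (hs : SpansMod V₃ p₀ p₁) :
    ∃ n₀ n₁, SpansMod V₂ n₀ n₁ ∧ ∀ s ∈ V₁, T s n₀ p₀ + T s n₁ p₁ = 0 := by
  obtain ⟨x, y, hxy⟩ := exists_spansMod h.finrank₂
  obtain ⟨q, hq0, hq, -⟩ := h.exists_relation hxy hs
  by_cases hdet : q 0 * q 3 - q 2 * q 1 = 0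
  · exfalso
    apply hp
    by_cases h01 : q 0 = 0 ∧ q 1 = 0
    · refine ⟨y, hxy.symm.left_notMem h.finrank₂, q 2 • p₀ + q 3 • p₁, fun hmem => hq0 ?_,
        fun s hs => ?_⟩
      · have := hs.eq_zero h.finrank₃ hmem
        ext i
        fin_cases i <;> simp [h01, this]
      · have := hq s hs
        rw [h01.1, h01.2] at this
        simp only [map_add, map_smul, smul_eq_mul]
        linear_combination this
    · obtain ⟨c, h2, h3⟩ : ∃ c, q 2 = c * q 0 ∧ q 3 = c * q 1 := by
        by_cases h0 : q 0 = 0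
        · have h1 : q 1 ≠ 0 := fun h1 => h01 ⟨h0, h1⟩
          refine ⟨q 3 / q 1, ?_, by field_simp⟩
          rw [h0] at hdet ⊢
          simpa [h1] using hdet
        · refine ⟨q 2 / q 0, by field_simp, ?_⟩
          field_simp
          linear_combination hdet
      refine ⟨x + c • y, fun hmem => ?_, q 0 • p₀ + q 1 • p₁,
        fun hmem => h01 (hs.eq_zero h.finrank₃ hmem), fun s hs => ?_⟩
      · have := (hxy.eq_zero h.finrank₂ (a := 1) (b := c) (by simpa using hmem)).1
        simp at this
      · have := hq s hs
        rw [h2, h3] at this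
        simp only [map_add, map_smul, LinearMap.add_apply, LinearMap.smul_apply, smul_eq_mul]
        linear_combination this
  · refine ⟨q 0 • x + q 2 • y, q 1 • x + q 3 • y, hxy.change hdet (by simp) (by simp),
      fun s hs => ?_⟩
    have := hq s hs
    simp only [map_add, map_smul, LinearMap.add_apply, LinearMap.smul_apply, smul_eq_mul]
    linear_combination this

/-- Two relations of rank two determine the third one, by the existence of the
four-dimensional family `τ`; this is the case of `tensorO58`. -/
lemma hasFiveTensorValues_of_rank_two_two (h : IsQuotientPlaneForm T V₁ V₂ V₃ τ)
    (h₁ : ¬ HasPureRelation T V₁ V₂ V₃) (h₂ : ¬ HasPureRelation (_root_.flipLeft T) V₂ V₁ V₃) :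
    HasFiveTensorValues T := by
  obtain ⟨p₀, p₁, hp⟩ := exists_spansMod h.finrank₃
  obtain ⟨n₀, n₁, hn, rn⟩ := h.exists_relation_of_not_hasPureRelation h₁ hp
  obtain ⟨m₀, m₁, hm, rm⟩ := h.flipLeft.exists_relation_of_not_hasPureRelation h₂ hp
  simp only [flipLeft_apply] at rm
  obtain ⟨τ', h₃'⟩ := h.flipRight
  obtain ⟨q, hq0, hq, -⟩ := h₃'.flipLeft.exists_relation hm hn
  simp only [flipLeft_apply, flipRight_apply] at hq
  have tn : ∀ a m, τ a m n₀ p₀ + τ a m n₁ p₁ = 0 := fun a m => by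
    obtain ⟨s, hs, e⟩ := h.slice₁ a m
    rw [e, e, rn s hs]
  have tm : ∀ a n, τ a m₀ n p₀ + τ a m₁ n p₁ = 0 := fun a n => by
    obtain ⟨s, hs, e⟩ := h.slice₂ a n
    rw [e, e, rm s hs]
  have tq : ∀ a p, q 0 * τ a m₀ n₀ p + q 1 * τ a m₀ n₁ p + q 2 * τ a m₁ n₀ p
      + q 3 * τ a m₁ n₁ p = 0 := fun a p => by
    obtain ⟨s, hs, e⟩ := h.slice₃ a p
    rw [e, e, e, e, hq s hs]
  obtain hex := exists_of_four_functionals ![evalAt τ m₀ n₀ p₀, evalAt τ m₁ n₁ p₁,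
    evalAt τ m₀ n₀ p₁, evalAt τ m₁ n₁ p₀] (fun a ha => by
      have e0 := ha 0
      have e1 := ha 1
      have e2 := ha 2
      have e3 := ha 3
      simp at e0 e1 e2 e3
      have t1 := tn a m₀
      have t2 := tn a m₁
      have t3 := tm a n₀
      have t4 := tm a n₁
      rw [e0, zero_add] at t1 t3
      rw [e1, add_zero] at t2 t4
      exact h.eq_zero_of_values hm hn hp e0 e2 t4 t1 t2 t3 e3 e1)
  have hq1 : q 0 = 0 := by
    obtain ⟨a, ha⟩ := hex ![1, 0, 0, 0]
    have e0 := ha 0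
    have e1 := ha 1
    have e2 := ha 2
    have e3 := ha 3
    simp at e0 e1 e2 e3
    have := tq a p₀
    have t2 := tn a m₁
    have t4 := tm a n₁
    rw [e1, add_zero] at t2 t4
    rw [e0, t2, t4, e3] at this
    simpa using this
  have hq2 : q 3 = 0 := by
    obtain ⟨a, ha⟩ := hex ![0, 0, 0, 1]
    have e0 := ha 0
    have e1 := ha 1
    have e2 := ha 2
    have e3 := ha 3
    simp at e0 e1 e2 e3
    have := tq a p₀
    have t2 := tn a m₁
    have t4 := tm a n₁
    rw [e1, add_zero] at t2 t4
    rw [e0, t2, t4, e3] at this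
    simpa using this
  have hq3 : q 1 + q 2 = 0 := by
    obtain ⟨a, ha⟩ := hex ![0, 1, 0, 0]
    have e0 := ha 0
    have e1 := ha 1
    have e2 := ha 2
    have e3 := ha 3
    simp at e0 e1 e2 e3
    have := tq a p₀
    have t2 := tn a m₁
    have t4 := tm a n₁
    rw [e1] at t2 t4
    rw [e0, e3] at this
    linear_combination -this + q 1 * t4 + q 2 * t2
  have hq1' : q 1 ≠ 0 := fun h0 => hq0 (by
    have : q 2 = 0 := by simpa [h0] using hq3
    ext i; fin_cases i <;> simp [*])
  have rq : ∀ s ∈ V₃, T m₀ n₁ s - T m₁ n₀ s = 0 := fun s hs => by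
    have := hq s hs
    refine (mul_eq_zero.1 ?_).resolve_left hq1'
    rw [hq1, hq2] at this
    linear_combination this - T m₁ n₀ s * hq3
  have hm' : SpansMod V₁ m₀ (-m₁) :=
    hm.change (a := 1) (b := 0) (c := 0) (d := -1) (by norm_num) (by simp) (by simp)
  refine h.exists_values (m := ![m₀, -m₁]) (n := ![n₀, n₁]) (p := ![p₀, p₁]) hm' hn hp 0
    ![![1, 0], ![0, 1]] ![![1, 0], ![0, -1]] ![![0, 1], ![1, 0]] (by decide) (by decide)
    (by decide) (fun s hs => ?_) (fun s hs => ?_) (fun s hs => ?_) (by decide) (by decide)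
    (by decide)
    ![![![0, -T m₀ n₀ p₁], ![-T m₀ n₁ p₀, 0]], ![![0, T m₁ n₀ p₁], ![T m₁ n₁ p₀, 0]]]
    ![![![0, 0], ![T m₁ n₀ p₀, 0]], ![![0, -T m₀ n₁ p₁], ![0, 0]]]
    ![![![-T m₀ n₀ p₀, 0], ![0, 0]], ![![0, 0], ![0, T m₁ n₁ p₁]]] ?_ ?_ ?_ ?_
  · simpa [Fin.sum_univ_two] using rn s hs
  · simpa [Fin.sum_univ_two] using rm s hs
  · simpa [Fin.sum_univ_two, sub_eq_add_neg] using rq s hs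
  · simp [Fin.sum_univ_two]
  · simp [Fin.sum_univ_two]
  · simp [Fin.forall_fin_two, Fin.sum_univ_two]
  · have hz : ∀ i j k, coeffs 0 (planeIndex 0 i) (planeIndex 1 j) (planeIndex 2 k) = 0 := by decide
    intro i j k
    rw [hz]
    fin_cases i <;> fin_cases j <;> fin_cases k <;> simp

/-- One relation of rank two and one of rank one determine the third one, which has
rank one; this is the case of `tensorO57`. -/
lemma hasFiveTensorValues_of_rank_two_one (h : IsQuotientPlaneForm T V₁ V₂ V₃ τ)
    (h₁ : ¬ HasPureRelation T V₁ V₂ V₃) (h₂ : HasPureRelation (_root_.flipLeft T) V₂ V₁ V₃) :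
    HasFiveTensorValues T := by
  obtain ⟨m₁, hm₁, p₁, hp₁, rm⟩ := h₂
  simp only [flipLeft_apply] at rm
  obtain ⟨p₀, hp⟩ := exists_spansMod_left h.finrank₃ hp₁
  replace hp := hp.symm
  obtain ⟨m₀, hm⟩ := exists_spansMod_left h.finrank₁ hm₁
  replace hm := hm.symm
  obtain ⟨n₀, n₁, hn, rn⟩ := h.exists_relation_of_not_hasPureRelation h₁ hp
  obtain ⟨τ', h₃'⟩ := h.flipRight
  obtain ⟨q, hq0, hq, -⟩ := h₃'.flipLeft.exists_relation hm hn
  simp only [flipLeft_apply, flipRight_apply] at hq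
  have tn : ∀ a m, τ a m n₀ p₀ + τ a m n₁ p₁ = 0 := fun a m => by
    obtain ⟨s, hs, e⟩ := h.slice₁ a m
    rw [e, e, rn s hs]
  have tm : ∀ a n, τ a m₁ n p₁ = 0 := fun a n => by
    obtain ⟨s, hs, e⟩ := h.slice₂ a n
    rw [e, rm s hs]
  have tm' : ∀ a, τ a m₁ n₀ p₀ = 0 := fun a => by
    have := tn a m₁
    rwa [tm, add_zero] at this
  have tq : ∀ a, q 0 * τ a m₀ n₀ p₀ + q 1 * τ a m₀ n₁ p₀ + q 3 * τ a m₁ n₁ p₀ = 0 := fun a => by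
    obtain ⟨s, hs, e⟩ := h.slice₃ a p₀
    have := hq s hs
    rw [← e, ← e, ← e, ← e, tm'] at this
    linear_combination this
  have hex := exists_of_four_functionals ![evalAt τ m₀ n₀ p₀, evalAt τ m₀ n₁ p₀,
    evalAt τ m₁ n₁ p₀, evalAt τ m₀ n₀ p₁] (fun a ha => by
      have e0 := ha 0
      have e1 := ha 1
      have e2 := ha 2
      have e3 := ha 3
      simp at e0 e1 e2 e3
      have t1 := tn a m₀
      rw [e0, zero_add] at t1
      exact h.eq_zero_of_values hm hn hp e0 e3 e1 t1 (tm' a) (tm a n₀) e2 (tm a n₁))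
  have hq' : q 0 = 0 ∧ q 1 = 0 ∧ q 3 = 0 := by
    have key : ∀ y : Fin 4 → ℂ, q 0 * y 0 + q 1 * y 1 + q 3 * y 2 = 0 := fun y => by
      obtain ⟨a, ha⟩ := hex y
      have := tq a
      rw [← ha 0, ← ha 1, ← ha 2]
      exact this
    exact ⟨by simpa using key ![1, 0, 0, 0], by simpa using key ![0, 1, 0, 0],
      by simpa using key ![0, 0, 1, 0]⟩
  have hq2 : q 2 ≠ 0 := fun h0 => hq0 (by ext i; fin_cases i <;> simp [hq', h0])
  have rq : ∀ s ∈ V₃, T m₁ n₀ s = 0 := fun s hs => by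
    have := hq s hs
    simpa [hq', hq2] using this
  refine h.exists_values (m := ![m₀, m₁]) (n := ![n₀, n₁]) (p := ![p₀, p₁]) hm hn hp 1
    ![![1, 0], ![0, 1]] ![![0, 0], ![0, 1]] ![![0, 0], ![1, 0]] (by decide) (by decide)
    (by decide) (fun s hs => ?_) (fun s hs => ?_) (fun s hs => ?_) (by decide) (by decide)
    (by decide)
    ![![![0, 0], ![0, 0]], ![![0, -T m₁ n₀ p₁], ![0, 0]]]
    ![![![-T m₀ n₀ p₀, -T m₀ n₀ p₁], ![-T m₁ n₀ p₀, 0]],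
      ![![-T m₀ n₁ p₀, -T m₀ n₁ p₁], ![-T m₁ n₁ p₀, 0]]]
    ![![![0, 0], ![0, 0]], ![![0, 0], ![0, -T m₁ n₁ p₁]]] ?_ ?_ ?_ ?_
  · simpa [Fin.sum_univ_two] using rn s hs
  · simpa [Fin.sum_univ_two] using rm s hs
  · simpa [Fin.sum_univ_two] using rq s hs
  · simp [Fin.forall_fin_two, Fin.sum_univ_two]
  · simp [Fin.forall_fin_two, Fin.sum_univ_two]
  · simp [Fin.forall_fin_two, Fin.sum_univ_two]
  · have hz : ∀ i j k, coeffs 1 (planeIndex 0 i) (planeIndex 1 j) (planeIndex 2 k) = 0 := by decide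
    intro i j k
    rw [hz]
    fin_cases i <;> fin_cases j <;> fin_cases k <;> simp

/-- Two relations of rank one involving different vectors of the common quotient plane determine
the third one; this is the case of `tensorO56`. -/
lemma hasFiveTensorValues_of_mismatch (h : IsQuotientPlaneForm T V₁ V₂ V₃ τ) {m m₁ : M} {n₀ : N}
    {p₁ : P} (hmm : SpansMod V₁ m m₁) (hn₀ : n₀ ∉ V₂) (hp₁ : p₁ ∉ V₃)
    (rm : ∀ s ∈ V₂, T m s p₁ = 0) (rq : ∀ s ∈ V₃, T m₁ n₀ s = 0) : HasFiveTensorValues T := by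
  obtain ⟨p₀, hp⟩ := exists_spansMod_left h.finrank₃ hp₁
  replace hp := hp.symm
  obtain ⟨n₁, hn⟩ := exists_spansMod_left h.finrank₂ hn₀
  -- in `tensorO56` the mismatched vectors are `m₀ - m₁` and `m₁`
  obtain ⟨m₀, rfl⟩ : ∃ m₀, m = m₀ - m₁ := ⟨m + m₁, by abel⟩
  have hm : SpansMod V₁ m₀ m₁ :=
    hmm.change (a := 1) (b := 1) (c := 0) (d := 1) (by norm_num) (by simp) (by simp)
  obtain ⟨q, hq0, hq, -⟩ := h.exists_relation hn hp
  have tm : ∀ a n, τ a m₀ n p₁ = τ a m₁ n p₁ := fun a n => by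
    obtain ⟨s, hs, e⟩ := h.slice₂ a n
    have := rm s hs
    rwa [map_sub, LinearMap.sub_apply, LinearMap.sub_apply, ← e, ← e, sub_eq_zero] at this
  have tq : ∀ a p, τ a m₁ n₀ p = 0 := fun a p => by
    obtain ⟨s, hs, e⟩ := h.slice₃ a p
    rw [e, rq s hs]
  have tn : ∀ a, q 0 * τ a m₀ n₀ p₀ + q 2 * τ a m₀ n₁ p₀ + q 3 * τ a m₀ n₁ p₁ = 0 := fun a => by
    obtain ⟨s, hs, e⟩ := h.slice₁ a m₀
    have := hq s hs
    rw [← e, ← e, ← e, ← e, tm a n₀, tq] at this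
    linear_combination this
  have hex := exists_of_four_functionals ![evalAt τ m₀ n₀ p₀, evalAt τ m₀ n₁ p₀,
    evalAt τ m₀ n₁ p₁, evalAt τ m₁ n₁ p₀] (fun a ha => by
      have e0 := ha 0
      have e1 := ha 1
      have e2 := ha 2
      have e3 := ha 3
      simp at e0 e1 e2 e3
      exact h.eq_zero_of_values hm hn hp e0 ((tm a n₀).trans (tq a p₁)) e1 e2 (tq a p₀)
        (tq a p₁) e3 ((tm a n₁).symm.trans e2))
  have hq' : q 0 = 0 ∧ q 2 = 0 ∧ q 3 = 0 := by
    have key : ∀ y : Fin 4 → ℂ, q 0 * y 0 + q 2 * y 1 + q 3 * y 2 = 0 := fun y => by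
      obtain ⟨a, ha⟩ := hex y
      have := tn a
      rw [← ha 0, ← ha 1, ← ha 2]
      exact this
    exact ⟨by simpa using key ![1, 0, 0, 0], by simpa using key ![0, 1, 0, 0],
      by simpa using key ![0, 0, 1, 0]⟩
  have hq1 : q 1 ≠ 0 := fun h0 => hq0 (by ext i; fin_cases i <;> simp [hq', h0])
  have rn : ∀ s ∈ V₁, T s n₀ p₁ = 0 := fun s hs => by
    have := hq s hs
    simpa [hq', hq1] using this
  refine h.exists_values (m := ![m₀, m₁]) (n := ![n₀, n₁]) (p := ![p₀, p₁]) hm hn hp 2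
    ![![0, 1], ![0, 0]] ![![0, 1], ![0, -1]] ![![0, 0], ![1, 0]] (by decide) (by decide)
    (by decide) (fun s hs => ?_) (fun s hs => ?_) (fun s hs => ?_) (by decide) (by decide)
    (by decide)
    ![![![-T m₀ n₀ p₀, 0], ![-T m₀ n₁ p₀, -T m₀ n₁ p₁]],
      ![![-T m₁ n₀ p₀, 0], ![-T m₁ n₁ p₀, -T m₁ n₁ p₁]]]
    ![![![0, -T m₁ n₀ p₁], ![0, -T m₁ n₀ p₁]], ![![0, 0], ![0, 0]]]
    ![![![0, 0], ![0, 0]], ![![T m₁ n₀ p₁ - T m₀ n₀ p₁, 0], ![0, 0]]] ?_ ?_ ?_ ?_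
  · simpa [Fin.sum_univ_two] using rn s hs
  · simpa [Fin.sum_univ_two, sub_eq_add_neg] using rm s hs
  · simpa [Fin.sum_univ_two] using rq s hs
  · simp [Fin.forall_fin_two, Fin.sum_univ_two]
  · simp [Fin.sum_univ_two]
  · simp [Fin.forall_fin_two, Fin.sum_univ_two]
  · have hz : ∀ i j k, coeffs 2 (planeIndex 0 i) (planeIndex 1 j) (planeIndex 2 k) = 0 := by decide
    intro i j k
    rw [hz]
    fin_cases i <;> fin_cases j <;> fin_cases k <;> simp <;> ring

/-- When three relations of rank one involve a single vector of each quotient plane,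
the only further invariant is whether the form vanishes on these three vectors;
these are the cases of `tensorO55` and `tensorO54`. -/
lemma hasFiveTensorValues_of_match (h : IsQuotientPlaneForm T V₁ V₂ V₃ τ) {m₁ : M} {n₀ : N}
    {p₁ : P} (hm₁ : m₁ ∉ V₁) (hn₀ : n₀ ∉ V₂) (hp₁ : p₁ ∉ V₃) (rn : ∀ s ∈ V₁, T s n₀ p₁ = 0)
    (rm : ∀ s ∈ V₂, T m₁ s p₁ = 0) (rq : ∀ s ∈ V₃, T m₁ n₀ s = 0) : HasFiveTensorValues T := by
  obtain ⟨x, hx⟩ : ∃ x, x = T m₁ n₀ p₁ := ⟨_, rfl⟩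
  wlog hx1 : x = 0 ∨ x = 1 generalizing m₁ x
  · have hx0 : x ≠ 0 := fun h0 => hx1 (Or.inl h0)
    exact this (m₁ := x⁻¹ • m₁) (fun hmem => hm₁ (by simpa [hx0] using V₁.smul_mem x hmem))
      (fun s hs => by simp [rm s hs]) (fun s hs => by simp [rq s hs]) 1
      (by simp [← hx, hx0]) (Or.inr rfl)
  obtain ⟨p₀, hp⟩ := exists_spansMod_left h.finrank₃ hp₁
  replace hp := hp.symm
  obtain ⟨n₁, hn⟩ := exists_spansMod_left h.finrank₂ hn₀
  obtain ⟨m₀, hm⟩ := exists_spansMod_left h.finrank₁ hm₁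
  replace hm := hm.symm
  obtain ⟨e, he, heq⟩ : ∃ e : Fin 5, (e = 3 ∨ e = 4) ∧ x = coeffs e 4 2 1 := by
    rcases hx1 with h0 | h0
    · exact ⟨4, Or.inr rfl, by rw [h0, show coeffs 4 4 2 1 = 0 by decide]; simp⟩
    · exact ⟨3, Or.inl rfl, by rw [h0, show coeffs 3 4 2 1 = 1 by decide]; simp⟩
  refine h.exists_values (m := ![m₀, m₁]) (n := ![n₀, n₁]) (p := ![p₀, p₁]) hm hn hp e
    ![![0, 1], ![0, 0]] ![![0, 0], ![0, 1]] ![![0, 0], ![1, 0]] (by decide) (by decide)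
    (by decide) (fun s hs => ?_) (fun s hs => ?_) (fun s hs => ?_)
    (by rcases he with rfl | rfl <;> decide) (by rcases he with rfl | rfl <;> decide)
    (by rcases he with rfl | rfl <;> decide)
    ![![![-T m₀ n₀ p₀, 0], ![-T m₀ n₁ p₀, -T m₀ n₁ p₁]],
      ![![-T m₁ n₀ p₀, 0], ![-T m₁ n₁ p₀, -T m₁ n₁ p₁]]]
    ![![![0, -T m₀ n₀ p₁], ![0, 0]], ![![0, 0], ![0, 0]]]
    0 ?_ ?_ ?_ ?_
  · simpa [Fin.sum_univ_two] using rn s hs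
  · simpa [Fin.sum_univ_two] using rm s hs
  · simpa [Fin.sum_univ_two] using rq s hs
  · simp [Fin.forall_fin_two, Fin.sum_univ_two]
  · simp [Fin.forall_fin_two, Fin.sum_univ_two]
  · simp
  · have hz : ∀ i j k, coeffs e (planeIndex 0 i) (planeIndex 1 j) (planeIndex 2 k) =
        if i = 1 ∧ j = 0 ∧ k = 1 then coeffs e 4 2 1 else 0 := by
      rcases he with rfl | rfl <;> decide
    intro i j k
    rw [hz]
    fin_cases i <;> fin_cases j <;> fin_cases k <;> simp [← hx, heq]

/-- The three relations of a quotient plane form have, up to a permutation, the ranks `(2, 2, 2)`,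
`(2, 1, 1)` or `(1, 1, 1)`, and the position of the vectors in the last case is one of two. -/
theorem hasFiveTensorValues (h : IsQuotientPlaneForm T V₁ V₂ V₃ τ) : HasFiveTensorValues T := by
  obtain ⟨τ', hr⟩ := h.flipRight
  obtain ⟨τ'', hr'⟩ := h.flipLeft.flipRight
  by_cases h₁ : HasPureRelation T V₁ V₂ V₃
  swap
  · by_cases h₂ : HasPureRelation (_root_.flipLeft T) V₂ V₁ V₃
    · exact h.hasFiveTensorValues_of_rank_two_one h₁ h₂
    · exact h.hasFiveTensorValues_of_rank_two_two h₁ h₂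
  obtain ⟨n, hn, p, hp, r₁⟩ := h₁
  by_cases h₂ : HasPureRelation (_root_.flipLeft T) V₂ V₁ V₃
  swap
  · exact .of_flipLeft (h.flipLeft.hasFiveTensorValues_of_rank_two_one h₂ ⟨n, hn, p, hp, r₁⟩)
  obtain ⟨m, hm, p', hp', r₂⟩ := h₂
  by_cases h₃ : HasPureRelation (_root_.flipLeft (_root_.flipRight T)) V₃ V₁ V₂
  swap
  · exact .of_flipRight (.of_flipLeft (hr.flipLeft.hasFiveTensorValues_of_rank_two_one h₃
      ⟨p, hp, n, hn, r₁⟩))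
  obtain ⟨m', hm', n', hn', r₃⟩ := h₃
  simp only [flipLeft_apply, flipRight_apply] at r₂ r₃
  rcases spansMod_or_exists_smul h.finrank₁ hm hm' with hs | ⟨c, hc, hmc⟩
  · exact h.hasFiveTensorValues_of_mismatch hs hn' hp' r₂ r₃
  rcases spansMod_or_exists_smul h.finrank₂ hn hn' with hs | ⟨d, hd, hnd⟩
  · exact .of_flipLeft (h.flipLeft.hasFiveTensorValues_of_mismatch hs hm' hp r₁ r₃)
  rcases spansMod_or_exists_smul h.finrank₃ hp hp' with hs | ⟨e, he, hpe⟩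
  · exact .of_flipRight (.of_flipLeft (hr.flipLeft.hasFiveTensorValues_of_mismatch hs hm hn
      r₁ r₂))
  refine h.hasFiveTensorValues_of_match hm hn hp r₁ (fun s hs => ?_) (fun s hs => ?_)
  · have h1 := r₂ s hs
    have h2 := h.vanish₂₃ m s hs _ hpe
    rw [map_sub, h1, map_smul, zero_sub, neg_eq_zero, smul_eq_zero] at h2
    exact h2.resolve_left he
  · have h1 := r₃ s hs
    have h2 := h.vanish₁₃ _ hmc n' s hs
    have h3 := h.vanish₂₃ m _ hnd s hs
    rw [map_sub, LinearMap.sub_apply, LinearMap.sub_apply, h1, map_smul, LinearMap.smul_apply,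
      LinearMap.smul_apply, zero_sub, neg_eq_zero, smul_eq_zero] at h2
    rw [map_sub, LinearMap.sub_apply, h2.resolve_left hc, map_smul, LinearMap.smul_apply, zero_sub,
      neg_eq_zero, smul_eq_zero] at h3
    exact h3.resolve_left hd

end IsQuotientPlaneForm

end Classification


/-! ### The trilinear form of a tensor -/

section TensorForm

open Module

variable {m : ℕ}

/-- The trilinear form on `A^* × B^* × C^*` given by a tensor. -/
def tensorForm (T : Tensor3 m) :
    (Fin m → ℂ) →ₗ[ℂ] (Fin m → ℂ) →ₗ[ℂ] (Fin m → ℂ) →ₗ[ℂ] ℂ :=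
  ∑ i, ∑ j, ∑ k, (LinearMap.proj i).smulRight
    ((LinearMap.proj j).smulRight (T ![i, j, k] • LinearMap.proj k))

lemma tensorForm_apply (T : Tensor3 m) (x y z : Fin m → ℂ) :
    tensorForm T x y z = ∑ i, ∑ j, ∑ k, x i * y j * z k * T ![i, j, k] := by
  simp only [tensorForm, LinearMap.sum_apply, LinearMap.smulRight_apply, LinearMap.smul_apply,
    LinearMap.proj_apply, smul_eq_mul]
  exact Finset.sum_congr rfl fun i _ => Finset.sum_congr rfl fun j _ =>
    Finset.sum_congr rfl fun k _ => by ring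

lemma tensorForm_ext {F G : (Fin m → ℂ) →ₗ[ℂ] (Fin m → ℂ) →ₗ[ℂ] (Fin m → ℂ) →ₗ[ℂ] ℂ}
    (h : ∀ i j k, F (Pi.single i 1) (Pi.single j 1) (Pi.single k 1) =
      G (Pi.single i 1) (Pi.single j 1) (Pi.single k 1)) : F = G := by
  ext i j k
  simpa using h i j k

/-- Sums over multi-indices as iterated sums. -/
lemma sum_fin_three_arrow {β : Type*} [AddCommMonoid β] (f : (Fin 3 → Fin m) → β) :
    ∑ y, f y = ∑ i, ∑ j, ∑ k, f ![i, j, k] := by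
  let e : (Fin 3 → Fin m) ≃ Fin m × Fin m × Fin m :=
    { toFun := fun y => (y 0, y 1, y 2)
      invFun := fun t => ![t.1, t.2.1, t.2.2]
      left_inv := fun y => by ext i; fin_cases i <;> rfl
      right_inv := fun t => rfl }
  rw [← e.symm.sum_comp, Fintype.sum_prod_type]
  refine Finset.sum_congr rfl fun i _ => ?_
  rw [Fintype.sum_prod_type]
  rfl

lemma eq_vec_three (x : Fin 3 → Fin m) : x = ![x 0, x 1, x 2] := by
  ext i; fin_cases i <;> rfl

lemma sum_update_zero (T : Tensor3 m) (c : Fin m → ℂ) (x : Fin 3 → Fin m) :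
    ∑ i, c i * T (Function.update x 0 i) = contractA T c (x 2) (x 1) :=
  Finset.sum_congr rfl fun i _ => by rw [eq_vec_three (Function.update x 0 i)]; simp

lemma sum_update_one (T : Tensor3 m) (c : Fin m → ℂ) (x : Fin 3 → Fin m) :
    ∑ i, c i * T (Function.update x 1 i) = contractB T c (x 2) (x 0) :=
  Finset.sum_congr rfl fun i _ => by rw [eq_vec_three (Function.update x 1 i)]; simp

lemma sum_update_two (T : Tensor3 m) (c : Fin m → ℂ) (x : Fin 3 → Fin m) :
    ∑ i, c i * T (Function.update x 2 i) = contractC T c (x 1) (x 0) :=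
  Finset.sum_congr rfl fun i _ => by rw [eq_vec_three (Function.update x 2 i)]; simp

/-- Conciseness in a form symmetric in the three factors. -/
lemma isConcise_iff (T : Tensor3 m) : IsConcise T ↔ ∀ (p : Fin 3) (c : Fin m → ℂ),
    (∀ x, ∑ i, c i * T (Function.update x p i) = 0) → c = 0 := by
  have key : ∀ L : (Fin m → ℂ) →ₗ[ℂ] Matrix (Fin m) (Fin m) ℂ,
      Function.Injective L ↔ ∀ c, L c = 0 → c = 0 := fun L => by
    rw [← LinearMap.ker_eq_bot, LinearMap.ker_eq_bot']
  have hA : ∀ c, contractA T c = 0 ↔ ∀ x, ∑ i, c i * T (Function.update x 0 i) = 0 := by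
    intro c
    simp only [sum_update_zero]
    refine ⟨fun h x => by rw [h]; rfl, fun h => Matrix.ext fun k j => h ![k, j, k]⟩
  have hB : ∀ c, contractB T c = 0 ↔ ∀ x, ∑ i, c i * T (Function.update x 1 i) = 0 := by
    intro c
    simp only [sum_update_one]
    refine ⟨fun h x => by rw [h]; rfl, fun h => Matrix.ext fun k j => h ![j, k, k]⟩
  have hC : ∀ c, contractC T c = 0 ↔ ∀ x, ∑ i, c i * T (Function.update x 2 i) = 0 := by
    intro c
    simp only [sum_update_two]
    refine ⟨fun h x => by rw [h]; rfl, fun h => Matrix.ext fun k j => h ![j, k, k]⟩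
  simp only [IsConcise, key, hA, hB, hC, Fin.forall_fin_succ, Fin.isEmpty.forall_iff, and_true]
  rfl

lemma isConcise_iff_linearIndependent (T : Tensor3 m) : IsConcise T ↔
    ∀ p, LinearIndependent ℂ fun (i : Fin m) (x : Fin 3 → Fin m) => T (Function.update x p i) := by
  rw [isConcise_iff]
  refine forall_congr' fun p => ?_
  rw [Fintype.linearIndependent_iff]
  simp only [funext_iff, Finset.sum_apply, Pi.smul_apply, smul_eq_mul, Pi.zero_apply]

lemma isOpen_setOf_isConcise : IsOpen {T : Tensor3 m | IsConcise T} := by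
  simp only [isConcise_iff_linearIndependent, Set.ofPred_forall]
  refine isOpen_iInter_of_finite fun p => ?_
  have hc : Continuous fun (T : Tensor3 m) (i : Fin m) (x : Fin 3 → Fin m) =>
      T (Function.update x p i) := by fun_prop
  exact (isOpen_setOfPred_linearIndependent (𝕜 := ℂ) (ι := Fin m)
    (E := (Fin 3 → Fin m) → ℂ)).preimage hc

/-- Each argument of the trilinear form of a `1`-degenerate tensor has singular slices. -/
lemma IsOneDegenerate.exists_tensorForm_eq_zero {T : Tensor3 m} (h : IsOneDegenerate T) :
    (∀ x, ∃ y ≠ 0, ∀ z, tensorForm T x y z = 0) ∧ (∀ y, ∃ x ≠ 0, ∀ z, tensorForm T x y z = 0) ∧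
      ∀ z, ∃ x ≠ 0, ∀ y, tensorForm T x y z = 0 := by
  simp only [IsOneDegenerate, IsOneStarGeneric, not_or, not_exists] at h
  have key : ∀ M : Matrix (Fin m) (Fin m) ℂ, M.rank ≠ m → ∃ v ≠ 0, M.mulVec v = 0 := by
    intro M hM
    rw [Matrix.exists_mulVec_eq_zero_iff]
    by_contra hd
    apply hM
    rw [Matrix.rank_of_isUnit M ((Matrix.isUnit_iff_isUnit_det M).2 (isUnit_iff_ne_zero.2 hd)),
      Fintype.card_fin]
  refine ⟨fun x => ?_, fun y => ?_, fun z => ?_⟩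
  · obtain ⟨y, hy, h0⟩ := key _ (h.1 x)
    refine ⟨y, hy, fun z => ?_⟩
    calc _ = ∑ k, z k * (contractA T x).mulVec y k := by
          simp only [tensorForm_apply, contractA, dotProduct, Matrix.mulVec, LinearMap.coe_mk,
            AddHom.coe_mk, Matrix.of_apply, Finset.mul_sum, Finset.sum_mul]
          rw [Finset.sum_comm_cycle]
          refine Finset.sum_congr rfl fun k _ => ?_
          rw [Finset.sum_comm]
          exact Finset.sum_congr rfl fun j _ => Finset.sum_congr rfl fun i _ => by ring
      _ = 0 := by simp [h0]
  · obtain ⟨x, hx, h0⟩ := key _ (h.2.1 y)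
    refine ⟨x, hx, fun z => ?_⟩
    calc _ = ∑ k, z k * (contractB T y).mulVec x k := by
          simp only [tensorForm_apply, contractB, dotProduct, Matrix.mulVec, LinearMap.coe_mk,
            AddHom.coe_mk, Matrix.of_apply, Finset.mul_sum, Finset.sum_mul]
          rw [Finset.sum_comm_cycle]
          exact Finset.sum_congr rfl fun k _ => Finset.sum_congr rfl fun j _ =>
            Finset.sum_congr rfl fun i _ => by ring
      _ = 0 := by simp [h0]
  · obtain ⟨x, hx, h0⟩ := key _ (h.2.2 z)
    refine ⟨x, hx, fun y => ?_⟩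
    calc _ = ∑ j, y j * (contractC T z).mulVec x j := by
          simp only [tensorForm_apply, contractC, dotProduct, Matrix.mulVec, LinearMap.coe_mk,
            AddHom.coe_mk, Matrix.of_apply, Finset.mul_sum, Finset.sum_mul]
          rw [Finset.sum_comm]
          exact Finset.sum_congr rfl fun k _ => Finset.sum_congr rfl fun j _ =>
            Finset.sum_congr rfl fun i _ => by ring
      _ = 0 := by simp [h0]

lemma IsConcise.tensorForm_nondegenerate {T : Tensor3 m} (h : IsConcise T) :
    (∀ x, (∀ y z, tensorForm T x y z = 0) → x = 0) ∧
      (∀ y, (∀ x z, tensorForm T x y z = 0) → y = 0) ∧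
      ∀ z, (∀ x y, tensorForm T x y z = 0) → z = 0 := by
  rw [isConcise_iff] at h
  refine ⟨fun v hv => h 0 v fun x => ?_, fun v hv => h 1 v fun x => ?_,
    fun v hv => h 2 v fun x => ?_⟩
  · rw [sum_update_zero, ← hv (Pi.single (x 1) 1) (Pi.single (x 2) 1)]
    simp [tensorForm_apply, Pi.single_apply, contractA]
  · rw [sum_update_one, ← hv (Pi.single (x 0) 1) (Pi.single (x 2) 1)]
    simp [tensorForm_apply, Pi.single_apply, contractB]
  · rw [sum_update_two, ← hv (Pi.single (x 0) 1) (Pi.single (x 1) 1)]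
    simp [tensorForm_apply, Pi.single_apply, contractC]

end TensorForm

/-! ### Semicontinuity of the algebra of balanced endomorphisms -/

section Semicontinuity

open Module

variable {m : ℕ}

/-- The effect of the matrix `X p` on the factor `p` of the tensor `T`, for every `p`, as a linear
map; the value at `(p, q)` is the difference of the effects on the factors `p` and `q`. -/
def balanceMap : Tensor3 m →ₗ[ℂ] (Fin 3 → Fin m → Fin m → ℂ) →ₗ[ℂ] (Fin 3 → Fin 3 → Tensor3 m) :=
  LinearMap.mk₂ ℂ (fun T X p q x => ∑ a, X p a (x p) * T (Function.update x p a) -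
      ∑ a, X q a (x q) * T (Function.update x q a))
    (fun T T' X => by
      funext p q x
      simp only [Pi.add_apply, mul_add, Finset.sum_add_distrib]; ring)
    (fun c T X => by
      funext p q x
      simp only [Pi.smul_apply, smul_eq_mul, mul_sub, Finset.mul_sum, mul_left_comm])
    (fun T X X' => by
      funext p q x
      simp only [Pi.add_apply, add_mul, Finset.sum_add_distrib]; ring)
    (fun c T X => by
      funext p q x
      simp only [Pi.smul_apply, smul_eq_mul, mul_sub, Finset.mul_sum, mul_assoc])

lemma mem_ker_balanceMap {T : Tensor3 m} {X : Fin 3 → Fin m → Fin m → ℂ} :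
    X ∈ LinearMap.ker (balanceMap T) ↔ ∀ p q x, ∑ a, X p a (x p) * T (Function.update x p a) =
      ∑ a, X q a (x q) * T (Function.update x q a) := by
  simp only [LinearMap.mem_ker, funext_iff, balanceMap, LinearMap.mk₂_apply, Pi.zero_apply,
    sub_eq_zero]

lemma isClosed_setOf_le_finrank_ker (d : ℕ) :
    IsClosed {T : Tensor3 m | d ≤ finrank ℂ (LinearMap.ker (balanceMap T))} := by
  set E := Fin 3 → Fin m → Fin m → ℂ
  set F := Fin 3 → Fin 3 → Tensor3 m
  let Ψ : Tensor3 m →ₗ[ℂ] (E →L[ℂ] F) :=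
    (LinearMap.toContinuousLinearMap (𝕜 := ℂ) (E := E) (F' := F)).toLinearMap ∘ₗ balanceMap
  have hΨ : Continuous Ψ := Ψ.continuous_of_finiteDimensional
  rw [← isOpen_compl_iff]
  by_cases hd : d ≤ finrank ℂ E
  · convert (isOpen_setOfPred_nat_le_rank (𝕜 := ℂ) (E := E) (F := F)
      (finrank ℂ E - d + 1)).preimage hΨ using 1
    ext T
    have h1 := LinearMap.finrank_range_add_finrank_ker (balanceMap T)
    have h2 : ((finrank ℂ E - d + 1 : ℕ) : Cardinal) ≤ LinearMap.rank (balanceMap T) ↔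
        finrank ℂ E - d + 1 ≤ finrank ℂ (LinearMap.range (balanceMap T)) := by
      rw [LinearMap.rank, ← finrank_eq_rank, Nat.cast_le]
    change _ + _ = finrank ℂ E at h1
    simp only [Set.mem_compl_iff, Set.mem_ofPred_eq, Set.mem_preimage, not_le]
    refine Iff.trans ?_ h2.symm
    omega
  · convert isOpen_univ
    ext T
    have h1 := LinearMap.finrank_range_add_finrank_ker (balanceMap T)
    change _ + _ = finrank ℂ E at h1
    simp only [Set.mem_compl_iff, Set.mem_ofPred_eq, Set.mem_univ, iff_true]
    omega

lemma isSumOfPure_iff {r : ℕ} {T : Tensor3 m} : IsSumOfPure r T ↔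
    ∃ f : Fin r → Fin 3 → Fin m → ℂ, T = fun x => ∑ s, ∏ p, f s p (x p) := by
  constructor
  · rintro ⟨a, b, c, rfl⟩
    refine ⟨fun s => ![a s, b s, c s], ?_⟩
    funext x
    simp [pureTensor, Finset.sum_apply, Fin.prod_univ_three]
  · rintro ⟨f, rfl⟩
    refine ⟨fun s => f s 0, fun s => f s 1, fun s => f s 2, ?_⟩
    funext x
    simp [pureTensor, Finset.sum_apply, Fin.prod_univ_three]

lemma prod_update {f : Fin 3 → Fin m → ℂ} (x : Fin 3 → Fin m) (p : Fin 3) (a : Fin m) :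
    ∏ q, f q (Function.update x p a q) = f p a * ∏ q ∈ Finset.univ.erase p, f q (x q) := by
  rw [← Finset.mul_prod_erase _ _ (Finset.mem_univ p), Function.update_self]
  congr 1
  exact Finset.prod_congr rfl fun q hq => by rw [Function.update_of_ne (Finset.ne_of_mem_erase hq)]

/-- A concise sum of `m` decomposable tensors is a unit tensor in suitable bases, so that the
diagonal matrices act compatibly on the three factors. -/
lemma le_finrank_ker_of_isSumOfPure {T : Tensor3 m} (h : IsConcise T) (hT : IsSumOfPure m T) :
    m ≤ finrank ℂ (LinearMap.ker (balanceMap T)) := by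
  obtain ⟨f, rfl⟩ := isSumOfPure_iff.1 hT
  rw [isConcise_iff] at h
  let A : Fin 3 → Matrix (Fin m) (Fin m) ℂ := fun p => Matrix.of fun s i => f s p i
  have hA : ∀ p, IsUnit (A p).det := by
    intro p
    rw [isUnit_iff_ne_zero]
    intro hdet
    obtain ⟨c, hc, h0⟩ := Matrix.exists_mulVec_eq_zero_iff.2 hdet
    refine hc (h p c fun x => ?_)
    simp only [prod_update, Finset.mul_sum]
    rw [Finset.sum_comm]
    refine Finset.sum_eq_zero fun s _ => ?_
    have := congrFun h0 s
    simp only [Matrix.mulVec, dotProduct, A, Matrix.of_apply, Pi.zero_apply] at this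
    calc _ = (∑ i, f s p i * c i) * ∏ q ∈ Finset.univ.erase p, f s q (x q) := by
          rw [Finset.sum_mul]
          exact Finset.sum_congr rfl fun i _ => by ring
      _ = 0 := by rw [this, zero_mul]
  let L : (Fin m → ℂ) →ₗ[ℂ] (Fin 3 → Fin m → Fin m → ℂ) := LinearMap.pi fun p =>
    (Matrix.ofLinearEquiv ℂ).symm.toLinearMap ∘ₗ LinearMap.mulRight ℂ (A p) ∘ₗ
      LinearMap.mulLeft ℂ (A p)⁻¹ ∘ₗ Matrix.diagonalLinearMap _ ℂ ℂ
  have hLA : ∀ d p, A p * Matrix.of (L d p) = Matrix.diagonal d * A p := by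
    intro d p
    change A p * ((A p)⁻¹ * Matrix.diagonal d * A p) = _
    rw [← Matrix.mul_assoc, ← Matrix.mul_assoc, Matrix.mul_nonsing_inv _ (hA p), Matrix.one_mul]
  have hval : ∀ d p (x : Fin 3 → Fin m), ∑ a, L d p a (x p) *
      (∑ s, ∏ q, f s q (Function.update x p a q)) = ∑ s, d s * ∏ q, f s q (x q) := by
    intro d p x
    simp only [prod_update, Finset.mul_sum]
    rw [Finset.sum_comm]
    refine Finset.sum_congr rfl fun s _ => ?_
    have := congrFun (congrFun (hLA d p) s) (x p)
    rw [Matrix.diagonal_mul, Matrix.mul_apply] at this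
    simp only [A, Matrix.of_apply] at this
    rw [← Finset.mul_prod_erase _ _ (Finset.mem_univ p), ← mul_assoc, ← this, Finset.sum_mul]
    exact Finset.sum_congr rfl fun i _ => by ring
  have hker : ∀ d, L d ∈ LinearMap.ker (balanceMap fun x => ∑ s, ∏ q, f s q (x q)) := fun d => by
    rw [mem_ker_balanceMap]
    intro p q x
    rw [hval, hval]
  have hinj : Function.Injective (L.codRestrict _ hker) := by
    rw [LinearMap.injective_codRestrict_iff]
    intro d d' hd
    have := hLA d 0
    rw [hd, hLA d' 0] at this
    have h2 := congrArg (· * (A 0)⁻¹) this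
    simp only [Matrix.mul_assoc, Matrix.mul_nonsing_inv _ (hA 0), Matrix.mul_one] at h2
    exact (Matrix.diagonal_injective h2).symm
  simpa using LinearMap.finrank_le_finrank_of_injective hinj

lemma le_finrank_formAlgebra {T : Tensor3 m} (h : IsConcise T)
    (hT : T ∈ closure {S : Tensor3 m | IsSumOfPure m S}) :
    m ≤ finrank ℂ (formAlgebra (tensorForm T)) := by
  have hker : m ≤ finrank ℂ (LinearMap.ker (balanceMap T)) := by
    have h1 : T ∈ closure ({S : Tensor3 m | IsConcise S} ∩ {S : Tensor3 m | IsSumOfPure m S}) :=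
      isOpen_setOf_isConcise.inter_closure ⟨h, hT⟩
    exact closure_minimal (fun S hS => le_finrank_ker_of_isSumOfPure hS.1 hS.2)
      (isClosed_setOf_le_finrank_ker m) h1
  refine hker.trans ?_
  let L : (Fin 3 → Fin m → Fin m → ℂ) →ₗ[ℂ] (End ℂ (Fin m → ℂ) × End ℂ (Fin m → ℂ) ×
      End ℂ (Fin m → ℂ)) :=
    { toFun := fun X => (Matrix.toLin' (Matrix.of (X 0)), Matrix.toLin' (Matrix.of (X 1)),
        Matrix.toLin' (Matrix.of (X 2)))
      map_add' := fun X Y => by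
        simp only [Prod.mk_add_mk, ← map_add]; rfl
      map_smul' := fun c X => by
        simp only [Prod.smul_mk, ← map_smul, RingHom.id_apply]; rfl }
  have hX : ∀ (X : Matrix (Fin m) (Fin m) ℂ) i, Matrix.toLin' X (Pi.single i 1) = fun a => X a i :=
    fun X i => by ext a; simp
  have hL : ∀ X : LinearMap.ker (balanceMap T), L X ∈ formAlgebra (tensorForm T) := by
    rintro ⟨X, hX'⟩
    rw [mem_ker_balanceMap] at hX'
    have e₂ : tensorForm T ∘ₗ (L X).1 = flipLeft (flipLeft (tensorForm T) ∘ₗ (L X).2.1) := by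
      refine tensorForm_ext fun i j k => ?_
      simpa [L, hX, tensorForm_apply, Pi.single_apply, eq_vec_three (Function.update _ _ _)]
        using hX' 0 1 ![i, j, k]
    have e₃ : tensorForm T ∘ₗ (L X).1 = flipRight (flipLeft (flipLeft (flipRight (tensorForm T)) ∘ₗ
        (L X).2.2)) := by
      refine tensorForm_ext fun i j k => ?_
      simpa [L, hX, tensorForm_apply, Pi.single_apply, eq_vec_three (Function.update _ _ _)]
        using hX' 0 2 ![i, j, k]
    intro x y z
    exact ⟨congrArg (fun F => F x y z) e₂, congrArg (fun F => F x y z) e₃⟩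
  let L' : LinearMap.ker (balanceMap T) →ₗ[ℂ] formAlgebra (tensorForm T) :=
    (L ∘ₗ Submodule.subtype _).codRestrict (Subalgebra.toSubmodule (formAlgebra (tensorForm T))) hL
  refine LinearMap.finrank_le_finrank_of_injective (f := L') ?_
  refine (LinearMap.injective_codRestrict_iff ..).2 ?_
  rintro ⟨X, hX₁⟩ ⟨Y, hY₁⟩ h
  have h' : L X = L Y := h
  simp only [L, LinearMap.coe_mk, AddHom.coe_mk, Prod.mk.injEq, EmbeddingLike.apply_eq_iff_eq] at h'
  refine Subtype.ext (funext fun p => ?_)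
  fin_cases p
  exacts [h'.1, h'.2.1, h'.2.2]

lemma HasMinimalBorderRank.mem_closure [NeZero m] {T : Tensor3 m} (h : HasMinimalBorderRank T) :
    T ∈ closure {S : Tensor3 m | IsSumOfPure m S} := by
  have hne : {r : ℕ | T ∈ closure {S : Tensor3 m | IsSumOfPure r S}}.Nonempty := by
    by_contra hempty
    rw [Set.not_nonempty_iff_eq_empty] at hempty
    rw [HasMinimalBorderRank, borderRank, hempty, Nat.sInf_empty] at h
    exact NeZero.ne m h.symm
  have := Nat.sInf_mem hne
  rwa [← borderRank, h] at this

end Semicontinuity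


/-! ### Orbits -/

section Orbits

variable {m : ℕ}

lemma smul_apply_left (g : Fin 3 → GL (Fin m) ℂ) (T : Tensor3 m) (x : Fin 3 → Fin m) :
    ((⟨g, 1⟩ : TensorGroup m) • T) x =
      ∑ y : Fin 3 → Fin m, (∏ p, (g p : Matrix (Fin m) (Fin m) ℂ) (x p) (y p)) * T y := rfl

lemma smul_apply_right (σ : Equiv.Perm (Fin 3)) (T : Tensor3 m) (x : Fin 3 → Fin m) :
    ((⟨1, σ⟩ : TensorGroup m) • T) x = T (x ∘ σ) := by
  change tensorAct 1 σ T x = T (x ∘ σ)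
  unfold tensorAct
  rw [Finset.sum_eq_single x]
  · simp
  · intro y _ hy
    obtain ⟨p, hp⟩ := Function.ne_iff.mp hy
    rw [Finset.prod_eq_zero (Finset.mem_univ p), zero_mul]
    simp [Ne.symm hp]
  · simp

/-- The value of the trilinear form of `T` at the three covectors `v 0`, `v 1`, `v 2`. -/
def formValue (T : Tensor3 m) (v : Fin 3 → Fin m → ℂ) : ℂ := ∑ y, (∏ p, v p (y p)) * T y

lemma tensorForm_eq_formValue (T : Tensor3 m) (v : Fin 3 → Fin m → ℂ) :
    tensorForm T (v 0) (v 1) (v 2) = formValue T v := by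
  rw [tensorForm_apply, formValue, sum_fin_three_arrow]
  simp [Fin.prod_univ_three]

/-- A tensor which is concise after a permutation of the factors, and whose coefficients are values
of the form of `T`, lies in the orbit of `T`. -/
lemma mem_orbit_of_forall_formValue {T S : Tensor3 m} (σ : Equiv.Perm (Fin 3)) (hS : IsConcise S)
    (u : Fin 3 → Fin m → Fin m → ℂ)
    (h : ∀ x : Fin 3 → Fin m, formValue T (fun p => u p (x p)) = S (x ∘ σ)) :
    S ∈ MulAction.orbit (TensorGroup m) T := by
  have hdet : ∀ p, IsUnit (Matrix.of (u p)).det := by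
    intro p
    rw [isUnit_iff_ne_zero]
    intro h0
    obtain ⟨c, hc, hz⟩ := Matrix.exists_vecMul_eq_zero_iff.2 h0
    refine hc ((isConcise_iff S).1 hS (σ.symm p) c fun x => ?_)
    have hx : ∀ i, S (Function.update x (σ.symm p) i) =
        formValue T fun q => u q (Function.update (x ∘ σ.symm) p i q) := by
      intro i
      rw [h]
      congr 1
      funext q
      by_cases hq : q = σ.symm p
      · subst hq; simp
      · have : σ q ≠ p := fun hh => hq (by rw [← hh, Equiv.symm_apply_apply])
        simp [Function.update_of_ne hq, Function.update_of_ne this]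
    simp only [hx, formValue, Finset.mul_sum]
    rw [Finset.sum_comm]
    refine Finset.sum_eq_zero fun y _ => ?_
    have hprod : ∀ i, ∏ q, u q (Function.update (x ∘ σ.symm) p i q) (y q) =
        u p i (y p) * ∏ q ∈ Finset.univ.erase p, u q ((x ∘ σ.symm) q) (y q) := by
      intro i
      rw [← Finset.mul_prod_erase _ _ (Finset.mem_univ p), Function.update_self]
      congr 1
      exact Finset.prod_congr rfl fun q hq => by
        rw [Function.update_of_ne (Finset.ne_of_mem_erase hq)]
    have hy := congrFun hz (y p)
    simp only [Matrix.vecMul, dotProduct, Matrix.of_apply, Pi.zero_apply] at hy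
    calc _ = (∑ i, c i * u p i (y p)) *
          ((∏ q ∈ Finset.univ.erase p, u q ((x ∘ σ.symm) q) (y q)) * T y) := by
          rw [Finset.sum_mul]
          exact Finset.sum_congr rfl fun i _ => by rw [hprod]; ring
      _ = 0 := by rw [hy, zero_mul]
  let g : Fin 3 → GL (Fin m) ℂ := fun p =>
    Matrix.GeneralLinearGroup.mkOfDetNeZero _ (hdet p).ne_zero
  have hg : (⟨g, 1⟩ : TensorGroup m) • T = (⟨1, σ⟩ : TensorGroup m) • S := by
    funext x
    rw [smul_apply_right, smul_apply_left, ← h]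
    rfl
  exact ⟨(⟨1, σ⟩ : TensorGroup m)⁻¹ * ⟨g, 1⟩, by
    change ((⟨1, σ⟩ : TensorGroup m)⁻¹ * ⟨g, 1⟩) • T = S
    rw [mul_smul, hg, inv_smul_smul]⟩

lemma continuous_smul_tensor (h : TensorGroup m) : Continuous fun T : Tensor3 m => h • T := by
  refine continuous_pi fun x => ?_
  change Continuous fun T : Tensor3 m => ∑ y : Fin 3 → Fin m,
    (∏ p, (h.left p : Matrix (Fin m) (Fin m) ℂ) (x p) (y p)) * T (y ∘ h.right)
  fun_prop

lemma IsSumOfPure.smul {r : ℕ} {T : Tensor3 m} (hT : IsSumOfPure r T) (h : TensorGroup m) :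
    IsSumOfPure r (h • T) := by
  obtain ⟨f, rfl⟩ := isSumOfPure_iff.1 hT
  rw [isSumOfPure_iff]
  refine ⟨fun s p i => ∑ j, (h.left p : Matrix (Fin m) (Fin m) ℂ) i j * f s (h.right.symm p) j, ?_⟩
  funext x
  change ∑ y : Fin 3 → Fin m, (∏ p, (h.left p : Matrix (Fin m) (Fin m) ℂ) (x p) (y p)) *
    (∑ s, ∏ p, f s p ((y ∘ h.right) p)) = _
  simp only [Finset.mul_sum]
  rw [Finset.sum_comm]
  refine Finset.sum_congr rfl fun s _ => ?_
  rw [Finset.prod_univ_sum, Fintype.piFinset_univ]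
  refine Finset.sum_congr rfl fun y _ => ?_
  rw [Finset.prod_mul_distrib]
  congr 1
  rw [← Equiv.prod_comp h.right fun p => f s (h.right.symm p) (y p)]
  simp

lemma mem_closure_isSumOfPure_of_mem_closure_orbit {r : ℕ} {S T : Tensor3 m}
    (hT : T ∈ closure {R : Tensor3 m | IsSumOfPure r R})
    (hS : S ∈ closure (MulAction.orbit (TensorGroup m) T)) :
    S ∈ closure {R : Tensor3 m | IsSumOfPure r R} := by
  refine closure_minimal ?_ isClosed_closure hS
  rintro _ ⟨h, rfl⟩
  exact map_mem_closure (continuous_smul_tensor h) hT fun R hR => IsSumOfPure.smul hR h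

/-- A concise tensor is not a sum of fewer than `m` decomposable tensors. -/
lemma IsConcise.le_of_isSumOfPure {r : ℕ} {T : Tensor3 m} (hT : IsConcise T)
    (h : IsSumOfPure r T) : m ≤ r := by
  obtain ⟨f, rfl⟩ := isSumOfPure_iff.1 h
  by_contra! hlt
  have hker : (LinearMap.ker (Matrix.mulVecLin (Matrix.of fun s i => f s 0 i))) ≠ ⊥ :=
    LinearMap.ker_ne_bot_of_finrank_lt (by simpa using hlt)
  obtain ⟨c, hc, hc0⟩ := Submodule.exists_mem_ne_zero_of_ne_bot hker
  refine hc0 ((isConcise_iff _).1 hT 0 c fun x => ?_)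
  simp only [prod_update, Finset.mul_sum]
  rw [Finset.sum_comm]
  refine Finset.sum_eq_zero fun s _ => ?_
  have := congrFun (LinearMap.mem_ker.1 hc) s
  simp only [Matrix.mulVecLin_apply, Matrix.mulVec, dotProduct, Matrix.of_apply,
    Pi.zero_apply] at this
  calc _ = (∑ i, f s 0 i * c i) * ∏ q ∈ Finset.univ.erase 0, f s q (x q) := by
        rw [Finset.sum_mul]
        exact Finset.sum_congr rfl fun i _ => by ring
    _ = 0 := by rw [this, zero_mul]

lemma IsConcise.hasMinimalBorderRank {T : Tensor3 m} (hT : IsConcise T)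
    (h : T ∈ closure {S : Tensor3 m | IsSumOfPure m S}) : HasMinimalBorderRank T := by
  refine le_antisymm (Nat.sInf_le h) ?_
  have hmem := Nat.sInf_mem (s := {r : ℕ | T ∈ closure {S : Tensor3 m | IsSumOfPure r S}}) ⟨m, h⟩
  have h1 : T ∈ closure ({S : Tensor3 m | IsConcise S} ∩
      {S : Tensor3 m | IsSumOfPure (borderRank T) S}) :=
    isOpen_setOf_isConcise.inter_closure ⟨hT, hmem⟩
  obtain ⟨S, hS⟩ := closure_nonempty_iff.1 ⟨T, h1⟩
  exact hS.1.le_of_isSumOfPure hS.2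

/-- Every concise `1`-degenerate tensor of minimal border rank is equivalent to one of the five. -/
theorem exists_mem_orbit_fiveTensors (h5 : ∀ n, IsConcise (fiveTensors n)) {T : Tensor3 5}
    (hT : IsConcise T) (hd : IsOneDegenerate T) (hb : HasMinimalBorderRank T) :
    ∃ n, T ∈ MulAction.orbit (TensorGroup 5) (fiveTensors n) := by
  obtain ⟨nd₁, nd₂, nd₃⟩ := hT.tensorForm_nondegenerate
  obtain ⟨g₁, g₂, g₃⟩ := hd.exists_tensorForm_eq_zero
  obtain ⟨V₁, V₂, V₃, τ, h⟩ := exists_isQuotientPlaneForm (tensorForm T) (by simp) (by simp)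
    (by simp) nd₁ nd₂ nd₃ g₁ g₂ g₃ (le_finrank_formAlgebra hT hb.mem_closure)
  obtain ⟨n, σ, u, v, w, hx⟩ := h.hasFiveTensorValues
  refine ⟨n, ?_⟩
  rw [MulAction.mem_orbit_symm]
  refine mem_orbit_of_forall_formValue σ (h5 n) ![u, v, w] fun x => ?_
  rw [← hx, ← tensorForm_eq_formValue]
  rfl

end Orbits


/-! ### Ranks of slices -/

section SliceRank

variable {m : ℕ}

lemma formValue_smul (h : TensorGroup m) (T : Tensor3 m) (v : Fin 3 → Fin m → ℂ) :
    formValue (h • T) v = formValue T fun q =>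
      (h.left (h.right q) : Matrix (Fin m) (Fin m) ℂ).vecMulLinear (v (h.right q)) := by
  change ∑ x : Fin 3 → Fin m, (∏ p, v p (x p)) * (∑ y : Fin 3 → Fin m,
    (∏ p, (h.left p : Matrix (Fin m) (Fin m) ℂ) (x p) (y p)) * T (y ∘ h.right)) = _
  simp only [formValue, Finset.mul_sum, Matrix.vecMulLinear_apply, Matrix.vecMul, dotProduct]
  rw [Finset.sum_comm]
  refine Fintype.sum_equiv (Equiv.arrowCongr h.right.symm (Equiv.refl _)) _ _ fun y => ?_
  have h1 : (Equiv.arrowCongr h.right.symm (Equiv.refl (Fin m))) y = y ∘ h.right := rfl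
  rw [h1]
  change _ = (∏ p, (fun q => ∑ i, v q i * (h.left q : Matrix (Fin m) (Fin m) ℂ) i (y q))
    (h.right p)) * T (y ∘ h.right)
  rw [Equiv.prod_comp h.right fun q =>
    ∑ i, v q i * (h.left q : Matrix (Fin m) (Fin m) ℂ) i (y q),
    Finset.prod_univ_sum, Fintype.piFinset_univ, Finset.sum_mul]
  refine Finset.sum_congr rfl fun x _ => ?_
  rw [Finset.prod_mul_distrib, mul_assoc]

/-- The contraction of the factor `p` of `T` with `c` has rank at most `r`. The condition says that
the bilinear form `formValue T`, with the argument `p` fixed to be `c`, vanishes as soon as one of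
the two other arguments satisfies certain `r` linear equations. -/
def IsSliceRankLE (T : Tensor3 m) (p : Fin 3) (r : ℕ) (c : Fin m → ℂ) : Prop :=
  ∃ q ≠ p, ∃ L : (Fin m → ℂ) →ₗ[ℂ] (Fin r → ℂ), ∀ v : Fin 3 → Fin m → ℂ,
    v p = c → L (v q) = 0 → formValue T v = 0

/-- The action of `h` on covectors of the factor `p`. -/
noncomputable def covectorEquiv (h : TensorGroup m) (p : Fin 3) :
    (Fin m → ℂ) ≃ₗ[ℂ] (Fin m → ℂ) :=
  LinearEquiv.ofBijective (h.left p : Matrix (Fin m) (Fin m) ℂ).vecMulLinear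
    ⟨Matrix.vecMul_injective_of_isUnit (h.left p).isUnit,
      LinearMap.surjective_of_injective (Matrix.vecMul_injective_of_isUnit (h.left p).isUnit)⟩

lemma IsSliceRankLE.smul {T : Tensor3 m} {p : Fin 3} {r : ℕ} {c : Fin m → ℂ} (h : TensorGroup m)
    (hc : IsSliceRankLE T p r (covectorEquiv h (h.right p) c)) :
    IsSliceRankLE (h • T) (h.right p) r c := by
  obtain ⟨q, hq, L, hL⟩ := hc
  refine ⟨h.right q, fun e => hq (h.right.injective e),
    L ∘ₗ (covectorEquiv h (h.right q)).toLinearMap, fun v hv hv' => ?_⟩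
  rw [formValue_smul]
  exact hL _ (by rw [← hv]; rfl) hv'

/-- The contraction of the factor `p` with a covector, as a matrix. -/
def sliceMatrix (T : Tensor3 m) : Fin 3 → (Fin m → ℂ) → Matrix (Fin m) (Fin m) ℂ :=
  ![contractA T, contractB T, contractC T]

/-- The factor which indexes the columns of `sliceMatrix T p`. -/
def columnFactor : Fin 3 → Fin 3 := ![1, 0, 0]

/-- The factor which indexes the rows of `sliceMatrix T p`. -/
def rowFactor : Fin 3 → Fin 3 := ![2, 2, 1]

lemma formValue_eq_sliceMatrix (T : Tensor3 m) (v : Fin 3 → Fin m → ℂ) (p : Fin 3) :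
    formValue T v = v (rowFactor p) ⬝ᵥ (sliceMatrix T p (v p)).mulVec (v (columnFactor p)) := by
  rw [formValue, sum_fin_three_arrow]
  fin_cases p
  · simp only [rowFactor, sliceMatrix, columnFactor, Fin.prod_univ_three, dotProduct,
      Matrix.mulVec, contractA, Finset.mul_sum]
    simp only [Fin.zero_eta, Matrix.cons_val, LinearMap.coe_mk, AddHom.coe_mk, Matrix.of_apply,
      Finset.mul_sum, Finset.sum_mul]
    rw [Finset.sum_comm_cycle]
    refine Finset.sum_congr rfl fun k _ => ?_
    rw [Finset.sum_comm]
    exact Finset.sum_congr rfl fun j _ => Finset.sum_congr rfl fun i _ => by ring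
  · simp only [rowFactor, sliceMatrix, columnFactor, Fin.prod_univ_three, dotProduct,
      Matrix.mulVec, contractB, Finset.mul_sum]
    simp only [Fin.mk_one, Matrix.cons_val, LinearMap.coe_mk, AddHom.coe_mk, Matrix.of_apply,
      Finset.mul_sum, Finset.sum_mul]
    rw [Finset.sum_comm_cycle]
    exact Finset.sum_congr rfl fun k _ => Finset.sum_congr rfl fun j _ =>
      Finset.sum_congr rfl fun i _ => by ring
  · simp only [rowFactor, sliceMatrix, columnFactor, Fin.prod_univ_three, dotProduct,
      Matrix.mulVec, contractC, Finset.mul_sum]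
    simp only [Fin.reduceFinMk, Matrix.cons_val, LinearMap.coe_mk, AddHom.coe_mk, Matrix.of_apply,
      Finset.mul_sum, Finset.sum_mul]
    rw [Finset.sum_comm]
    exact Finset.sum_congr rfl fun k _ => Finset.sum_congr rfl fun j _ =>
      Finset.sum_congr rfl fun i _ => by ring

lemma isSliceRankLE_iff {T : Tensor3 m} {p : Fin 3} {r : ℕ} {c : Fin m → ℂ} :
    IsSliceRankLE T p r c ↔ ∃ L : (Fin m → ℂ) →ₗ[ℂ] (Fin r → ℂ),
      (∀ y, L y = 0 → (sliceMatrix T p c).mulVec y = 0) ∨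
        ∀ y, L y = 0 → (sliceMatrix T p c).vecMul y = 0 := by
  have hq : ∀ q, q ≠ p ↔ q = columnFactor p ∨ q = rowFactor p := by revert p; decide
  have h12 : columnFactor p ≠ rowFactor p := by revert p; decide
  have h1 := (hq (columnFactor p)).2 (.inl rfl)
  have h2 := (hq (rowFactor p)).2 (.inr rfl)
  have hv : ∀ y z : Fin m → ℂ, ∃ v : Fin 3 → Fin m → ℂ, v p = c ∧ v (columnFactor p) = y ∧
      v (rowFactor p) = z := fun y z =>
    ⟨Function.update (Function.update (fun _ => c) (columnFactor p) y) (rowFactor p) z,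
      by rw [Function.update_of_ne h2.symm, Function.update_of_ne h1.symm],
      by rw [Function.update_of_ne h12, Function.update_self], by rw [Function.update_self]⟩
  constructor
  · rintro ⟨q, hqp, L, hL⟩
    refine ⟨L, ?_⟩
    rcases (hq q).1 hqp with rfl | rfl
    · refine Or.inl fun y hy => dotProduct_eq_zero _ fun z => ?_
      obtain ⟨v, rfl, rfl, rfl⟩ := hv y z
      rw [dotProduct_comm, ← formValue_eq_sliceMatrix]
      exact hL v rfl hy
    · refine Or.inr fun y hy => dotProduct_eq_zero _ fun z => ?_
      obtain ⟨v, rfl, rfl, rfl⟩ := hv z y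
      rw [← Matrix.dotProduct_mulVec, ← formValue_eq_sliceMatrix]
      exact hL v rfl hy
  · rintro ⟨L, hL | hL⟩
    · refine ⟨columnFactor p, h1, L, fun v hv hv' => ?_⟩
      rw [formValue_eq_sliceMatrix T v p, hv, hL _ hv', dotProduct_zero]
    · refine ⟨rowFactor p, h2, L, fun v hv hv' => ?_⟩
      rw [formValue_eq_sliceMatrix T v p, hv, Matrix.dotProduct_mulVec, hL _ hv', zero_dotProduct]

lemma IsSliceRankLE.det_submatrix {T : Tensor3 m} {p : Fin 3} {r : ℕ} {c : Fin m → ℂ}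
    (h : IsSliceRankLE T p r c) (f g : Fin (r + 1) → Fin m) :
    ((sliceMatrix T p c).submatrix f g).det = 0 := by
  have hker : ∀ (L : (Fin m → ℂ) →ₗ[ℂ] (Fin r → ℂ)) (f : Fin (r + 1) → Fin m),
      ∃ w : Fin (r + 1) → ℂ, w ≠ 0 ∧ L (∑ a, w a • Pi.single (f a) 1) = 0 := by
    intro L f
    have := LinearMap.ker_ne_bot_of_finrank_lt (f := L ∘ₗ
      Fintype.linearCombination ℂ fun a => (Pi.single (f a) 1 : Fin m → ℂ)) (by simp)
    obtain ⟨w, hw, hw0⟩ := Submodule.exists_mem_ne_zero_of_ne_bot this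
    exact ⟨w, hw0, hw⟩
  obtain ⟨L, hL | hL⟩ := isSliceRankLE_iff.1 h
  · obtain ⟨w, hw, h0⟩ := hker L g
    refine Matrix.exists_mulVec_eq_zero_iff.1 ⟨w, hw, funext fun a => ?_⟩
    have := congrFun (hL _ h0) (f a)
    rw [← Matrix.mulVecLin_apply, map_sum] at this
    simpa [Matrix.mulVec, dotProduct, Finset.sum_apply, mul_comm] using this
  · obtain ⟨w, hw, h0⟩ := hker L f
    refine Matrix.exists_vecMul_eq_zero_iff.1 ⟨w, hw, funext fun a => ?_⟩
    have := congrFun (hL _ h0) (g a)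
    rw [← Matrix.vecMulLinear_apply, map_sum] at this
    simpa [Matrix.vecMul, dotProduct, Finset.sum_apply, mul_comm] using this

lemma IsSliceRankLE.minor_two {T : Tensor3 m} {p : Fin 3} {c : Fin m → ℂ}
    (h : IsSliceRankLE T p 1 c) (a a' b b' : Fin m) :
    sliceMatrix T p c a b * sliceMatrix T p c a' b' -
      sliceMatrix T p c a b' * sliceMatrix T p c a' b = 0 :=
  (Matrix.det_fin_two _).symm.trans (h.det_submatrix ![a, a'] ![b, b'])

lemma IsSliceRankLE.prod_eq_zero_of_triangular {T : Tensor3 m} {p : Fin 3} {r : ℕ} {c : Fin m → ℂ}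
    (h : IsSliceRankLE T p r c) (f g : Fin (r + 1) → Fin m)
    (hz : ∀ i j, j < i → sliceMatrix T p c (f i) (g j) = 0) :
    ∏ i, sliceMatrix T p c (f i) (g i) = 0 :=
  (Matrix.det_of_isUpperTriangular (M := (sliceMatrix T p c).submatrix f g) fun i j hij =>
    hz i j hij).symm.trans (h.det_submatrix f g)

lemma isSliceRankLE_of_eq_sum {T : Tensor3 m} {p : Fin 3} {r : ℕ} {c : Fin m → ℂ}
    (u w : Fin r → Fin m → ℂ) (h : ∀ a b, sliceMatrix T p c a b = ∑ s, u s a * w s b) :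
    IsSliceRankLE T p r c := by
  refine isSliceRankLE_iff.2 ⟨(Matrix.of w).mulVecLin, Or.inl fun y hy => ?_⟩
  have h : sliceMatrix T p c = ∑ s, Matrix.vecMulVec (u s) (w s) := by
    ext a b
    rw [h, Matrix.sum_apply]
    rfl
  rw [h, Matrix.sum_mulVec]
  refine Finset.sum_eq_zero fun s _ => ?_
  have hs : w s ⬝ᵥ y = 0 := congrFun hy s
  rw [Matrix.vecMulVec_mulVec, hs]
  simp

/-- The covectors of the factor `p` whose contraction has rank at most one contain a plane. -/
def HasSlicePlane (T : Tensor3 m) (p : Fin 3) : Prop :=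
  ∃ x y : Fin m → ℂ, LinearIndependent ℂ ![x, y] ∧ ∀ s t : ℂ, IsSliceRankLE T p 1 (s • x + t • y)

/-- The covectors of the factor `p` whose contraction has rank at most `r` contain the hyperplane
`l = 0` (or the whole space, if `l` is zero). -/
def IsSliceHyperplane (T : Tensor3 m) (p : Fin 3) (r : ℕ) (l : (Fin m → ℂ) →ₗ[ℂ] ℂ) : Prop :=
  ∀ c, l c = 0 → IsSliceRankLE T p r c

/-- The covectors of the factor `p` whose contraction has rank at most `r` contain two
different hyperplanes. -/
def HasTwoSliceHyperplanes (T : Tensor3 m) (p : Fin 3) (r : ℕ) : Prop :=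
  ∃ l l', IsSliceHyperplane T p r l ∧ IsSliceHyperplane T p r l' ∧ ∃ c, l c = 0 ∧ l' c ≠ 0

lemma HasSlicePlane.smul {T : Tensor3 m} {p : Fin 3} (h : TensorGroup m) (hT : HasSlicePlane T p) :
    HasSlicePlane (h • T) (h.right p) := by
  obtain ⟨x, y, hxy, hr⟩ := hT
  let e := covectorEquiv h (h.right p)
  refine ⟨e.symm x, e.symm y, ?_, fun s t => IsSliceRankLE.smul h ?_⟩
  · have hcomp : ![e.symm x, e.symm y] = e.symm.toLinearMap ∘ ![x, y] := by
      ext i; fin_cases i <;> rfl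
    rw [hcomp]
    exact hxy.map' _ (LinearEquiv.ker _)
  · rw [← map_smul, ← map_smul, ← map_add]
    change IsSliceRankLE T p 1 (e (e.symm _))
    rw [LinearEquiv.apply_symm_apply]
    exact hr s t

lemma IsSliceHyperplane.smul {T : Tensor3 m} {p : Fin 3} {r : ℕ} {l : (Fin m → ℂ) →ₗ[ℂ] ℂ}
    (h : TensorGroup m) (hT : IsSliceHyperplane T p r l) :
    IsSliceHyperplane (h • T) (h.right p) r (l ∘ₗ (covectorEquiv h (h.right p)).toLinearMap) :=
  fun _ hc => IsSliceRankLE.smul h (hT _ hc)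

lemma HasTwoSliceHyperplanes.smul {T : Tensor3 m} {p : Fin 3} {r : ℕ} (h : TensorGroup m)
    (hT : HasTwoSliceHyperplanes T p r) : HasTwoSliceHyperplanes (h • T) (h.right p) r := by
  obtain ⟨l, l', hl, hl', c, hc, hc'⟩ := hT
  exact ⟨_, _, hl.smul h, hl'.smul h, (covectorEquiv h (h.right p)).symm c, by simpa, by simpa⟩

lemma IsSliceHyperplane.false_of_coordinates {T : Tensor3 m} {p : Fin 3} {r : ℕ}
    {l : (Fin m → ℂ) →ₗ[ℂ] ℂ} (hl : IsSliceHyperplane T p r l) {i j : Fin m} (hij : i ≠ j)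
    (h : ∀ c, IsSliceRankLE T p r c → c i = 0 ∧ c j = 0) : False := by
  have hi : l (Pi.single i 1) ≠ 0 := fun h0 => by simpa using (h _ (hl _ h0)).1
  refine hi ?_
  have := (h _ (hl (l (Pi.single i 1) • Pi.single j 1 - l (Pi.single j 1) • Pi.single i 1)
    (by simp only [map_sub, map_smul, smul_eq_mul]; ring))).2
  simpa [hij] using this

lemma not_hasTwoSliceHyperplanes {T : Tensor3 m} {p : Fin 3} {r : ℕ} (i : Fin m)
    (h : ∀ c, IsSliceRankLE T p r c → c i = 0) : ¬ HasTwoSliceHyperplanes T p r := by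
  rintro ⟨l, l', hl, hl', c, hc, hc'⟩
  have hi : l' (Pi.single i 1) ≠ 0 := fun h0 => by simpa using h _ (hl' _ h0)
  have h1 := h _ (hl' (c - (l' c / l' (Pi.single i 1)) • Pi.single i 1)
    (by simp only [map_sub, map_smul, smul_eq_mul]; field_simp; simp))
  simp [h _ (hl _ hc), hi, hc'] at h1

/-- If the covectors whose contraction has rank at most one lie on the cone over a smooth conic,
then they contain no plane. -/
lemma not_hasSlicePlane {T : Tensor3 m} {p : Fin 3} (i j k : Fin m) {e : ℂ} (he : e ≠ 0)
    (h : ∀ c, IsSliceRankLE T p 1 c →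
      (∀ a, a = i ∨ a = j ∨ a = k ∨ c a = 0) ∧ c i ^ 2 + e * (c j * c k) = 0) :
    ¬ HasSlicePlane T p := by
  rintro ⟨x, y, hxy, hr⟩
  have hx := h x (by simpa using hr 1 0)
  have hy := h y (by simpa using hr 0 1)
  have hs := (h (x + y) (by simpa using hr 1 1)).2
  simp only [Pi.add_apply] at hs
  have hm : 2 * (x i * y i) + e * (x j * y k + x k * y j) = 0 := by
    linear_combination hs - hx.2 - hy.2
  have hjk : x j * y k - x k * y j = 0 := by
    refine (mul_eq_zero.1 ?_).resolve_left he
    refine pow_eq_zero_iff two_ne_zero |>.1 ?_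
    linear_combination (e * (x j * y k + x k * y j) - 2 * (x i * y i)) * hm -
      4 * e * (y j * y k) * hx.2 + 4 * x i ^ 2 * hy.2
  have hij : x i * y j - x j * y i = 0 := by
    refine pow_eq_zero_iff two_ne_zero |>.1 ?_
    linear_combination y j ^ 2 * hx.2 + x j ^ 2 * hy.2 - x j * y j * hm
  have hik : x i * y k - x k * y i = 0 := by
    refine pow_eq_zero_iff two_ne_zero |>.1 ?_
    linear_combination y k ^ 2 * hx.2 + x k ^ 2 * hy.2 - x k * y k * hm
  have hx0 : ∀ a, ¬(a = i ∨ a = j ∨ a = k) → x a = 0 := fun a ha => by have := hx.1 a; tauto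
  have hy0 : ∀ a, ¬(a = i ∨ a = j ∨ a = k) → y a = 0 := fun a ha => by have := hy.1 a; tauto
  have hall : ∀ a b, x a * y b - x b * y a = 0 := by
    intro a b
    by_cases ha : a = i ∨ a = j ∨ a = k
    · by_cases hb : b = i ∨ b = j ∨ b = k
      · rcases ha with rfl | rfl | rfl <;> rcases hb with rfl | rfl | rfl <;>
          first | ring1 | linear_combination hij | linear_combination hik |
            linear_combination hjk | linear_combination -hij | linear_combination -hik |
            linear_combination -hjk
      · rw [hx0 b hb, hy0 b hb]; ring
    · rw [hx0 a ha, hy0 a ha]; ring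
  rw [LinearIndependent.pair_iff] at hxy
  obtain ⟨a, ha⟩ : ∃ a, x a ≠ 0 := by
    by_contra! h0
    have := hxy 1 0 (by ext a; simp [h0])
    simp at this
  refine ha (neg_eq_zero.1 (hxy (y a) (-x a) ?_).2)
  ext b
  simp only [Pi.add_apply, Pi.smul_apply, smul_eq_mul, Pi.zero_apply]
  linear_combination -(hall a b)

end SliceRank


/-! ### Conciseness, degeneracy and border rank of the five tensors -/

section FiveTensors

open Filter Topology

open IsQuotientPlaneForm in
lemma isConcise_fiveTensors (n : Fin 5) : IsConcise (fiveTensors n) := by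
  have hA : ∀ n i, ∃ j k, ∀ i', coeffs n i' j k ≠ 0 ↔ i' = i := by decide
  have hB : ∀ n j, ∃ i k, ∀ j', coeffs n i j' k ≠ 0 ↔ j' = j := by decide
  have hC : ∀ n k, ∃ i j, ∀ k', coeffs n i j k' ≠ 0 ↔ k' = k := by decide
  have key : ∀ (z : Fin 5 → ℤ) (c : Fin 5 → ℂ) (a : Fin 5), (∀ b, z b ≠ 0 ↔ b = a) →
      ∑ b, c b * (z b : ℂ) = 0 → c a = 0 := by
    intro z c a hz hs
    rw [Finset.sum_eq_single a (fun b _ hb => by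
      rw [not_not.1 (mt (hz b).1 hb), Int.cast_zero, mul_zero]) (by simp)] at hs
    exact (mul_eq_zero.1 hs).resolve_right (Int.cast_ne_zero.2 ((hz a).2 rfl))
  rw [isConcise_iff]
  intro p c h
  ext a
  fin_cases p
  · obtain ⟨j, k, hjk⟩ := hA n a
    refine key _ c a hjk ?_
    rw [← h ![a, j, k]]
    exact Finset.sum_congr rfl fun b _ => by
      rw [← fiveTensors_apply, eq_vec_three (Function.update _ _ _)]; simp
  · obtain ⟨i, k, hik⟩ := hB n a
    refine key _ c a hik ?_
    rw [← h ![i, a, k]]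
    exact Finset.sum_congr rfl fun b _ => by
      rw [← fiveTensors_apply, eq_vec_three (Function.update _ _ _)]; simp
  · obtain ⟨i, j, hij⟩ := hC n a
    refine key _ c a hij ?_
    rw [← h ![i, j, a]]
    exact Finset.sum_congr rfl fun b _ => by
      rw [← fiveTensors_apply, eq_vec_three (Function.update _ _ _)]; simp

open IsQuotientPlaneForm in
/-- A matrix with a zero block of size three is singular. -/
lemma rank_ne_of_zero_block {M : Matrix (Fin 5) (Fin 5) ℂ} (p q : Fin 3)
    (h : ∀ l l', M (spaceIndex p l) (spaceIndex q l') = 0) : M.rank ≠ 5 := by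
  intro hr
  let L : (Fin 3 → ℂ) →ₗ[ℂ] (Fin 5 → ℂ) :=
    Fintype.linearCombination ℂ fun l => Pi.single (spaceIndex q l) 1
  have hL : ∀ w l, L w (spaceIndex q l) = w l := by
    intro w l
    have hinj : ∀ q l l', spaceIndex q l = spaceIndex q l' ↔ l = l' := by decide
    simp [L, Fintype.linearCombination_apply, Pi.single_apply, hinj]
  obtain ⟨w, hw, hw0⟩ := Submodule.exists_mem_ne_zero_of_ne_bot
    (LinearMap.ker_ne_bot_of_finrank_lt (f := LinearMap.funLeft ℂ ℂ (planeIndex p) ∘ₗ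
      M.mulVecLin ∘ₗ L) (by simp))
  have hker : M.mulVecLin (L w) = 0 := by
    ext a
    obtain ⟨b, rfl⟩ | ⟨l, rfl⟩ := exists_index p a
    · exact congrFun hw b
    · simp [L, Fintype.linearCombination_apply, h]
  refine hw0 (funext fun l => ?_)
  rw [← hL w l]
  have hinj : Function.Injective M.mulVecLin := by
    rw [← LinearMap.ker_eq_bot, ← Submodule.finrank_eq_zero]
    have := LinearMap.finrank_range_add_finrank_ker M.mulVecLin
    rw [show Module.finrank ℂ (LinearMap.range M.mulVecLin) = 5 from hr] at this
    simpa using this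
  rw [(map_eq_zero_iff _ hinj).1 hker]
  rfl

open IsQuotientPlaneForm in
lemma isOneDegenerate_fiveTensors (n : Fin 5) : IsOneDegenerate (fiveTensors n) := by
  obtain ⟨h1, h2, h3⟩ := coeffs_spaceIndex n
  rintro (⟨c, hc⟩ | ⟨c, hc⟩ | ⟨c, hc⟩)
  · refine rank_ne_of_zero_block 2 1 (fun l l' => ?_) hc
    simp [contractA, fiveTensors_apply, h3]
  · refine rank_ne_of_zero_block 2 0 (fun l l' => ?_) hc
    simp [contractB, fiveTensors_apply, h2]
  · refine rank_ne_of_zero_block 1 0 (fun l l' => ?_) hc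
    simp [contractC, fiveTensors_apply, h1]

/-- Tangent vectors at five points whose combination vanishes: if `∑ d s • x s = 0`, then
`∑ d s • ẋ s` is the limit of the sums `ε⁻¹ • ∑ d s • x s (ε)` of five decomposable tensors. -/
lemma tensorO58_mem_closure : tensorO58 ∈ closure {S : Tensor3 5 | IsSumOfPure 5 S} := by
  -- Five points `θ` of the affine line, the weights of the divided difference at these points
  -- (times 24), the corresponding points of a twisted cubic in the product of the three planes,
  -- and tangent directions at these points.
  let θ : Fin 5 → ℤ := ![0, 1, -1, 2, -2]
  let d : Fin 5 → ℤ := ![6, -4, -4, 1, 1]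
  let f : Fin 3 → Fin 5 → Fin 5 → ℤ := ![fun s => ![-1, 0, 0, 0, θ s],
    fun s => ![0, 0, 1, θ s, 0], fun s => ![θ s, -1, 0, 0, 0]]
  let g : Fin 3 → Fin 5 → Fin 5 → ℤ := ![fun s => ![0, θ s ^ 3, θ s ^ 2, 5 * θ s ^ 2 - θ s ^ 4, 0],
    fun s => ![-θ s ^ 3, θ s ^ 4 - 5 * θ s ^ 2, 0, 0, θ s ^ 2],
    fun s => ![0, 0, 5 * θ s ^ 2 - θ s ^ 4, -θ s ^ 3, θ s ^ 2]]
  have h0 : ∀ i j k, ∑ s, d s * (f 0 s i * f 1 s j * f 2 s k) = 0 := by decide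
  have h1 : ∀ i j k, ∑ s, d s * (g 0 s i * f 1 s j * f 2 s k + f 0 s i * g 1 s j * f 2 s k +
      f 0 s i * f 1 s j * g 2 s k) = 24 * coeffs 0 i j k := by decide
  let F : ℂ → Tensor3 5 := fun ε x => fiveTensors 0 x +
    ε * ((∑ s, d s * (g 0 s (x 0) * g 1 s (x 1) * f 2 s (x 2) +
      g 0 s (x 0) * f 1 s (x 1) * g 2 s (x 2) + f 0 s (x 0) * g 1 s (x 1) * g 2 s (x 2)) : ℤ) / 24)
    + ε ^ 2 * ((∑ s, d s * (g 0 s (x 0) * g 1 s (x 1) * g 2 s (x 2)) : ℤ) / 24)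
  have hF : Tendsto F (𝓝[≠] 0) (𝓝 tensorO58) := by
    have hc : Continuous F := continuous_pi fun x => by fun_prop
    have : F 0 = tensorO58 := by
      funext x
      simp [F]
      rfl
    rw [← this]
    exact (hc.tendsto 0).mono_left nhdsWithin_le_nhds
  refine mem_closure_of_tendsto hF ?_
  filter_upwards [self_mem_nhdsWithin] with ε hε
  have hε : ε ≠ 0 := hε
  refine ⟨fun s i => d s / (24 * ε) * (f 0 s i + ε * g 0 s i), fun s i => f 1 s i + ε * g 1 s i,
    fun s i => f 2 s i + ε * g 2 s i, ?_⟩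
  funext x
  have e0 := congrArg (Int.cast : ℤ → ℂ) (h0 (x 0) (x 1) (x 2))
  have e1 := congrArg (Int.cast : ℤ → ℂ) (h1 (x 0) (x 1) (x 2))
  have e2 : fiveTensors 0 x = coeffs 0 (x 0) (x 1) (x 2) := by
    rw [← fiveTensors_apply, ← eq_vec_three]
  clear_value θ d f g
  simp only [F, e2, Finset.sum_apply, pureTensor]
  have e3 : ∀ s, (d s : ℂ) / (24 * ε) * (f 0 s (x 0) + ε * g 0 s (x 0)) *
      (f 1 s (x 1) + ε * g 1 s (x 1)) * (f 2 s (x 2) + ε * g 2 s (x 2)) = (24 * ε)⁻¹ * (d s *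
      ((f 0 s (x 0) + ε * g 0 s (x 0)) * (f 1 s (x 1) + ε * g 1 s (x 1)) *
      (f 2 s (x 2) + ε * g 2 s (x 2)))) := fun s => by ring
  rw [Finset.sum_congr rfl fun s _ => e3 s, ← Finset.mul_sum,
    eq_inv_mul_iff_mul_eq₀ (mul_ne_zero (by norm_num) hε)]
  push_cast at e0 e1 ⊢
  simp only [Fin.sum_univ_five] at e0 e1 ⊢
  linear_combination -ε * e1 - e0

lemma basisTensor_eq (i j k : Fin 5) (x : Fin 3 → Fin 5) :
    basisTensor i j k x = (Pi.single i 1 : Fin 5 → ℂ) (x 0) * (Pi.single j 1 : Fin 5 → ℂ) (x 1) *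
      (Pi.single k 1 : Fin 5 → ℂ) (x 2) := rfl

lemma formValue_add (S T : Tensor3 5) (v : Fin 3 → Fin 5 → ℂ) :
    formValue (S + T) v = formValue S v + formValue T v := by
  simp [formValue, mul_add, Finset.sum_add_distrib]

lemma formValue_sub (S T : Tensor3 5) (v : Fin 3 → Fin 5 → ℂ) :
    formValue (S - T) v = formValue S v - formValue T v := by
  simp [formValue, mul_sub]

lemma formValue_basisTensor (i j k : Fin 5) (v : Fin 3 → Fin 5 → ℂ) :
    formValue (basisTensor i j k) v = v 0 i * v 1 j * v 2 k := by
  rw [formValue, Finset.sum_eq_single ![i, j, k]]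
  · simp [basisTensor_eq, Fin.prod_univ_three]
  · intro y _ hy
    rw [basisTensor_eq]
    by_contra hne
    apply hy
    simp only [mul_eq_zero, not_or, Pi.single_apply, ite_eq_right_iff, one_ne_zero,
      imp_false, not_not] at hne
    rw [eq_vec_three y, hne.2.1.1, hne.2.1.2, hne.2.2]
  · simp

/-- A concise limit of tensors `F ε`, each of them obtained from `T` by a linear map on each factor
and a permutation of the factors, lies in the closure of the orbit of `T`: the linear maps are
automatically invertible, because conciseness is an open condition. -/
lemma mem_closure_orbit {S T : Tensor3 5} (hS : IsConcise S) (σ : Equiv.Perm (Fin 3))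
    (F : ℂ → Tensor3 5) (hF : Continuous F) (h0 : F 0 = S)
    (u : ℂ → Fin 3 → Fin 5 → Fin 5 → ℂ)
    (h : ∀ ε ≠ 0, ∀ x : Fin 3 → Fin 5, formValue T (fun p => u ε p (x p)) = F ε (x ∘ σ)) :
    S ∈ closure (MulAction.orbit (TensorGroup 5) T) := by
  have hlim : Tendsto F (𝓝[≠] 0) (𝓝 S) := h0 ▸ (hF.tendsto 0).mono_left nhdsWithin_le_nhds
  refine mem_closure_of_tendsto hlim ?_
  filter_upwards [self_mem_nhdsWithin, hlim.eventually (isOpen_setOf_isConcise.mem_nhds hS)]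
    with ε hε hc
  exact mem_orbit_of_forall_formValue σ hc (u ε) (h ε hε)

/-- Scaling `a₅`, `b₅`, `c₅` by `ε`, `ε⁻¹`, `ε⁻¹` fixes `tensorM2` and multiplies the remaining
terms by `ε`. -/
lemma tensorO57_mem_closure_orbit :
    tensorO57 ∈ closure (MulAction.orbit (TensorGroup 5) tensorO58) := by
  let e : Fin 5 → Fin 5 → ℂ := fun i => Pi.single i 1
  refine mem_closure_orbit (isConcise_fiveTensors 1) 1
    (fun ε => tensorM2 + ε • (basisTensor 4 0 1 - basisTensor 4 2 3)) (by fun_prop)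
    (by simp; rfl)
    (fun ε => ![fun r => ![e 0 r, e 1 r, e 2 r, e 3 r, ε * e 4 r],
      fun r => ![e 0 r, e 1 r, e 2 r, e 3 r, ε⁻¹ * e 4 r],
      fun r => ![e 0 r, e 1 r, e 2 r, e 3 r, ε⁻¹ * e 4 r]]) fun ε hε x => ?_
  simp [tensorO58, tensorM2, formValue_add, formValue_sub, formValue_basisTensor, basisTensor_eq, e]
  field_simp

/-- Scaling `a₅`, `b₅`, `c₅` by `ε`, `ε⁻¹`, `ε⁻¹` fixes `tensorM1` and multiplies the remaining term
by `ε`. -/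
lemma tensorO54_mem_closure_orbit :
    tensorO54 ∈ closure (MulAction.orbit (TensorGroup 5) tensorO55) := by
  let e : Fin 5 → Fin 5 → ℂ := fun i => Pi.single i 1
  refine mem_closure_orbit (isConcise_fiveTensors 4) 1
    (fun ε => tensorM1 + ε • basisTensor 4 2 1) (by fun_prop) (by simp; rfl)
    (fun ε => ![fun r => ![e 0 r, e 1 r, e 2 r, e 3 r, ε * e 4 r],
      fun r => ![e 0 r, e 1 r, e 2 r, e 3 r, ε⁻¹ * e 4 r],
      fun r => ![e 0 r, e 1 r, e 2 r, e 3 r, ε⁻¹ * e 4 r]]) fun ε hε x => ?_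
  simp [tensorO55, tensorM1, formValue_add, formValue_basisTensor, basisTensor_eq, e]
  field_simp

/-- Replacing `b₂` by `b₂ + ε⁻¹ b₃` and `c₃` by `c₃ - ε⁻¹ c₂` preserves `tensorM1` and turns
`a₅ ⊗ b₂ ⊗ c₂` into a multiple of `a₅ ⊗ (b₃ + ε b₂) ⊗ c₂`; scaling `a₅`, `b₅`, `c₅` by `ε`, `ε⁻¹`,
`ε⁻¹` removes the factor. -/
lemma tensorO55_mem_closure_orbit :
    tensorO55 ∈ closure (MulAction.orbit (TensorGroup 5) tensorO56) := by
  let e : Fin 5 → Fin 5 → ℂ := fun i => Pi.single i 1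
  refine mem_closure_orbit (isConcise_fiveTensors 3) 1
    (fun ε => tensorM1 + basisTensor 4 2 1 + ε • basisTensor 4 1 1) (by fun_prop) (by simp; rfl)
    (fun ε => ![fun r => ![e 0 r, e 1 r, e 2 r, e 3 r, ε * e 4 r],
      fun r => ![e 0 r, e 1 r + ε⁻¹ * e 2 r, e 2 r, e 3 r, ε⁻¹ * e 4 r],
      fun r => ![e 0 r, e 1 r, e 2 r - ε⁻¹ * e 1 r, e 3 r, ε⁻¹ * e 4 r]]) fun ε hε x => ?_
  simp [tensorO56, tensorM1, formValue_add, formValue_basisTensor, basisTensor_eq, e]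
  field_simp
  ring

lemma tensorO56_mem_closure_orbit :
    tensorO56 ∈ closure (MulAction.orbit (TensorGroup 5) tensorO57) := by
  let e : Fin 5 → Fin 5 → ℂ := fun i => Pi.single i 1
  have h2 : Equiv.swap (0 : Fin 3) 1 2 = 2 := by decide
  -- The first two factors are exchanged: the quotient planes with two degenerate relations
  -- correspond to each other in this way.
  refine mem_closure_orbit (isConcise_fiveTensors 2) (Equiv.swap 0 1)
    (fun ε => tensorO56 - ε • basisTensor 0 4 1) (by fun_prop) (by simp)
    (fun ε => ![fun r => ![e 3 r, e 4 r, e 0 r - e 4 r, ε⁻¹ * e 1 r, e 2 r],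
      fun r => ![e 2 r, ε⁻¹ * e 3 r, e 4 r + e 0 r, e 0 r, e 1 r],
      fun r => ![e 0 r, ε * e 1 r, e 4 r, e 3 r - e 4 r, e 2 r]]) fun ε hε x => ?_
  simp [tensorO57, tensorO56, tensorM1, tensorM2, formValue_add, formValue_sub,
    formValue_basisTensor, basisTensor_eq, e, h2]
  field_simp
  ring

lemma fiveTensors_mem_closure (n : Fin 5) :
    fiveTensors n ∈ closure {S : Tensor3 5 | IsSumOfPure 5 S} := by
  have h0 := tensorO58_mem_closure
  have h1 := mem_closure_isSumOfPure_of_mem_closure_orbit h0 tensorO57_mem_closure_orbit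
  have h2 := mem_closure_isSumOfPure_of_mem_closure_orbit h1 tensorO56_mem_closure_orbit
  have h3 := mem_closure_isSumOfPure_of_mem_closure_orbit h2 tensorO55_mem_closure_orbit
  have h4 := mem_closure_isSumOfPure_of_mem_closure_orbit h3 tensorO54_mem_closure_orbit
  fin_cases n
  exacts [h0, h1, h2, h3, h4]

end FiveTensors


/-! ### Slices of the five tensors -/

section Slices

lemma sliceMatrix_add (S T : Tensor3 5) (p : Fin 3) (c : Fin 5 → ℂ) :
    sliceMatrix (S + T) p c = sliceMatrix S p c + sliceMatrix T p c := by
  fin_cases p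
  · change contractA (S + T) c = contractA S c + contractA T c
    ext; simp [contractA, mul_add, Finset.sum_add_distrib]
  · change contractB (S + T) c = contractB S c + contractB T c
    ext; simp [contractB, mul_add, Finset.sum_add_distrib]
  · change contractC (S + T) c = contractC S c + contractC T c
    ext; simp [contractC, mul_add, Finset.sum_add_distrib]

lemma sliceMatrix_sub (S T : Tensor3 5) (p : Fin 3) (c : Fin 5 → ℂ) :
    sliceMatrix (S - T) p c = sliceMatrix S p c - sliceMatrix T p c := by
  rw [eq_sub_iff_add_eq, ← sliceMatrix_add, sub_add_cancel]

lemma sliceMatrix_zero_basisTensor (i j k a b : Fin 5) (c : Fin 5 → ℂ) :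
    sliceMatrix (basisTensor i j k) 0 c a b = if a = k ∧ b = j then c i else 0 := by
  change contractA (basisTensor i j k) c a b = _
  by_cases ha : a = k <;> by_cases hb : b = j <;>
    simp [contractA, basisTensor_eq, Pi.single_apply, ha, hb]

lemma sliceMatrix_one_basisTensor (i j k a b : Fin 5) (c : Fin 5 → ℂ) :
    sliceMatrix (basisTensor i j k) 1 c a b = if a = k ∧ b = i then c j else 0 := by
  change contractB (basisTensor i j k) c a b = _
  by_cases ha : a = k <;> by_cases hb : b = i <;>
    simp [contractB, basisTensor_eq, Pi.single_apply, ha, hb]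

lemma sliceMatrix_two_basisTensor (i j k a b : Fin 5) (c : Fin 5 → ℂ) :
    sliceMatrix (basisTensor i j k) 2 c a b = if a = j ∧ b = i then c k else 0 := by
  change contractC (basisTensor i j k) c a b = _
  by_cases ha : a = j <;> by_cases hb : b = i <;>
    simp [contractC, basisTensor_eq, Pi.single_apply, ha, hb]

lemma sliceMatrix_tensorO58_zero (c : Fin 5 → ℂ) :
    sliceMatrix tensorO58 0 c =
      !![c 0, 0, c 1, c 2, c 4;
         c 4, c 0, c 3, -c 1, 0;
         0, 0, c 0, 0, 0;
         0, 0, -c 4, c 0, 0;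
         0, 0, 0, c 4, 0] := by
  ext a b
  simp only [tensorO58, tensorM2, sliceMatrix_add, Matrix.add_apply, sliceMatrix_sub,
    Matrix.sub_apply, sliceMatrix_zero_basisTensor]
  revert a b
  simp [Fin.forall_fin_succ]

lemma sliceMatrix_tensorO58_one (c : Fin 5 → ℂ) :
    sliceMatrix tensorO58 1 c =
      !![c 0, c 2, c 3, 0, c 4;
         c 1, -c 3, 0, c 2, c 0;
         c 2, 0, 0, 0, 0;
         c 3, 0, 0, 0, -c 2;
         0, 0, 0, 0, c 3] := by
  ext a b
  simp only [tensorO58, tensorM2, sliceMatrix_add, Matrix.add_apply, sliceMatrix_sub,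
    Matrix.sub_apply, sliceMatrix_one_basisTensor]
  revert a b
  simp [Fin.forall_fin_succ]

lemma sliceMatrix_tensorO58_two (c : Fin 5 → ℂ) :
    sliceMatrix tensorO58 2 c =
      !![c 0, 0, 0, 0, c 1;
         c 1, 0, 0, 0, 0;
         c 2, c 0, 0, c 1, -c 3;
         c 3, -c 1, c 0, 0, c 4;
         0, 0, 0, 0, c 0] := by
  ext a b
  simp only [tensorO58, tensorM2, sliceMatrix_add, Matrix.add_apply, sliceMatrix_sub,
    Matrix.sub_apply, sliceMatrix_two_basisTensor]
  revert a b
  simp [Fin.forall_fin_succ]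

lemma sliceMatrix_tensorO57_zero (c : Fin 5 → ℂ) :
    sliceMatrix tensorO57 0 c =
      !![c 0, 0, c 1, c 2, c 4;
         0, c 0, c 3, -c 1, 0;
         0, 0, c 0, 0, 0;
         0, 0, 0, c 0, 0;
         0, 0, 0, c 4, 0] := by
  ext a b
  simp only [tensorO57, tensorM2, sliceMatrix_add, Matrix.add_apply, sliceMatrix_sub,
    Matrix.sub_apply, sliceMatrix_zero_basisTensor]
  revert a b
  simp [Fin.forall_fin_succ]

lemma sliceMatrix_tensorO57_one (c : Fin 5 → ℂ) :
    sliceMatrix tensorO57 1 c =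
      !![c 0, c 2, c 3, 0, c 4;
         c 1, -c 3, 0, c 2, 0;
         c 2, 0, 0, 0, 0;
         c 3, 0, 0, 0, 0;
         0, 0, 0, 0, c 3] := by
  ext a b
  simp only [tensorO57, tensorM2, sliceMatrix_add, Matrix.add_apply, sliceMatrix_sub,
    Matrix.sub_apply, sliceMatrix_one_basisTensor]
  revert a b
  simp [Fin.forall_fin_succ]

lemma sliceMatrix_tensorO56_zero (c : Fin 5 → ℂ) :
    sliceMatrix tensorO56 0 c =
      !![c 0, 0, c 1, c 2, c 4;
         0, c 0 + c 4, 0, c 3, 0;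
         0, 0, c 0, 0, 0;
         0, 0, 0, c 0, 0;
         0, 0, 0, c 4, 0] := by
  ext a b
  simp only [tensorO56, tensorM1, sliceMatrix_add, Matrix.add_apply,
    sliceMatrix_zero_basisTensor]
  revert a b
  simp [Fin.forall_fin_succ]

lemma sliceMatrix_tensorO56_one (c : Fin 5 → ℂ) :
    sliceMatrix tensorO56 1 c =
      !![c 0, c 2, c 3, 0, c 4;
         c 1, 0, 0, c 3, c 1;
         c 2, 0, 0, 0, 0;
         c 3, 0, 0, 0, 0;
         0, 0, 0, 0, c 3] := by
  ext a b
  simp only [tensorO56, tensorM1, sliceMatrix_add, Matrix.add_apply,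
    sliceMatrix_one_basisTensor]
  revert a b
  simp [Fin.forall_fin_succ]

lemma sliceMatrix_tensorO56_two (c : Fin 5 → ℂ) :
    sliceMatrix tensorO56 2 c =
      !![c 0, 0, 0, 0, 0;
         c 1, 0, 0, 0, c 1;
         c 2, c 0, 0, 0, 0;
         c 3, 0, c 0, c 1, c 4;
         0, 0, 0, 0, c 0] := by
  ext a b
  simp only [tensorO56, tensorM1, sliceMatrix_add, Matrix.add_apply,
    sliceMatrix_two_basisTensor]
  revert a b
  simp [Fin.forall_fin_succ]

lemma sliceMatrix_tensorO55_zero (c : Fin 5 → ℂ) :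
    sliceMatrix tensorO55 0 c =
      !![c 0, 0, c 1, c 2, c 4;
         0, c 0, c 4, c 3, 0;
         0, 0, c 0, 0, 0;
         0, 0, 0, c 0, 0;
         0, 0, 0, c 4, 0] := by
  ext a b
  simp only [tensorO55, tensorM1, sliceMatrix_add, Matrix.add_apply,
    sliceMatrix_zero_basisTensor]
  revert a b
  simp [Fin.forall_fin_succ]

lemma sliceMatrix_tensorO55_one (c : Fin 5 → ℂ) :
    sliceMatrix tensorO55 1 c =
      !![c 0, c 2, c 3, 0, c 4;
         c 1, 0, 0, c 3, c 2;
         c 2, 0, 0, 0, 0;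
         c 3, 0, 0, 0, 0;
         0, 0, 0, 0, c 3] := by
  ext a b
  simp only [tensorO55, tensorM1, sliceMatrix_add, Matrix.add_apply,
    sliceMatrix_one_basisTensor]
  revert a b
  simp [Fin.forall_fin_succ]

lemma sliceMatrix_tensorO55_two (c : Fin 5 → ℂ) :
    sliceMatrix tensorO55 2 c =
      !![c 0, 0, 0, 0, 0;
         c 1, 0, 0, 0, 0;
         c 2, c 0, 0, 0, c 1;
         c 3, 0, c 0, c 1, c 4;
         0, 0, 0, 0, c 0] := by
  ext a b
  simp only [tensorO55, tensorM1, sliceMatrix_add, Matrix.add_apply,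
    sliceMatrix_two_basisTensor]
  revert a b
  simp [Fin.forall_fin_succ]

lemma sliceMatrix_tensorO54_zero (c : Fin 5 → ℂ) :
    sliceMatrix tensorO54 0 c =
      !![c 0, 0, c 1, c 2, c 4;
         0, c 0, 0, c 3, 0;
         0, 0, c 0, 0, 0;
         0, 0, 0, c 0, 0;
         0, 0, 0, c 4, 0] := by
  ext a b
  simp only [tensorO54, tensorM1, sliceMatrix_add, Matrix.add_apply,
    sliceMatrix_zero_basisTensor]
  revert a b
  simp [Fin.forall_fin_succ]

lemma sliceMatrix_tensorO54_one (c : Fin 5 → ℂ) :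
    sliceMatrix tensorO54 1 c =
      !![c 0, c 2, c 3, 0, c 4;
         c 1, 0, 0, c 3, 0;
         c 2, 0, 0, 0, 0;
         c 3, 0, 0, 0, 0;
         0, 0, 0, 0, c 3] := by
  ext a b
  simp only [tensorO54, tensorM1, sliceMatrix_add, Matrix.add_apply,
    sliceMatrix_one_basisTensor]
  revert a b
  simp [Fin.forall_fin_succ]

lemma sliceMatrix_tensorO54_two (c : Fin 5 → ℂ) :
    sliceMatrix tensorO54 2 c =
      !![c 0, 0, 0, 0, 0;
         c 1, 0, 0, 0, 0;
         c 2, c 0, 0, 0, 0;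
         c 3, 0, c 0, c 1, c 4;
         0, 0, 0, 0, c 0] := by
  ext a b
  simp only [tensorO54, tensorM1, sliceMatrix_add, Matrix.add_apply,
    sliceMatrix_two_basisTensor]
  revert a b
  simp [Fin.forall_fin_succ]

end Slices


/-! ### The five orbits are different -/

section Distinct

lemma linearIndependent_single_single {i j : Fin 5} (h : i ≠ j) :
    LinearIndependent ℂ ![(Pi.single i 1 : Fin 5 → ℂ), Pi.single j 1] := by
  rw [LinearIndependent.pair_iff]
  intro s t hst
  have hi := congrFun hst i
  have hj := congrFun hst j
  simp [h, h.symm] at hi hj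
  exact ⟨hi, hj⟩

lemma not_hasSlicePlane_tensorO58 (p : Fin 3) : ¬ HasSlicePlane tensorO58 p := by
  fin_cases p
  · refine not_hasSlicePlane 1 2 3 one_ne_zero fun c h => ?_
    have h1 := h.minor_two 0 1 0 1
    have h2 := h.minor_two 0 4 3 4
    have h3 := h.minor_two 0 1 2 3
    simp only [Fin.zero_eta, sliceMatrix_tensorO58_zero] at h1 h2 h3
    simp at h1 h2 h3
    exact ⟨fun a => by fin_cases a <;> simp [h1, h2], by linear_combination -h3⟩
  · refine not_hasSlicePlane 0 1 4 (neg_ne_zero.2 one_ne_zero) fun c h => ?_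
    have h1 := h.minor_two 1 2 0 3
    have h2 := h.minor_two 0 3 0 2
    have h3 := h.minor_two 0 1 0 4
    simp only [Fin.mk_one, sliceMatrix_tensorO58_one] at h1 h2 h3
    simp at h1 h2 h3
    exact ⟨fun a => by fin_cases a <;> simp [h1, h2], by linear_combination h3⟩
  · refine not_hasSlicePlane 3 2 4 one_ne_zero fun c h => ?_
    have h1 := h.minor_two 0 4 0 4
    have h2 := h.minor_two 1 2 0 3
    have h3 := h.minor_two 2 3 0 4
    simp only [Fin.reduceFinMk, sliceMatrix_tensorO58_two] at h1 h2 h3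
    simp at h1 h2 h3
    exact ⟨fun a => by fin_cases a <;> simp [h1, h2], by linear_combination h3⟩

lemma not_hasSlicePlane_tensorO57 : ¬ HasSlicePlane tensorO57 0 := by
  refine not_hasSlicePlane 1 2 3 one_ne_zero fun c h => ?_
  have h1 := h.minor_two 0 1 0 1
  have h2 := h.minor_two 0 4 3 4
  have h3 := h.minor_two 0 1 2 3
  simp only [sliceMatrix_tensorO57_zero] at h1 h2 h3
  simp at h1 h2 h3
  exact ⟨fun a => by fin_cases a <;> simp [h1, h2], by linear_combination -h3⟩

lemma hasSlicePlane_tensorO57 : HasSlicePlane tensorO57 1 := by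
  refine ⟨Pi.single 0 1, Pi.single 4 1, linearIndependent_single_single (by decide), fun s t =>
    isSliceRankLE_of_eq_sum ![![1, 0, 0, 0, 0]] ![![s, 0, 0, 0, t]] ?_⟩
  rw [sliceMatrix_tensorO57_one]
  simp [Fin.forall_fin_succ]

lemma hasSlicePlane_of_eq {T : Tensor3 5} (hT : T = tensorO56 ∨ T = tensorO55 ∨ T = tensorO54)
    (p : Fin 3) : HasSlicePlane T p := by
  fin_cases p
  · refine ⟨Pi.single 1 1, Pi.single 2 1, linearIndependent_single_single (by decide), fun s t =>
      isSliceRankLE_of_eq_sum ![![1, 0, 0, 0, 0]] ![![0, 0, s, t, 0]] ?_⟩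
    rcases hT with rfl | rfl | rfl <;> simp only [Fin.zero_eta, sliceMatrix_tensorO56_zero,
      sliceMatrix_tensorO55_zero, sliceMatrix_tensorO54_zero] <;> simp [Fin.forall_fin_succ]
  · refine ⟨Pi.single 0 1, Pi.single 4 1, linearIndependent_single_single (by decide), fun s t =>
      isSliceRankLE_of_eq_sum ![![1, 0, 0, 0, 0]] ![![s, 0, 0, 0, t]] ?_⟩
    rcases hT with rfl | rfl | rfl <;> simp only [Fin.mk_one, sliceMatrix_tensorO56_one,
      sliceMatrix_tensorO55_one, sliceMatrix_tensorO54_one] <;> simp [Fin.forall_fin_succ]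
  · refine ⟨Pi.single 2 1, Pi.single 3 1, linearIndependent_single_single (by decide), fun s t =>
      isSliceRankLE_of_eq_sum ![![0, 0, s, t, 0]] ![![1, 0, 0, 0, 0]] ?_⟩
    rcases hT with rfl | rfl | rfl <;> simp only [Fin.reduceFinMk, sliceMatrix_tensorO56_two,
      sliceMatrix_tensorO55_two, sliceMatrix_tensorO54_two] <;> simp [Fin.forall_fin_succ]

lemma not_isSliceHyperplane_tensorO56 (l : (Fin 5 → ℂ) →ₗ[ℂ] ℂ) :
    ¬ IsSliceHyperplane tensorO56 0 2 l := by
  refine fun hl => hl.false_of_coordinates (i := 0) (j := 4) (by decide) fun c h => ?_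
  have h1 := (Matrix.det_fin_three _).symm.trans (h.det_submatrix ![0, 2, 3] ![0, 2, 3])
  have h2 := (Matrix.det_fin_three _).symm.trans (h.det_submatrix ![0, 1, 4] ![1, 3, 4])
  simp only [Matrix.submatrix_apply, sliceMatrix_tensorO56_zero] at h1 h2
  simp at h1 h2
  simp_all

lemma hasTwoSliceHyperplanes_tensorO56 : HasTwoSliceHyperplanes tensorO56 0 3 := by
  refine ⟨LinearMap.proj (R := ℂ) (φ := fun _ : Fin 5 => ℂ) 0,
    LinearMap.proj (R := ℂ) (φ := fun _ : Fin 5 => ℂ) 0 + LinearMap.proj 4,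
    fun c hc => ?_, fun c hc => ?_, Pi.single 4 1, by simp, ?_⟩
  · have h0 : c 0 = 0 := hc
    refine isSliceRankLE_of_eq_sum ![Pi.single 0 1, Pi.single 1 1, Pi.single 4 1]
      ![![0, 0, c 1, c 2, c 4], ![0, c 4, 0, c 3, 0], ![0, 0, 0, c 4, 0]] ?_
    rw [sliceMatrix_tensorO56_zero, h0]
    simp [Fin.forall_fin_succ, Fin.sum_univ_succ]
  · have h0 : c 0 + c 4 = 0 := hc
    refine isSliceRankLE_of_eq_sum ![Pi.single 0 1, Pi.single 2 1, ![0, c 3, 0, c 0, c 4]]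
      ![![c 0, 0, c 1, c 2, c 4], ![0, 0, c 0, 0, 0], ![0, 0, 0, 1, 0]] ?_
    rw [sliceMatrix_tensorO56_zero, h0]
    simp [Fin.forall_fin_succ, Fin.sum_univ_succ]
  · change (Pi.single 4 1 : Fin 5 → ℂ) 0 + (Pi.single 4 1 : Fin 5 → ℂ) 4 ≠ 0
    simp

lemma not_isSliceHyperplane_tensorO55 (l : (Fin 5 → ℂ) →ₗ[ℂ] ℂ) :
    ¬ IsSliceHyperplane tensorO55 0 2 l := by
  refine fun hl => hl.false_of_coordinates (i := 0) (j := 4) (by decide) fun c h => ?_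
  have h1 := (Matrix.det_fin_three _).symm.trans (h.det_submatrix ![0, 2, 3] ![0, 2, 3])
  have h2 := (Matrix.det_fin_three _).symm.trans (h.det_submatrix ![0, 1, 4] ![2, 3, 4])
  simp only [Matrix.submatrix_apply, sliceMatrix_tensorO55_zero] at h1 h2
  simp at h1 h2
  simp_all

lemma not_hasTwoSliceHyperplanes_tensorO55 (p : Fin 3) :
    ¬ HasTwoSliceHyperplanes tensorO55 p 3 := by
  fin_cases p
  · refine not_hasTwoSliceHyperplanes 0 fun c h => ?_
    have h1 := h.prod_eq_zero_of_triangular ![0, 1, 2, 3] ![0, 1, 2, 3]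
    simp only [Fin.zero_eta, sliceMatrix_tensorO55_zero] at h1
    simpa [Fin.forall_fin_succ, Fin.prod_univ_succ] using h1
  · refine not_hasTwoSliceHyperplanes 3 fun c h => ?_
    have h1 := h.prod_eq_zero_of_triangular ![0, 1, 3, 4] ![2, 3, 0, 4]
    simp only [Fin.mk_one, sliceMatrix_tensorO55_one] at h1
    simpa [Fin.forall_fin_succ, Fin.prod_univ_succ] using h1
  · refine not_hasTwoSliceHyperplanes 0 fun c h => ?_
    have h1 := h.prod_eq_zero_of_triangular ![3, 2, 0, 4] ![2, 1, 0, 4]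
    simp only [Fin.reduceFinMk, sliceMatrix_tensorO55_two] at h1
    simpa [Fin.forall_fin_succ, Fin.prod_univ_succ] using h1

lemma exists_isSliceHyperplane_tensorO54 (p : Fin 3) : ∃ l, IsSliceHyperplane tensorO54 p 2 l := by
  fin_cases p
  · refine ⟨LinearMap.proj 0, fun c hc => ?_⟩
    have h0 : c 0 = 0 := hc
    refine isSliceRankLE_of_eq_sum ![Pi.single 0 1, ![0, c 3, 0, 0, c 4]]
      ![![0, 0, c 1, c 2, c 4], Pi.single 3 1] ?_
    simp only [Fin.zero_eta, sliceMatrix_tensorO54_zero, h0]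
    simp [Fin.forall_fin_succ, Fin.sum_univ_succ]
  · refine ⟨LinearMap.proj 3, fun c hc => ?_⟩
    have h0 : c 3 = 0 := hc
    refine isSliceRankLE_of_eq_sum ![Pi.single 0 1, ![c 0, c 1, c 2, 0, 0]]
      ![![0, c 2, 0, 0, c 4], Pi.single 0 1] ?_
    simp only [Fin.mk_one, sliceMatrix_tensorO54_one, h0]
    simp [Fin.forall_fin_succ, Fin.sum_univ_succ]
  · refine ⟨LinearMap.proj 0, fun c hc => ?_⟩
    have h0 : c 0 = 0 := hc
    refine isSliceRankLE_of_eq_sum ![Pi.single 3 1, ![0, c 1, c 2, c 3, 0]]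
      ![![0, 0, 0, c 1, c 4], Pi.single 0 1] ?_
    simp only [Fin.reduceFinMk, sliceMatrix_tensorO54_two, h0]
    simp [Fin.forall_fin_succ, Fin.sum_univ_succ]

/-- A property of the factors of a tensor that is carried along by the action. -/
lemma forall_of_forall_smul {m : ℕ} {Q : Tensor3 m → Fin 3 → Prop}
    (hQ : ∀ (h : TensorGroup m) T p, Q T p → Q (h • T) (h.right p)) {S T : Tensor3 m}
    (hS : S ∈ MulAction.orbit (TensorGroup m) T) :
    ((∃ p, Q T p) → ∃ p, Q S p) ∧ ((∀ p, Q T p) → ∀ p, Q S p) := by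
  obtain ⟨h, rfl⟩ := hS
  refine ⟨fun ⟨p, hp⟩ => ⟨_, hQ h T p hp⟩, fun hT p => ?_⟩
  have := hQ h T _ (hT (h.right.symm p))
  rwa [Equiv.apply_symm_apply] at this

/-- The orbits are separated by the loci of slices of low rank. Planes of slices of rank one occur
for no factor of `tensorO58`, for some but not all factors of `tensorO57`, and for all factors of the
other tensors. Among these, only `tensorO54` has for each factor a hyperplane of slices of rank at
most two, and `tensorO56`, unlike `tensorO55`, has for some factor two hyperplanes of slices of rank
at most three. -/
theorem fiveTensors_notMem_orbit {n n' : Fin 5} (hne : n ≠ n') :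
    fiveTensors n' ∉ MulAction.orbit (TensorGroup 5) (fiveTensors n) := by
  wlog hlt : n < n' generalizing n n'
  · exact fun hmem => this hne.symm (lt_of_le_of_ne (not_lt.1 hlt) hne.symm)
      (MulAction.mem_orbit_symm.1 hmem)
  intro hmem
  have hmem' := MulAction.mem_orbit_symm.1 hmem
  have hplane := forall_of_forall_smul (Q := HasSlicePlane) (fun h T p hp => hp.smul h) hmem'
  have htwo := forall_of_forall_smul (Q := fun T p => HasTwoSliceHyperplanes T p 3)
    (fun h T p hp => hp.smul h) hmem
  have hhyp := forall_of_forall_smul (Q := fun T p => ∃ l, IsSliceHyperplane T p 2 l)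
    (fun h T p hp => hp.elim fun l hl => ⟨_, hl.smul h⟩) hmem'
  have h4 : (∃ l, IsSliceHyperplane tensorO56 0 2 l) → False :=
    fun ⟨l, hl⟩ => not_isSliceHyperplane_tensorO56 l hl
  have h5 : (∃ l, IsSliceHyperplane tensorO55 0 2 l) → False :=
    fun ⟨l, hl⟩ => not_isSliceHyperplane_tensorO55 l hl
  have h58 : ∀ p, HasSlicePlane tensorO58 p → False := not_hasSlicePlane_tensorO58
  have h55 : ∀ p, HasTwoSliceHyperplanes tensorO55 p 3 → False :=
    not_hasTwoSliceHyperplanes_tensorO55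
  have h6 := hasSlicePlane_of_eq (.inl rfl : tensorO56 = _ ∨ _)
  have h5' := hasSlicePlane_of_eq (.inr (.inl rfl) : tensorO55 = _ ∨ _)
  have h4' := hasSlicePlane_of_eq (.inr (.inr rfl) : tensorO54 = _ ∨ _)
  fin_cases n <;> fin_cases n' <;> first | exact absurd hlt (by decide) | skip
  · exact (hplane.1 ⟨1, hasSlicePlane_tensorO57⟩).elim h58
  · exact (hplane.1 ⟨0, h6 0⟩).elim h58
  · exact (hplane.1 ⟨0, h5' 0⟩).elim h58
  · exact (hplane.1 ⟨0, h4' 0⟩).elim h58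
  · exact not_hasSlicePlane_tensorO57 (hplane.2 h6 0)
  · exact not_hasSlicePlane_tensorO57 (hplane.2 h5' 0)
  · exact not_hasSlicePlane_tensorO57 (hplane.2 h4' 0)
  · exact (htwo.1 ⟨0, hasTwoSliceHyperplanes_tensorO56⟩).elim h55
  · exact h4 (hhyp.2 exists_isSliceHyperplane_tensorO54 0)
  · exact h5 (hhyp.2 exists_isSliceHyperplane_tensorO54 0)

end Distinct

theorem theorem1p6 :
    -- the five tensors are concise, `1`-degenerate and of minimal border rank
    (∀ n : Fin 5, IsConcise (fiveTensors n) ∧ IsOneDegenerate (fiveTensors n) ∧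
      HasMinimalBorderRank (fiveTensors n)) ∧
    -- they lie in pairwise different orbits
    (∀ n n' : Fin 5, n ≠ n' →
      fiveTensors n' ∉ MulAction.orbit (TensorGroup 5) (fiveTensors n)) ∧
    -- every such tensor lies in one of the five orbits
    (∀ T : Tensor3 5, IsConcise T → IsOneDegenerate T → HasMinimalBorderRank T →
      ∃ n : Fin 5, T ∈ MulAction.orbit (TensorGroup 5) (fiveTensors n)) ∧
    -- the presentations as spaces of matrices
    (∀ x₁ x₂ x₃ x₄ x₅ : ℂ,
      contractA tensorO58 ![x₁, x₂, x₃, x₄, x₅] =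
        !![x₁, 0, x₂, x₃, x₅;
           x₅, x₁, x₄, -x₂, 0;
           0, 0, x₁, 0, 0;
           0, 0, -x₅, x₁, 0;
           0, 0, 0, x₅, 0] ∧
      contractA tensorO57 ![x₁, x₂, x₃, x₄, x₅] =
        !![x₁, 0, x₂, x₃, x₅;
           0, x₁, x₄, -x₂, 0;
           0, 0, x₁, 0, 0;
           0, 0, 0, x₁, 0;
           0, 0, 0, x₅, 0] ∧
      contractA tensorO56 ![x₁, x₂, x₃, x₄, x₅] =
        !![x₁, 0, x₂, x₃, x₅;
           0, x₁ + x₅, 0, x₄, 0;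
           0, 0, x₁, 0, 0;
           0, 0, 0, x₁, 0;
           0, 0, 0, x₅, 0] ∧
      contractA tensorO55 ![x₁, x₂, x₃, x₄, x₅] =
        !![x₁, 0, x₂, x₃, x₅;
           0, x₁, x₅, x₄, 0;
           0, 0, x₁, 0, 0;
           0, 0, 0, x₁, 0;
           0, 0, 0, x₅, 0] ∧
      contractA tensorO54 ![x₁, x₂, x₃, x₄, x₅] =
        !![x₁, 0, x₂, x₃, x₅;
           0, x₁, 0, x₄, 0;
           0, 0, x₁, 0, 0;
           0, 0, 0, x₁, 0;
           0, 0, 0, x₅, 0]) ∧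
    -- each subsequent tensor lies in the closure of the orbit of the previous one
    (tensorO57 ∈ closure (MulAction.orbit (TensorGroup 5) tensorO58) ∧
      tensorO56 ∈ closure (MulAction.orbit (TensorGroup 5) tensorO57) ∧
      tensorO55 ∈ closure (MulAction.orbit (TensorGroup 5) tensorO56) ∧
      tensorO54 ∈ closure (MulAction.orbit (TensorGroup 5) tensorO55)) := by
  refine ⟨fun n => ⟨isConcise_fiveTensors n, isOneDegenerate_fiveTensors n,
    (isConcise_fiveTensors n).hasMinimalBorderRank (fiveTensors_mem_closure n)⟩,
    fun n n' => fiveTensors_notMem_orbit, fun T => exists_mem_orbit_fiveTensors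
      isConcise_fiveTensors, fun x₁ x₂ x₃ x₄ x₅ => ⟨?_, ?_, ?_, ?_, ?_⟩,
    tensorO57_mem_closure_orbit, tensorO56_mem_closure_orbit, tensorO55_mem_closure_orbit,
    tensorO54_mem_closure_orbit⟩
  exacts [sliceMatrix_tensorO58_zero ![x₁, x₂, x₃, x₄, x₅],
    sliceMatrix_tensorO57_zero ![x₁, x₂, x₃, x₄, x₅],
    sliceMatrix_tensorO56_zero ![x₁, x₂, x₃, x₄, x₅],
    sliceMatrix_tensorO55_zero ![x₁, x₂, x₃, x₄, x₅],
    sliceMatrix_tensorO54_zero ![x₁, x₂, x₃, x₄, x₅]]
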